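/- **Model.** There are $n$ customer types and $m$ resources. In each period $t=1,\dots,T$ one customer arrives; the types $j(1),j(2),\dots$ are i.i.d. with $P(j(t)=j)=\lambda_j$, $\lambda_j\ge 0$, $\sum_j\lambda_j=1$. Accepting a type-$j$ customer earns $r_j\ge 0$ and consumes $a_{ij}\ge 0$ units of each resource $i$; every type consumes at least one resource. Write $A_j=(a_{1j},\dots,a_{mj})^\top$, $A=[A_1,\dots,A_n]$. The initial capacities are $C_i=\rho_iT$ with fixed $\rho_i>0$, and all $O(\cdot)$ are for $T\to\infty$ with $m,n,\lambda,r,A,\rho$ fixed. Let $\Lambda_j(s,t)$ be the number of type-$j$ arrivals in periods $s,\dots,t$. For $B\in\mathbb R^m$ let $H(B,t)$ be the maximum of $\sum_jr_jz_j$ over real $z$ with $\sum_jA_jz_j\le B$ and $0\le z_j\le\Lambda_j(t,T)$. The hindsight optimum is $V^{\mathsf{HO}}=H(C,1)$. Call a capacity vector $B$ *sufficient* if $A_j\le B$ for all $j$. **Assumption 1 (general position).** For every $p\in\mathbb R^m$, at most $m$ of the $m+n$ equations $p^\top A_j=r_j$ ($j\le n$), $p_i=0$ ($i\le m$) hold.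 **Subroutine FF** with start time $t_1$, capacity $B$, length $L$. Let $\bar\alpha_i=\max_{j:a_{ij}\ne0}r_j/a_{ij}$ (and $0$ if no $a_{ij}\neq 0$), $\bar a=\max_{i,j}a_{ij}$, $\bar\theta=\frac{\max_iB_i}{\min_iB_i}\sum_i\bar\alpha_i$, $D=\bar\theta\sqrt m$, $G=\frac{\max_iB_i}{L}\sqrt m+\bar a\sqrt m$. Start with prices $\theta^{(t_1)}=0$ and remaining capacity $B$. In period $t$, if the remaining capacity is sufficient, set $y_t=1$ if $r_{j(t)}>\sum_i\theta^{(t)}_ia_{i,j(t)}$ and $y_t=0$ otherwise, subtract $y_tA_{j(t)}$ from the remaining capacity, and set $\theta_i^{(t+1)}=\min\{\max\{0,\theta_i^{(t)}-\eta_t(B_i/L-y_ta_{i,j(t)})\},\bar\theta\}$ with $\eta_t=\frac{D}{G\sqrt{t-t_1+1}}$. Once the remaining capacity is not sufficient the run stops, and $y_t=0$ from then on. **Algorithm FD** with parameters $\alpha,\beta,\gamma$. Put $a=\alpha$, $b=\frac12+\beta$, $c=\frac\alpha2+\gamma$, $l_1=\lceil T^a\rceil$, $l_2=\lceil T-T^a-T^b\rceil$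 ($l_2=0$ if this is negative). *Phase I* (periods $1,\dots,l_1$): follow FF with start time $1$, capacity $\frac{l_1}{T}C$, length $L=l_1$. Let $x_j$ be the number of type-$j$ customers accepted; put $j$ in $\mathcal R$ if $x_j<\lambda_jT^c$, otherwise in $\mathcal A$ if $x_j>\lambda_j(T^a-T^c)$. *Phase II* (the next $l_2$ periods): set $B(l_1+1)=\frac{T-l_1}{T}C$ and run FF with start time $l_1+1$, capacity $\frac{T-l_1}TC$, length $L=T-l_1$ on a virtual copy of the capacities, giving decisions $y_t$ (this run updates its prices and its virtual capacity with $y_t$ for all arriving types). While $B(t)$ is sufficient, the real decision is $z_t=0$ if $j(t)\in\mathcal R$, $z_t=1$ if $j(t)\in\mathcal A$, $z_t=y_t$ otherwise, and $B(t+1)=B(t)-z_tA_{j(t)}$; once $B(t)$ is not sufficient, everybody is rejected until the end of the phase. *Phase III* (the remaining periods): run FF with start time $l_1+l_2+1$, length $L=T-l_1-l_2$ and virtual capacities $\max\{T^{3b/4},\min\{B_i(l_1+l_2+1),\bar aT^b\}\}$, giving $y_t$; the real decision is $z_t=y_t$ if $A_{j(t)}\le B(t)$ and $z_t=0$ otherwise,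 and $B(t+1)=B(t)-z_tA_{j(t)}$. Let $V^{\mathsf{FD}}$ be the total revenue of FD. Policy H-I follows FD in phase I and then earns $H(B(l_1+1),l_1+1)$; policy H-II follows FD in phases I and II and then earns $H(B(l_1+l_2+1),l_1+l_2+1)$. Their revenues are $V^{\mathsf{H}\text{-I}}$ and $V^{\mathsf{H}\text{-II}}$. **Proposition.** Let $0<\alpha<\frac12$, $\frac\alpha2\le\beta<\frac12$, $0<\gamma<\frac\alpha2$, and let $\varepsilon$ satisfy $0<\varepsilon<2\gamma$, $\varepsilon\le\beta$, $\varepsilon\ge\frac{\log\log T}{\log T}$. The parameters $\alpha,\beta,\gamma,\varepsilon$ may depend on $T$ (the inequalities being required for all large $T$), provided that $T^{2\gamma-\varepsilon}\to\infty$ and $T^{\alpha/2-\gamma}\to\infty$; for parameters that do not depend on $T$ these two conditions hold automatically. Under Assumption 1, $$\mathbf E[V^{\mathsf{HO}}-V^{\mathsf{FD}}]=\mathbf E[V^{\mathsf{HO}}-V^{\mathsf{H}\text{-I}}]+\mathbf E[V^{\mathsf{H}\text{-I}}-V^{\mathsf{H}\text{-II}}]+\mathbf E[V^{\mathsf{H}\text{-II}}-V^{\mathsf{FD}}]$$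 (all expectations being finite), and 1. $\mathbf E[V^{\mathsf{HO}}-V^{\mathsf{H}\text{-I}}]=O(T^a)$; 2. $\mathbf E[V^{\mathsf{H}\text{-I}}-V^{\mathsf{H}\text{-II}}]=O(Te^{-T^\varepsilon})$; 3. $\mathbf E[V^{\mathsf{H}\text{-II}}-V^{\mathsf{FD}}]=O\big(T^{\frac34b+\frac\varepsilon2}\big)$. -/

import Mathlib

open MeasureTheory ProbabilityTheory Filter Topology Asymptotics

namespace NRM

/-- The data of a network revenue management problem with `m` resources and `n` customer types:
arrival probabilities `lam j`, revenues `r j`, resource consumptions `A i j`, and the capacity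
`rho i` per period.  With horizon `T` the initial capacity of resource `i` is `C i = T * rho i`,
so that horizon and capacities grow proportionally. -/
structure Model (m n : ℕ) where
  lam : Fin n → ℝ
  r : Fin n → ℝ
  A : Matrix (Fin m) (Fin n) ℝ
  rho : Fin m → ℝ

/-- The standing assumptions of the model. -/
structure Model.Valid {m n : ℕ} (M : Model m n) : Prop where
  lam_nonneg : ∀ j, 0 ≤ M.lam j
  lam_sum : ∑ j, M.lam j = 1
  r_nonneg : ∀ j, 0 ≤ M.r j
  A_nonneg : ∀ i j, 0 ≤ M.A i j
  /-- every customer type consumes at least one resource -/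
  A_used : ∀ j, ∃ i, M.A i j ≠ 0
  rho_pos : ∀ i, 0 < M.rho i

variable {m n : ℕ}

/-- General position: with `Abar = [A, I]` and `rbar = (r, 0)`, every bid price vector `p`
satisfies `pᵀ Abar_l = rbar_l` for at most `m` of the `m + n` columns `l`. -/
def Model.GeneralPosition (M : Model m n) : Prop :=
  ∀ p : Fin m → ℝ,
    {l : Fin n ⊕ Fin m |
      Matrix.vecMul p (Matrix.fromCols M.A (1 : Matrix (Fin m) (Fin m) ℝ)) l =
        (Sum.elim M.r (fun _ => 0) : Fin n ⊕ Fin m → ℝ) l}.ncard ≤ m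

/-- Initial capacities for horizon `T`. -/
def Model.C (M : Model m n) (T : ℕ) : Fin m → ℝ := fun i => (T : ℝ) * M.rho i

/-! ### Arrivals and the hindsight linear program

An arrival sequence is `s : ℕ → Fin n`; `s t` is the type arriving in period `t = 1, 2, …`
(the entry `s 0` is not used). -/

/-- `Λ_j(t₁, t₂)`: number of arrivals of type `j` in periods `t₁, …, t₂`. -/
def arrivals (s : ℕ → Fin n) (j : Fin n) (t₁ t₂ : ℕ) : ℕ :=
  ((Finset.Icc t₁ t₂).filter (fun t => s t = j)).card

/-- Optimal value of the hindsight linear program for periods `t, …, T` with capacity `B`: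
maximize `∑ r_j z_j` subject to `A z ≤ B` and `0 ≤ z_j ≤ Λ_j(t, T)`. -/
noncomputable def Model.hindsight (M : Model m n) (s : ℕ → Fin n) (B : Fin m → ℝ) (t T : ℕ) : ℝ :=
  sSup {v : ℝ | ∃ z : Fin n → ℝ,
    (∀ i, ∑ j, M.A i j * z j ≤ B i) ∧
    (∀ j, 0 ≤ z j ∧ z j ≤ (arrivals s j t T : ℝ)) ∧
    v = ∑ j, M.r j * z j}

/-! ### Algorithm FF (bid prices updated by online gradient descent) -/

/-- `ᾱ_i`: the maximum of `r_j / a_ij` over the types `j` with `a_ij ≠ 0`. -/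
noncomputable def Model.alphaBar (M : Model m n) (i : Fin m) : ℝ :=
  sSup {x : ℝ | ∃ j, M.A i j ≠ 0 ∧ x = M.r j / M.A i j}

/-- `ā`: the maximum of all `a_ij`. -/
noncomputable def Model.aBar (M : Model m n) : ℝ :=
  ⨆ q : Fin m × Fin n, M.A q.1 q.2

/-- `θ̄ = (B_max / B_min) ∑ ᾱ_i`. -/
noncomputable def Model.thetaBar (M : Model m n) (B : Fin m → ℝ) : ℝ :=
  (⨆ i, B i) / (⨅ i, B i) * ∑ i, M.alphaBar i

/-- Diameter bound `D = θ̄ √m`. -/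
noncomputable def Model.diamBound (M : Model m n) (B : Fin m → ℝ) : ℝ :=
  M.thetaBar B * √(m : ℝ)

/-- Gradient bound `G = (B_max / L) √m + ā √m`. -/
noncomputable def Model.gradBound (M : Model m n) (B : Fin m → ℝ) (L : ℝ) : ℝ :=
  (⨆ i, B i) / L * √(m : ℝ) + M.aBar * √(m : ℝ)

/-- The resources `B` suffice for a customer of any type. -/
def Model.Sufficient (M : Model m n) (B : Fin m → ℝ) : Prop :=
  ∀ i j, M.A i j ≤ B i

open scoped Classical in
/-- Bid price decision: `1` if `r_j > ∑ θ_i a_ij`, and `0` otherwise. -/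
noncomputable def Model.bid (M : Model m n) (θ : Fin m → ℝ) (j : Fin n) : ℝ :=
  if ∑ i, θ i * M.A i j < M.r j then 1 else 0

/-- Projected gradient step in the `k`-th period (`k = 1, 2, …`) of a run with initial capacity `B`
and length `L`, for `g(θ) = ∑ θ_i (B_i / L - y a_ij)` and step size `D / (G √k)`. -/
noncomputable def Model.priceStep (M : Model m n) (B : Fin m → ℝ) (L : ℝ) (k : ℕ)
    (θ : Fin m → ℝ) (y : ℝ) (j : Fin n) : Fin m → ℝ := fun i =>
  min (max 0 (θ i - M.diamBound B / (M.gradBound B L * √(k : ℝ)) * (B i / L - y * M.A i j)))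
    (M.thetaBar B)

/-- State of a run of Algorithm FF: bid prices and remaining capacities. -/
structure FFState (m : ℕ) where
  price : Fin m → ℝ
  cap : Fin m → ℝ

open scoped Classical in
/-- State of Algorithm FF, started in period `t₁` with capacity `B` and length `L`, at the beginning
of period `t₁ + k`.  When the capacities no longer suffice, the run stops: the state is frozen. -/
noncomputable def Model.ffState (M : Model m n) (s : ℕ → Fin n) (B : Fin m → ℝ) (L : ℝ) (t₁ : ℕ) :
    ℕ → FFState m
  | 0 => ⟨fun _ => 0, B⟩
  | k + 1 =>
    let S := M.ffState s B L t₁ k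
    let j := s (t₁ + k)
    if M.Sufficient S.cap then
      ⟨M.priceStep B L (k + 1) S.price (M.bid S.price j) j,
        fun i => S.cap i - M.bid S.price j * M.A i j⟩
    else S

open scoped Classical in
/-- Decision (`1` accept, `0` reject) of that run in period `t₁ + k`; once the run has stopped
every customer is rejected. -/
noncomputable def Model.ffDecision (M : Model m n) (s : ℕ → Fin n) (B : Fin m → ℝ) (L : ℝ)
    (t₁ k : ℕ) : ℝ :=
  if M.Sufficient (M.ffState s B L t₁ k).cap then
    M.bid (M.ffState s B L t₁ k).price (s (t₁ + k))
  else 0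

/-! ### Algorithm FD with parameters `α, β, γ`

`a = α`, `b = 1/2 + β`, `c = α/2 + γ`. -/

/-- Length of phase I: `⌈T^a⌉`. -/
noncomputable def len1 (T : ℕ) (α : ℝ) : ℕ := ⌈(T : ℝ) ^ α⌉₊

/-- Length of phase II: `⌈T - T^a - T^b⌉`. -/
noncomputable def len2 (T : ℕ) (α β : ℝ) : ℕ :=
  ⌈(T : ℝ) - (T : ℝ) ^ α - (T : ℝ) ^ (1 / 2 + β)⌉₊

/-- Decision in period `1 + k` of phase I: Algorithm FF with capacity `C l₁ / T`, spread over the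
`l₁` periods of the phase. -/
noncomputable def Model.decI (M : Model m n) (T : ℕ) (α : ℝ) (s : ℕ → Fin n) (k : ℕ) : ℝ :=
  M.ffDecision s (fun i => M.C T i * ((len1 T α : ℝ) / T)) (len1 T α) 1 k

/-- Number of type-`j` customers accepted in phase I. -/
noncomputable def Model.acceptedI (M : Model m n) (T : ℕ) (α : ℝ) (s : ℕ → Fin n) (j : Fin n) : ℝ :=
  ∑ k ∈ Finset.range (len1 T α), if s (1 + k) = j then M.decI T α s k else 0

/-- The class `R` of types to be rejected in phase II. -/
def Model.rejectClass (M : Model m n) (T : ℕ) (α γ : ℝ) (s : ℕ → Fin n) : Set (Fin n) :=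
  {j | M.acceptedI T α s j < M.lam j * (T : ℝ) ^ (α / 2 + γ)}

/-- The class `A` of types to be accepted in phase II. -/
def Model.acceptClass (M : Model m n) (T : ℕ) (α γ : ℝ) (s : ℕ → Fin n) : Set (Fin n) :=
  {j | ¬ M.acceptedI T α s j < M.lam j * (T : ℝ) ^ (α / 2 + γ) ∧
    M.lam j * ((T : ℝ) ^ α - (T : ℝ) ^ (α / 2 + γ)) < M.acceptedI T α s j}

/-- Capacity `C (T - l₁) / T` at the beginning of phase II. -/
noncomputable def Model.capStartII (M : Model m n) (T : ℕ) (α : ℝ) : Fin m → ℝ :=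
  fun i => M.C T i * (((T : ℝ) - len1 T α) / T)

/-- Decision `y_t`, `t = 1 + l₁ + k`, of the run of Algorithm FF on the virtual capacity `B'`.
This run updates `B'` and the bid prices for all arriving types with its own decisions `y_t`. -/
noncomputable def Model.subII (M : Model m n) (T : ℕ) (α : ℝ) (s : ℕ → Fin n) (k : ℕ) : ℝ :=
  M.ffDecision s (M.capStartII T α) ((T : ℝ) - len1 T α) (1 + len1 T α) k

open scoped Classical in
/-- Decision in period `1 + l₁ + k` of phase II, given the real remaining capacity `B`.
If `B` is not sufficient the phase is over and everybody is rejected. -/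
noncomputable def Model.decII (M : Model m n) (T : ℕ) (α γ : ℝ) (s : ℕ → Fin n) (B : Fin m → ℝ)
    (k : ℕ) : ℝ :=
  if M.Sufficient B then
    if s (1 + len1 T α + k) ∈ M.rejectClass T α γ s then 0
    else if s (1 + len1 T α + k) ∈ M.acceptClass T α γ s then 1
    else M.subII T α s k
  else 0

/-- Real remaining capacity at the beginning of period `1 + l₁ + k` of phase II. -/
noncomputable def Model.capII (M : Model m n) (T : ℕ) (α γ : ℝ) (s : ℕ → Fin n) :
    ℕ → Fin m → ℝ
  | 0 => M.capStartII T α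
  | k + 1 => fun i => M.capII T α γ s k i -
      M.decII T α γ s (M.capII T α γ s k) k * M.A i (s (1 + len1 T α + k))

/-- Real remaining capacity at the beginning of phase III. -/
noncomputable def Model.capStartIII (M : Model m n) (T : ℕ) (α β γ : ℝ) (s : ℕ → Fin n) :
    Fin m → ℝ :=
  M.capII T α γ s (len2 T α β)

/-- Virtual capacity `B''` at the beginning of phase III:
`max {T^(3b/4), min {B_i, ā T^b}}`. -/
noncomputable def Model.virtCapIII (M : Model m n) (T : ℕ) (α β γ : ℝ) (s : ℕ → Fin n) :
    Fin m → ℝ := fun i =>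
  max ((T : ℝ) ^ (3 / 4 * (1 / 2 + β)))
    (min (M.capStartIII T α β γ s i) (M.aBar * (T : ℝ) ^ (1 / 2 + β)))

/-- Decision `y_t`, `t = 1 + l₁ + l₂ + k`, of the run of Algorithm FF on `B''`. -/
noncomputable def Model.subIII (M : Model m n) (T : ℕ) (α β γ : ℝ) (s : ℕ → Fin n) (k : ℕ) : ℝ :=
  M.ffDecision s (M.virtCapIII T α β γ s) ((T : ℝ) - len1 T α - len2 T α β)
    (1 + len1 T α + len2 T α β) k

open scoped Classical in
/-- Decision in period `1 + l₁ + l₂ + k` of phase III, given the real remaining capacity `B`: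
the decision of the run on `B''`, if `B` suffices for the arriving customer. -/
noncomputable def Model.decIII (M : Model m n) (T : ℕ) (α β γ : ℝ) (s : ℕ → Fin n)
    (B : Fin m → ℝ) (k : ℕ) : ℝ :=
  if ∀ i, M.A i (s (1 + len1 T α + len2 T α β + k)) ≤ B i then M.subIII T α β γ s k else 0

/-- Real remaining capacity at the beginning of period `1 + l₁ + l₂ + k` of phase III. -/
noncomputable def Model.capIII (M : Model m n) (T : ℕ) (α β γ : ℝ) (s : ℕ → Fin n) :
    ℕ → Fin m → ℝ
  | 0 => M.capStartIII T α β γ s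
  | k + 1 => fun i => M.capIII T α β γ s k i -
      M.decIII T α β γ s (M.capIII T α β γ s k) k * M.A i (s (1 + len1 T α + len2 T α β + k))

/-! ### Revenues -/

/-- Revenue of Algorithm FD in phase I. -/
noncomputable def Model.revI (M : Model m n) (T : ℕ) (α : ℝ) (s : ℕ → Fin n) : ℝ :=
  ∑ k ∈ Finset.range (len1 T α), M.r (s (1 + k)) * M.decI T α s k

/-- Revenue of Algorithm FD in phase II. -/
noncomputable def Model.revII (M : Model m n) (T : ℕ) (α β γ : ℝ) (s : ℕ → Fin n) : ℝ :=
  ∑ k ∈ Finset.range (len2 T α β),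
    M.r (s (1 + len1 T α + k)) * M.decII T α γ s (M.capII T α γ s k) k

/-- Revenue of Algorithm FD in phase III. -/
noncomputable def Model.revIII (M : Model m n) (T : ℕ) (α β γ : ℝ) (s : ℕ → Fin n) : ℝ :=
  ∑ k ∈ Finset.range (T - (len1 T α + len2 T α β)),
    M.r (s (1 + len1 T α + len2 T α β + k)) *
      M.decIII T α β γ s (M.capIII T α β γ s k) k

/-- Hindsight optimal revenue `V^HO`. -/
noncomputable def Model.VHO (M : Model m n) (T : ℕ) (s : ℕ → Fin n) : ℝ :=
  M.hindsight s (M.C T) 1 T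

/-- Revenue of H-I: Algorithm FD in phase I, then the hindsight optimum for the periods from
`l₁ + 1` on with the capacity at the beginning of phase II. -/
noncomputable def Model.VHI (M : Model m n) (T : ℕ) (α : ℝ) (s : ℕ → Fin n) : ℝ :=
  M.revI T α s + M.hindsight s (M.capStartII T α) (len1 T α + 1) T

/-- Revenue of H-II: Algorithm FD in phases I and II, then the hindsight optimum for the periods
from `l₁ + l₂ + 1` on with the remaining capacity. -/
noncomputable def Model.VHII (M : Model m n) (T : ℕ) (α β γ : ℝ) (s : ℕ → Fin n) : ℝ :=
  M.revI T α s + M.revII T α β γ s +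
    M.hindsight s (M.capStartIII T α β γ s) (len1 T α + len2 T α β + 1) T

/-- Revenue `V^FD` of Algorithm FD. -/
noncomputable def Model.VFD (M : Model m n) (T : ℕ) (α β γ : ℝ) (s : ℕ → Fin n) : ℝ :=
  M.revI T α s + M.revII T α β γ s + M.revIII T α β γ s

end NRM

namespace NRM

/-! ### Elementary facts on the model constants -/

section Constants

variable {m n : ℕ} {M : Model m n}

/-! The three losses have different causes, and only the second needs general position.

Phase I. It lasts about `T^a` periods and its capacity is a proportional share. Shrinking a
hindsight plan by the factor `(T - l₁) / T` and truncating it to the later arrivals costs a multiple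
of `l₁` (`abs_VHO_sub_VHI_le`), on every path.

Algorithm FF. The price update is projected gradient descent, resource by resource, so its regret
against any fixed price `u` in `[0, θ̄]` is of order `θ̄ √k` (`regret_le`). Rewriting the regret
bound, the revenue of a run is at least the dual objective collected at the current prices plus `∑
u_i (consumption - target)_i`, up to that error (`revenue_ge`). If a run stops, some resource is
nearly exhausted; putting the price `θ̄` on it pays for all the lost periods, since `θ̄` times the
rate of that resource dominates the dual value at `ᾱ` (`revenue_full_ge`).

Phase III. Weak duality bounds the hindsight optimum by the dual objective at a minimizer, collected
along the arrivals. The prices of FF are predictable and their dual values are no smaller than the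
minimum, so the difference of the two sums has nonpositive expectation after the compensation for
stopped periods. What remains is the regret term, and the customers whom the virtual capacity admits
but the real one cannot serve; both are of order `T^(3b/4)` because of the floor `T^(3b/4)` in the
virtual capacity.

Phase II. Outside an event of probability `O(exp(-T^ε))` there is no loss at all. General position
makes the columns of the equations tight at a dual price vector linearly independent, so the fluid
problem has a sharp maximum `x`: any plan that is optimal and feasible up to `e` lies within `O(e)`
of the corresponding multiple of `x` (`exists_sharp`). Hence the acceptances of phase I follow `l₁
x` and the thresholds classify the types correctly (`eventually_classified`). An optimal plan `z`
for the remaining horizon also follows `x`. If the acceptances `w` of phase II follow `l₂ x`, then,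
phase III being much longer than all fluctuations, `w_j ≤ z_j ≤ w_j +` (arrivals of type `j` in
phase III), so `z` can still be completed and nothing is lost.

The delicate point is that `w` is read off a run of FF that is interrupted before the end of its
horizon, where feasibility of the consumption does not come for free. It suffices that consumption
never runs far ahead of its target rate (`ExcessControl`). This holds if the cap `θ̄` on the prices
is above every `ᾱ_i`, for then the prices record the whole excess, or if some dual minimizer has `∑
p_i < θ̄`, for then the penalty `θ̄` beats the value of the excess. If both fail, general position
leaves only one configuration: a single type is served, partially, from a single resource that
matters (`IsSingle`), and there the claim is checked directly from revenue and capacity.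

The exceptional event is a large deviation of finitely many martingales with bounded increments,
controlled by `azuma`. -/

lemma Model.le_aBar (M : Model m n) (i : Fin m) (j : Fin n) : M.A i j ≤ M.aBar :=
  le_ciSup (f := fun q : Fin m × Fin n => M.A q.1 q.2) (Set.finite_range _).bddAbove (i, j)

lemma Model.Valid.nonempty_types (hM : M.Valid) : Nonempty (Fin n) := by
  by_contra h
  rw [not_nonempty_iff] at h
  have := hM.lam_sum
  simp at this

lemma Model.Valid.nonempty_resources (hM : M.Valid) : Nonempty (Fin m) :=
  let ⟨j⟩ := hM.nonempty_types
  let ⟨i, _⟩ := hM.A_used j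
  ⟨i⟩

lemma Model.Valid.aBar_pos (hM : M.Valid) : 0 < M.aBar := by
  obtain ⟨j⟩ := hM.nonempty_types
  obtain ⟨i, hi⟩ := hM.A_used j
  exact (lt_of_le_of_ne (hM.A_nonneg i j) (Ne.symm hi)).trans_le (M.le_aBar i j)

lemma Model.Valid.alphaBar_nonneg (hM : M.Valid) (i : Fin m) : 0 ≤ M.alphaBar i := by
  apply Real.sSup_nonneg
  rintro x ⟨j, -, rfl⟩
  exact div_nonneg (hM.r_nonneg j) (hM.A_nonneg i j)

lemma Model.finite_ratios (M : Model m n) (i : Fin m) :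
    {x : ℝ | ∃ j, M.A i j ≠ 0 ∧ x = M.r j / M.A i j}.Finite := by
  apply (Set.finite_range (fun j => M.r j / M.A i j)).subset
  rintro x ⟨j, -, rfl⟩
  exact ⟨j, rfl⟩

lemma Model.ratio_le_alphaBar (M : Model m n) {i : Fin m} {j : Fin n} (h : M.A i j ≠ 0) :
    M.r j / M.A i j ≤ M.alphaBar i :=
  le_csSup (M.finite_ratios i).bddAbove ⟨j, h, rfl⟩

lemma Model.Valid.r_le_alphaBar_mul (hM : M.Valid) {i : Fin m} {j : Fin n} (h : M.A i j ≠ 0) :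
    M.r j ≤ M.alphaBar i * M.A i j := by
  have hpos : 0 < M.A i j := lt_of_le_of_ne (hM.A_nonneg i j) (Ne.symm h)
  exact (div_le_iff₀ hpos).1 (M.ratio_le_alphaBar h)

lemma Model.Valid.r_le_sum_alphaBar (hM : M.Valid) (j : Fin n) :
    M.r j ≤ ∑ i, M.alphaBar i * M.A i j := by
  obtain ⟨i, hi⟩ := hM.A_used j
  refine (hM.r_le_alphaBar_mul hi).trans ?_
  exact Finset.single_le_sum (f := fun i => M.alphaBar i * M.A i j)
    (fun i _ => mul_nonneg (hM.alphaBar_nonneg i) (hM.A_nonneg i j)) (Finset.mem_univ i)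

/-- Sum of the revenues, a bound for every single revenue. -/
noncomputable def Model.rTot (M : Model m n) : ℝ := ∑ j, M.r j

lemma Model.Valid.r_le_rTot (hM : M.Valid) (j : Fin n) : M.r j ≤ M.rTot :=
  Finset.single_le_sum (f := M.r) (fun j _ => hM.r_nonneg j) (Finset.mem_univ j)

lemma Model.Valid.rTot_nonneg (hM : M.Valid) : 0 ≤ M.rTot :=
  Finset.sum_nonneg fun j _ => hM.r_nonneg j

end Constants

/-! ### Largest and smallest capacity -/

section Capacity

variable {m : ℕ} {B : Fin m → ℝ}

lemma le_iSup_fin (B : Fin m → ℝ) (i : Fin m) : B i ≤ ⨆ i, B i :=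
  le_ciSup (Set.finite_range B).bddAbove i

lemma iInf_fin_le (B : Fin m → ℝ) (i : Fin m) : ⨅ i, B i ≤ B i :=
  ciInf_le (Set.finite_range B).bddBelow i

lemma iInf_fin_pos [Nonempty (Fin m)] (hB : ∀ i, 0 < B i) : 0 < ⨅ i, B i := by
  obtain ⟨i, hi⟩ := exists_eq_ciInf_of_finite (f := B)
  rw [← hi]
  exact hB i

lemma iSup_fin_pos [Nonempty (Fin m)] (hB : ∀ i, 0 < B i) : 0 < ⨆ i, B i :=
  let ⟨i⟩ := ‹Nonempty (Fin m)›
  (hB i).trans_le (le_iSup_fin B i)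

end Capacity

variable {m n : ℕ} {M : Model m n}

lemma Model.Valid.thetaBar_nonneg (hM : M.Valid) {B : Fin m → ℝ} (hB : ∀ i, 0 < B i) :
    0 ≤ M.thetaBar B := by
  have := hM.nonempty_resources
  exact mul_nonneg (div_nonneg (iSup_fin_pos hB).le (iInf_fin_pos hB).le)
    (Finset.sum_nonneg fun i _ => hM.alphaBar_nonneg i)

/-- Bound on a single component of the gradients used by Algorithm FF. -/
noncomputable def Model.slope (M : Model m n) (B : Fin m → ℝ) (L : ℝ) : ℝ :=
  (⨆ i, B i) / L + M.aBar

lemma Model.Valid.slope_pos (hM : M.Valid) {B : Fin m → ℝ} (hB : ∀ i, 0 < B i) {L : ℝ}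
    (hL : 0 < L) : 0 < M.slope B L := by
  have := hM.nonempty_resources
  exact add_pos (div_pos (iSup_fin_pos hB) hL) hM.aBar_pos

/-- The factor `√m` occurs in both the diameter and the gradient bound and cancels, so each resource
separately performs one-dimensional gradient descent with diameter `θ̄` and gradient bound `slope`.
-/
lemma Model.Valid.step_size (hM : M.Valid) (B : Fin m → ℝ) (L x : ℝ) :
    M.diamBound B / (M.gradBound B L * x) = M.thetaBar B / (M.slope B L * x) := by
  obtain ⟨i⟩ := hM.nonempty_resources
  have hm : (0 : ℝ) < √(m : ℝ) := Real.sqrt_pos.2 (by exact_mod_cast i.pos)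
  have h : M.gradBound B L * x = M.slope B L * x * √(m : ℝ) := by
    rw [Model.gradBound, Model.slope]; ring
  rw [h, Model.diamBound, mul_div_mul_right _ _ hm.ne']

/-! ### Projected gradient descent in one dimension -/

lemma sq_clip_sub_le {x u Θ : ℝ} (h0 : 0 ≤ u) (h1 : u ≤ Θ) :
    (min (max 0 x) Θ - u) ^ 2 ≤ (x - u) ^ 2 := by
  rw [sq_le_sq]
  rcases le_total x 0 with h | h
  · rw [max_eq_left h, min_eq_left (h0.trans h1), abs_of_nonpos (by linarith),
      abs_of_nonpos (by linarith)]
    linarith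
  · rw [max_eq_right h]
    rcases le_total x Θ with h' | h'
    · rw [min_eq_left h']
    · rw [min_eq_right h', abs_of_nonneg (by linarith), abs_of_nonneg (by linarith)]
      linarith

lemma clip_mem {x Θ : ℝ} (h : 0 ≤ Θ) : 0 ≤ min (max 0 x) Θ ∧ min (max 0 x) Θ ≤ Θ :=
  ⟨le_min (le_max_left _ _) h, min_le_right _ _⟩

lemma inv_two_sqrt_succ_le (k : ℕ) :
    1 / (2 * √((k + 1 : ℕ) : ℝ)) ≤ √((k + 1 : ℕ) : ℝ) - √(k : ℝ) := by
  have h1 : 0 < √((k + 1 : ℕ) : ℝ) := Real.sqrt_pos.2 (by positivity)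
  have h0 : 0 ≤ √(k : ℝ) := Real.sqrt_nonneg _
  have e1 : √((k + 1 : ℕ) : ℝ) ^ 2 = k + 1 := by rw [Real.sq_sqrt (by positivity)]; push_cast; ring
  have e0 : √(k : ℝ) ^ 2 = k := Real.sq_sqrt (by positivity)
  rw [div_le_iff₀ (by positivity)]
  nlinarith [sq_nonneg (√((k + 1 : ℕ) : ℝ) - √(k : ℝ))]

/-- One step of the potential argument for projected gradient descent with step sizes
`Θ / (G √k)`. -/
lemma gradient_step_le {Θ G θ u g R : ℝ} (k : ℕ) (hΘ : 0 < Θ) (hG : 0 < G) (hθ : 0 ≤ θ ∧ θ ≤ Θ)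
    (hu : 0 ≤ u ∧ u ≤ Θ) (hg : |g| ≤ G)
    (hR : R ≤ 3 / 2 * Θ * G * √(k : ℝ) - (θ - u) ^ 2 * G * √(k : ℝ) / (2 * Θ)) :
    R + (θ - u) * g ≤ 3 / 2 * Θ * G * √((k + 1 : ℕ) : ℝ) -
      (min (max 0 (θ - Θ / (G * √((k + 1 : ℕ) : ℝ)) * g)) Θ - u) ^ 2 * G * √((k + 1 : ℕ) : ℝ)
        / (2 * Θ) := by
  set w := √((k + 1 : ℕ) : ℝ) with hw
  set v := √(k : ℝ) with hv
  have hw0 : 0 < w := Real.sqrt_pos.2 (by positivity)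
  have hvw : 1 / (2 * w) ≤ w - v := inv_two_sqrt_succ_le k
  have hclip := sq_clip_sub_le (x := θ - Θ / (G * w) * g) hu.1 hu.2
  set d := min (max 0 (θ - Θ / (G * w) * g)) Θ - u
  have h1 : d ^ 2 * G * w / (2 * Θ) ≤ (θ - Θ / (G * w) * g - u) ^ 2 * G * w / (2 * Θ) := by
    gcongr
  have h2 : (θ - Θ / (G * w) * g - u) ^ 2 * G * w / (2 * Θ) =
      (θ - u) ^ 2 * G * w / (2 * Θ) - (θ - u) * g + g ^ 2 / G * Θ * (1 / (2 * w)) := by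
    field_simp
    ring
  have h3 : g ^ 2 / G ≤ G := by
    rw [div_le_iff₀ hG, ← sq]
    exact sq_le_sq' (by linarith [neg_abs_le g]) ((le_abs_self g).trans hg)
  -- Both errors telescope along `√k`: the squared gradient contributes `Θ G (w - v)` and the growth
  -- of the weight on the squared distance contributes `Θ G (w - v) / 2`. This is the constant `3 /
  -- 2`.
  have h4 : g ^ 2 / G * Θ * (1 / (2 * w)) ≤ G * Θ * (w - v) := by gcongr
  have h5 : (θ - u) ^ 2 ≤ Θ ^ 2 := by
    apply sq_le_sq' <;> linarith [hθ.1, hθ.2, hu.1, hu.2]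
  have h6 : (θ - u) ^ 2 * (G * (w - v) / (2 * Θ)) ≤ Θ ^ 2 * (G * (w - v) / (2 * Θ)) := by
    have : 0 ≤ w - v := le_trans (by positivity) hvw
    gcongr
  have h7 : Θ ^ 2 * (G * (w - v) / (2 * Θ)) = Θ * G * (w - v) / 2 := by field_simp
  have h8 : (θ - u) ^ 2 * (G * (w - v) / (2 * Θ)) =
      (θ - u) ^ 2 * G * w / (2 * Θ) - (θ - u) ^ 2 * G * v / (2 * Θ) := by ring
  nlinarith

/-! ### Runs of Algorithm FF -/

section Run

variable (M) (s : ℕ → Fin n) (B : Fin m → ℝ) (L : ℝ) (t₁ : ℕ)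

/-- The run of Algorithm FF has not stopped before period `t₁ + k`. -/
def Model.Active (k : ℕ) : Prop := M.Sufficient (M.ffState s B L t₁ k).cap

open scoped Classical in
/-- Indicator of the event that the run is active. -/
noncomputable def Model.act (k : ℕ) : ℝ := if M.Active s B L t₁ k then 1 else 0

/-- Bid prices of the run. -/
noncomputable def Model.price (k : ℕ) : Fin m → ℝ := (M.ffState s B L t₁ k).price

/-- Virtual consumption of resource `i` in the first `k` periods of the run. -/
noncomputable def Model.used (i : Fin m) (k : ℕ) : ℝ :=
  ∑ t ∈ Finset.range k, M.ffDecision s B L t₁ t * M.A i (s (t₁ + t))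

/-- Number of active periods among the first `k` ones. -/
noncomputable def Model.activeTime (k : ℕ) : ℝ := ∑ t ∈ Finset.range k, M.act s B L t₁ t

/-- Number of type-`j` customers accepted in the first `k` periods of the run. -/
noncomputable def Model.ffCount (k : ℕ) (j : Fin n) : ℝ :=
  ∑ t ∈ Finset.range k, if s (t₁ + t) = j then M.ffDecision s B L t₁ t else 0

/-- Number of type-`j` customers who arrive while the run is active. -/
noncomputable def Model.ffArrivals (k : ℕ) (j : Fin n) : ℝ :=
  ∑ t ∈ Finset.range k, if s (t₁ + t) = j then M.act s B L t₁ t else 0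

end Run

/-! ### Bookkeeping of a run, regret of the prices, and the resulting revenue bound -/

section RunLemmas

variable {s : ℕ → Fin n} {B : Fin m → ℝ} {L : ℝ} {t₁ : ℕ}

lemma Model.bid_mem (M : Model m n) (θ : Fin m → ℝ) (j : Fin n) :
    M.bid θ j = 0 ∨ M.bid θ j = 1 := by
  unfold Model.bid; split_ifs <;> simp

lemma Model.bid_nonneg (M : Model m n) (θ : Fin m → ℝ) (j : Fin n) : 0 ≤ M.bid θ j := by
  rcases M.bid_mem θ j with h | h <;> simp [h]

lemma Model.bid_le_one (M : Model m n) (θ : Fin m → ℝ) (j : Fin n) : M.bid θ j ≤ 1 := by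
  rcases M.bid_mem θ j with h | h <;> simp [h]

lemma Model.act_of_active {k : ℕ} (h : M.Active s B L t₁ k) : M.act s B L t₁ k = 1 := if_pos h

lemma Model.act_of_not_active {k : ℕ} (h : ¬ M.Active s B L t₁ k) : M.act s B L t₁ k = 0 :=
  if_neg h

lemma Model.act_mem (M : Model m n) (s : ℕ → Fin n) (B : Fin m → ℝ) (L : ℝ) (t₁ k : ℕ) :
    M.act s B L t₁ k = 0 ∨ M.act s B L t₁ k = 1 := by
  unfold Model.act; split_ifs <;> simp

lemma Model.act_nonneg (M : Model m n) (s : ℕ → Fin n) (B : Fin m → ℝ) (L : ℝ) (t₁ k : ℕ) :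
    0 ≤ M.act s B L t₁ k := by
  rcases M.act_mem s B L t₁ k with h | h <;> simp [h]

lemma Model.act_le_one (M : Model m n) (s : ℕ → Fin n) (B : Fin m → ℝ) (L : ℝ) (t₁ k : ℕ) :
    M.act s B L t₁ k ≤ 1 := by
  rcases M.act_mem s B L t₁ k with h | h <;> simp [h]

lemma Model.ffDecision_eq (M : Model m n) (s : ℕ → Fin n) (B : Fin m → ℝ) (L : ℝ) (t₁ k : ℕ) :
    M.ffDecision s B L t₁ k =
      M.act s B L t₁ k * M.bid (M.price s B L t₁ k) (s (t₁ + k)) := by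
  unfold Model.ffDecision Model.act Model.price Model.Active
  split_ifs <;> simp

lemma Model.ffDecision_nonneg (M : Model m n) (s : ℕ → Fin n) (B : Fin m → ℝ) (L : ℝ)
    (t₁ k : ℕ) : 0 ≤ M.ffDecision s B L t₁ k := by
  rw [M.ffDecision_eq]; exact mul_nonneg (M.act_nonneg ..) (M.bid_nonneg ..)

lemma Model.ffDecision_le_act (M : Model m n) (s : ℕ → Fin n) (B : Fin m → ℝ) (L : ℝ)
    (t₁ k : ℕ) : M.ffDecision s B L t₁ k ≤ M.act s B L t₁ k := by
  rw [M.ffDecision_eq]; exact mul_le_of_le_one_right (M.act_nonneg ..) (M.bid_le_one ..)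

lemma Model.ffDecision_le_one (M : Model m n) (s : ℕ → Fin n) (B : Fin m → ℝ) (L : ℝ)
    (t₁ k : ℕ) : M.ffDecision s B L t₁ k ≤ 1 :=
  (M.ffDecision_le_act s B L t₁ k).trans (M.act_le_one ..)

lemma Model.ffState_succ_of_active {k : ℕ} (h : M.Active s B L t₁ k) :
    M.ffState s B L t₁ (k + 1) =
      ⟨M.priceStep B L (k + 1) (M.price s B L t₁ k)
          (M.bid (M.price s B L t₁ k) (s (t₁ + k))) (s (t₁ + k)),
        fun i => (M.ffState s B L t₁ k).cap i -
          M.bid (M.price s B L t₁ k) (s (t₁ + k)) * M.A i (s (t₁ + k))⟩ := by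
  unfold Model.Active at h
  rw [Model.ffState]
  simp only [if_pos h, Model.price]

lemma Model.ffState_succ_of_not_active {k : ℕ} (h : ¬ M.Active s B L t₁ k) :
    M.ffState s B L t₁ (k + 1) = M.ffState s B L t₁ k := by
  unfold Model.Active at h
  rw [Model.ffState]
  simp only [if_neg h]

lemma Model.Active.of_succ {k : ℕ} (h : M.Active s B L t₁ (k + 1)) : M.Active s B L t₁ k := by
  by_contra h'
  apply h'
  unfold Model.Active at h ⊢
  rwa [Model.ffState_succ_of_not_active h'] at h

lemma Model.Active.mono {k l : ℕ} (h : M.Active s B L t₁ l) (hkl : k ≤ l) :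
    M.Active s B L t₁ k := by
  induction l, hkl using Nat.le_induction with
  | base => exact h
  | succ l _ ih => exact ih h.of_succ

lemma Model.cap_eq (M : Model m n) (s : ℕ → Fin n) (B : Fin m → ℝ) (L : ℝ) (t₁ k : ℕ)
    (i : Fin m) : (M.ffState s B L t₁ k).cap i = B i - M.used s B L t₁ i k := by
  induction k with
  | zero => simp [Model.ffState, Model.used]
  | succ k ih =>
    rw [Model.used, Finset.sum_range_succ, M.ffDecision_eq, ← Model.used]
    by_cases h : M.Active s B L t₁ k
    · rw [Model.ffState_succ_of_active h, Model.act_of_active h]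
      simp only [ih]
      ring
    · rw [Model.ffState_succ_of_not_active h, Model.act_of_not_active h, ih]
      ring

lemma Model.Valid.cap_nonneg (hM : M.Valid) (hB : ∀ i, 0 ≤ B i) (k : ℕ) (i : Fin m) :
    0 ≤ (M.ffState s B L t₁ k).cap i := by
  induction k with
  | zero => exact hB i
  | succ k ih =>
    by_cases h : M.Active s B L t₁ k
    · rw [Model.ffState_succ_of_active h]
      have h1 : M.A i (s (t₁ + k)) ≤ (M.ffState s B L t₁ k).cap i := h i _
      have h2 : M.bid (M.price s B L t₁ k) (s (t₁ + k)) * M.A i (s (t₁ + k)) ≤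
          M.A i (s (t₁ + k)) := mul_le_of_le_one_left (hM.A_nonneg _ _) (M.bid_le_one _ _)
      simp only
      linarith
    · rw [Model.ffState_succ_of_not_active h]
      exact ih

lemma Model.Valid.used_le (hM : M.Valid) (hB : ∀ i, 0 ≤ B i) (k : ℕ) (i : Fin m) :
    M.used s B L t₁ i k ≤ B i := by
  have := hM.cap_nonneg (s := s) (L := L) (t₁ := t₁) hB k i
  rw [M.cap_eq] at this
  linarith

/-- If the run has stopped, then one of the resources is nearly used up. -/
lemma Model.exists_lt_used_of_not_active {k : ℕ} (h : ¬ M.Active s B L t₁ k) :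
    ∃ i, B i - M.aBar < M.used s B L t₁ i k := by
  unfold Model.Active Model.Sufficient at h
  push Not at h
  obtain ⟨i, j, hij⟩ := h
  rw [M.cap_eq] at hij
  exact ⟨i, by linarith [M.le_aBar i j]⟩

lemma Model.activeTime_of_active {k : ℕ} (h : ∀ t < k, M.Active s B L t₁ t) :
    M.activeTime s B L t₁ k = k := by
  rw [Model.activeTime, Finset.sum_congr rfl
    (fun t ht => Model.act_of_active (h t (Finset.mem_range.1 ht)))]
  simp

lemma Model.activeTime_le (M : Model m n) (s : ℕ → Fin n) (B : Fin m → ℝ) (L : ℝ)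
    (t₁ k : ℕ) : M.activeTime s B L t₁ k ≤ k := by
  refine (Finset.sum_le_sum (fun t _ => M.act_le_one s B L t₁ t)).trans ?_
  simp

lemma Model.ffCount_nonneg (M : Model m n) (s : ℕ → Fin n) (B : Fin m → ℝ) (L : ℝ)
    (t₁ k : ℕ) (j : Fin n) : 0 ≤ M.ffCount s B L t₁ k j :=
  Finset.sum_nonneg fun t _ => by
    split_ifs
    exacts [M.ffDecision_nonneg .., le_rfl]

lemma Model.ffCount_mono (M : Model m n) (s : ℕ → Fin n) (B : Fin m → ℝ) (L : ℝ)
    (t₁ : ℕ) (j : Fin n) : Monotone (fun k => M.ffCount s B L t₁ k j) :=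
  monotone_nat_of_le_succ fun k => by
    simp only [Model.ffCount, Finset.sum_range_succ]
    have : (0 : ℝ) ≤ if s (t₁ + k) = j then M.ffDecision s B L t₁ k else 0 := by
      split_ifs
      exacts [M.ffDecision_nonneg .., le_rfl]
    linarith

lemma Model.ffCount_le_ffArrivals (M : Model m n) (s : ℕ → Fin n) (B : Fin m → ℝ) (L : ℝ)
    (t₁ k : ℕ) (j : Fin n) : M.ffCount s B L t₁ k j ≤ M.ffArrivals s B L t₁ k j :=
  Finset.sum_le_sum fun t _ => by
    split_ifs
    exacts [M.ffDecision_le_act .., le_rfl]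

/-- Summing over periods is summing over types. -/
lemma sum_mul_count (v : Fin n → ℝ) (s : ℕ → Fin n) (t₁ k : ℕ) (d : ℕ → ℝ) :
    ∑ j, v j * ∑ t ∈ Finset.range k, (if s (t₁ + t) = j then d t else 0) =
      ∑ t ∈ Finset.range k, v (s (t₁ + t)) * d t := by
  simp_rw [Finset.mul_sum]
  rw [Finset.sum_comm]
  refine Finset.sum_congr rfl fun t _ => ?_
  simp [mul_ite]

lemma Model.used_eq_sum_ffCount (M : Model m n) (s : ℕ → Fin n) (B : Fin m → ℝ) (L : ℝ)
    (t₁ k : ℕ) (i : Fin m) :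
    M.used s B L t₁ i k = ∑ j, M.A i j * M.ffCount s B L t₁ k j := by
  simp only [Model.ffCount]
  rw [sum_mul_count, Model.used]
  exact Finset.sum_congr rfl fun t _ => mul_comm _ _

lemma Model.Valid.price_mem (hM : M.Valid) (hB : ∀ i, 0 < B i) (k : ℕ) (i : Fin m) :
    0 ≤ M.price s B L t₁ k i ∧ M.price s B L t₁ k i ≤ M.thetaBar B := by
  have hΘ := hM.thetaBar_nonneg hB
  induction k with
  | zero => exact ⟨le_rfl, hΘ⟩
  | succ k ih =>
    by_cases h : M.Active s B L t₁ k
    · rw [Model.price, Model.ffState_succ_of_active h]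
      exact clip_mem hΘ
    · rw [Model.price, Model.ffState_succ_of_not_active h]
      exact ih

lemma Model.Valid.abs_grad_le (hM : M.Valid) (hB : ∀ i, 0 < B i) (hL : 0 < L)
    (θ : Fin m → ℝ) (i : Fin m) (j : Fin n) :
    |B i / L - M.bid θ j * M.A i j| ≤ M.slope B L := by
  have := hM.nonempty_resources
  have h1 : 0 ≤ B i / L := div_nonneg (hB i).le hL.le
  have h2 : B i / L ≤ (⨆ i, B i) / L := div_le_div_of_nonneg_right (le_iSup_fin B i) hL.le
  have h3 : 0 ≤ M.bid θ j * M.A i j := mul_nonneg (M.bid_nonneg ..) (hM.A_nonneg ..)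
  have h4 : M.bid θ j * M.A i j ≤ M.aBar :=
    (mul_le_of_le_one_left (hM.A_nonneg _ _) (M.bid_le_one _ _)).trans (M.le_aBar i j)
  have := hM.aBar_pos
  rw [abs_le, Model.slope]
  constructor <;> linarith

/-- Regret of the price updates of Algorithm FF, for a single resource. -/
lemma Model.Valid.regret_le (hM : M.Valid) (hB : ∀ i, 0 < B i) (hL : 0 < L) (i : Fin m) {u : ℝ}
    (hu : 0 ≤ u ∧ u ≤ M.thetaBar B) (k : ℕ) :
    ∑ t ∈ Finset.range k, M.act s B L t₁ t * ((M.price s B L t₁ t i - u) *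
      (B i / L - M.bid (M.price s B L t₁ t) (s (t₁ + t)) * M.A i (s (t₁ + t)))) ≤
      3 / 2 * M.thetaBar B * M.slope B L * √(k : ℝ) := by
  have hG := hM.slope_pos hB hL
  -- The potential divides by `θ̄`. If `θ̄ = 0`, all prices are zero and the regret vanishes.
  rcases (hM.thetaBar_nonneg hB).eq_or_lt with hΘ | hΘ
  · rw [← hΘ] at hu ⊢
    have hu0 : u = 0 := le_antisymm hu.2 hu.1
    have h0 : ∀ t, M.price s B L t₁ t i = 0 := fun t => by
      have := hM.price_mem (s := s) (L := L) (t₁ := t₁) hB t i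
      rw [← hΘ] at this
      exact le_antisymm this.2 this.1
    simp [h0, hu0]
  · set R := fun k => ∑ t ∈ Finset.range k, M.act s B L t₁ t * ((M.price s B L t₁ t i - u) *
      (B i / L - M.bid (M.price s B L t₁ t) (s (t₁ + t)) * M.A i (s (t₁ + t)))) with hRdef
    -- The bound with the squared distance is an invariant only while the run is active; afterwards
    -- the sum is frozen and the plain bound persists.
    have key : ∀ k, R k ≤ 3 / 2 * M.thetaBar B * M.slope B L * √(k : ℝ) ∧
        (M.Active s B L t₁ k → R k ≤ 3 / 2 * M.thetaBar B * M.slope B L * √(k : ℝ) -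
          (M.price s B L t₁ k i - u) ^ 2 * M.slope B L * √(k : ℝ) / (2 * M.thetaBar B)) := by
      intro k
      induction k with
      | zero => simp [R]
      | succ k ih =>
        by_cases h : M.Active s B L t₁ k
        · have hs := gradient_step_le k hΘ hG
            (hM.price_mem (s := s) (L := L) (t₁ := t₁) hB k i) hu
            (hM.abs_grad_le hB hL (M.price s B L t₁ k) i (s (t₁ + k))) (ih.2 h)
          have hp : M.price s B L t₁ (k + 1) i = min (max 0 (M.price s B L t₁ k i -
              M.thetaBar B / (M.slope B L * √((k + 1 : ℕ) : ℝ)) *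
              (B i / L - M.bid (M.price s B L t₁ k) (s (t₁ + k)) * M.A i (s (t₁ + k)))))
              (M.thetaBar B) := by
            rw [Model.price, Model.ffState_succ_of_active h]
            simp only [Model.priceStep, hM.step_size]
          have hR : R (k + 1) = R k + (M.price s B L t₁ k i - u) *
              (B i / L - M.bid (M.price s B L t₁ k) (s (t₁ + k)) * M.A i (s (t₁ + k))) := by
            simp only [R, Finset.sum_range_succ, Model.act_of_active h, one_mul]
          rw [← hp] at hs
          rw [hR]
          refine ⟨hs.trans (sub_le_self _ ?_), fun _ => hs⟩
          positivity
        · have hR : R (k + 1) = R k := by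
            simp only [R, Finset.sum_range_succ, Model.act_of_not_active h]
            ring
          rw [hR]
          refine ⟨ih.1.trans ?_, fun h' => absurd h'.of_succ h⟩
          have : √(k : ℝ) ≤ √((k + 1 : ℕ) : ℝ) := Real.sqrt_le_sqrt (by push_cast; linarith)
          gcongr
    exact (key k).1

/-- Dual objective of the fluid problem with capacity `c` per period. -/
noncomputable def Model.dual (M : Model m n) (c p : Fin m → ℝ) : ℝ :=
  ∑ i, p i * c i + ∑ j, M.lam j * max 0 (M.r j - ∑ i, p i * M.A i j)

/-- Contribution of a customer of type `j` to the dual objective. -/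
noncomputable def Model.dualAt (M : Model m n) (c p : Fin m → ℝ) (j : Fin n) : ℝ :=
  ∑ i, p i * c i + max 0 (M.r j - ∑ i, p i * M.A i j)

lemma Model.bid_mul (M : Model m n) (θ : Fin m → ℝ) (j : Fin n) :
    M.bid θ j * (M.r j - ∑ i, θ i * M.A i j) = max 0 (M.r j - ∑ i, θ i * M.A i j) := by
  unfold Model.bid
  split_ifs with h
  · rw [one_mul, max_eq_right (by linarith)]
  · rw [zero_mul, max_eq_left (by linarith)]

/-- Lower bound for the revenue of Algorithm FF. -/
lemma Model.Valid.revenue_ge (hM : M.Valid) (hB : ∀ i, 0 < B i) (hL : 0 < L) {u : Fin m → ℝ}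
    (hu : ∀ i, 0 ≤ u i ∧ u i ≤ M.thetaBar B) (k : ℕ) :
    ∑ t ∈ Finset.range k, M.act s B L t₁ t *
        M.dualAt (fun i => B i / L) (M.price s B L t₁ t) (s (t₁ + t)) +
      ∑ i, u i * (M.used s B L t₁ i k - M.activeTime s B L t₁ k * (B i / L)) -
      m * (3 / 2 * M.thetaBar B * M.slope B L * √(k : ℝ)) ≤
    ∑ t ∈ Finset.range k, M.r (s (t₁ + t)) * M.ffDecision s B L t₁ t := by
  have h1 : ∑ i, ∑ t ∈ Finset.range k, M.act s B L t₁ t * ((M.price s B L t₁ t i - u i) *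
      (B i / L - M.bid (M.price s B L t₁ t) (s (t₁ + t)) * M.A i (s (t₁ + t)))) ≤
      ∑ _i : Fin m, 3 / 2 * M.thetaBar B * M.slope B L * √(k : ℝ) :=
    Finset.sum_le_sum fun i _ => hM.regret_le hB hL i (hu i) k
  rw [Finset.sum_const, Finset.card_univ, Fintype.card_fin, nsmul_eq_mul, Finset.sum_comm] at h1
  have h2 : ∑ i, u i * (M.used s B L t₁ i k - M.activeTime s B L t₁ k * (B i / L)) =
      ∑ t ∈ Finset.range k, ∑ i, M.act s B L t₁ t * (u i *
        (M.bid (M.price s B L t₁ t) (s (t₁ + t)) * M.A i (s (t₁ + t)) - B i / L)) := by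
    rw [Finset.sum_comm]
    refine Finset.sum_congr rfl fun i _ => ?_
    rw [Model.used, Model.activeTime, Finset.sum_mul, ← Finset.sum_sub_distrib, Finset.mul_sum]
    refine Finset.sum_congr rfl fun t _ => ?_
    rw [M.ffDecision_eq]
    ring
  -- With `y` the bid decision, `r y` equals the dual contribution at `θ` minus `θ · (c - y a)`.
  -- Splitting `θ = (θ - u) + u` separates the regret against `u` from the excess consumption priced
  -- at `u`.
  have h3 : ∀ t, M.r (s (t₁ + t)) * M.ffDecision s B L t₁ t =
      M.act s B L t₁ t * M.dualAt (fun i => B i / L) (M.price s B L t₁ t) (s (t₁ + t)) +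
      ∑ i, M.act s B L t₁ t * (u i *
        (M.bid (M.price s B L t₁ t) (s (t₁ + t)) * M.A i (s (t₁ + t)) - B i / L)) -
      ∑ i, M.act s B L t₁ t * ((M.price s B L t₁ t i - u i) *
      (B i / L - M.bid (M.price s B L t₁ t) (s (t₁ + t)) * M.A i (s (t₁ + t)))) := by
    intro t
    rw [M.ffDecision_eq, Model.dualAt, ← M.bid_mul, ← Finset.mul_sum, ← Finset.mul_sum]
    have : ∑ i, u i * (M.bid (M.price s B L t₁ t) (s (t₁ + t)) * M.A i (s (t₁ + t)) - B i / L) -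
        ∑ i, (M.price s B L t₁ t i - u i) *
          (B i / L - M.bid (M.price s B L t₁ t) (s (t₁ + t)) * M.A i (s (t₁ + t))) =
        M.bid (M.price s B L t₁ t) (s (t₁ + t)) *
          ∑ i, M.price s B L t₁ t i * M.A i (s (t₁ + t)) -
        ∑ i, M.price s B L t₁ t i * (B i / L) := by
      rw [Finset.mul_sum, ← Finset.sum_sub_distrib, ← Finset.sum_sub_distrib]
      exact Finset.sum_congr rfl fun i _ => by ring
    linear_combination (-(M.act s B L t₁ t)) * this
  rw [Finset.sum_congr rfl fun t _ => h3 t, Finset.sum_sub_distrib, Finset.sum_add_distrib, h2]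
  linarith

end RunLemmas


/-! ### Prices as a record of excess consumption -/

section Excess

variable {s : ℕ → Fin n} {B : Fin m → ℝ} {L : ℝ} {t₁ : ℕ}

/-- A type is only accepted at prices below `alphaBar`. -/
lemma Model.Valid.price_lt_alphaBar (hM : M.Valid) {θ : Fin m → ℝ} (hθ : ∀ i, 0 ≤ θ i) {i : Fin m}
    {j : Fin n} (hA : M.A i j ≠ 0) (hb : M.bid θ j = 1) : θ i < M.alphaBar i := by
  have hpos : 0 < M.A i j := lt_of_le_of_ne (hM.A_nonneg i j) (Ne.symm hA)
  have h1 : ∑ i, θ i * M.A i j < M.r j := by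
    by_contra h
    simp [Model.bid, h] at hb
  have h2 : θ i * M.A i j ≤ ∑ i, θ i * M.A i j :=
    Finset.single_le_sum (f := fun i => θ i * M.A i j)
      (fun i _ => mul_nonneg (hθ i) (hM.A_nonneg i j)) (Finset.mem_univ i)
  have h3 := hM.r_le_alphaBar_mul hA
  exact lt_of_mul_lt_mul_right (by linarith) hpos.le

/-- If the price cap is never effective after the first `k₀` periods, then consumption does not
exceed its target rate by more than the order of `√k`. -/
lemma Model.Valid.excess_le (hM : M.Valid) (hB : ∀ i, 0 < B i) (hL : 0 < L) {i : Fin m}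
    (hi : M.alphaBar i < M.thetaBar B) {k₀ : ℕ}
    (hk₀ : M.thetaBar B ≤ (M.thetaBar B - M.alphaBar i) * √((k₀ + 1 : ℕ) : ℝ)) (k : ℕ) :
    M.used s B L t₁ i k - M.activeTime s B L t₁ k * (B i / L) ≤
      M.aBar * k₀ + M.slope B L * √(k : ℝ) := by
  have hG := hM.slope_pos hB hL
  have hΘ : 0 < M.thetaBar B := (hM.alphaBar_nonneg i).trans_lt hi
  have ha := hM.aBar_pos
  have hc : 0 ≤ B i / L := div_nonneg (hB i).le hL.le
  set E := fun k => M.used s B L t₁ i k - M.activeTime s B L t₁ k * (B i / L) with hE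
  -- As long as the upper clip does not act, the price is at least the excess accumulated so far,
  -- weighted by the step sizes. So the excess after period `k₀` is at most the price divided by the
  -- current step size; the first `k₀` periods cost at most `ā` each.
  have key : ∀ k, E k ≤ M.aBar * k₀ + M.slope B L * √(k : ℝ) ∧ (k ≤ k₀ → E k ≤ M.aBar * k) ∧
      (k₀ ≤ k → M.Active s B L t₁ k → E k ≤ M.aBar * k₀ +
        M.price s B L t₁ k i * (M.slope B L * √(k : ℝ) / M.thetaBar B)) := by
    intro k
    induction k with
    | zero =>
      have h0 : E 0 = 0 := by simp [E, Model.used, Model.activeTime]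
      rw [h0]
      refine ⟨by positivity, fun _ => by positivity, fun _ _ => by simp; positivity⟩
    | succ k ih =>
      have hmono : √(k : ℝ) ≤ √((k + 1 : ℕ) : ℝ) := Real.sqrt_le_sqrt (by push_cast; linarith)
      by_cases h : M.Active s B L t₁ k
      · set g := B i / L - M.bid (M.price s B L t₁ k) (s (t₁ + k)) * M.A i (s (t₁ + k)) with hg
        have hR : E (k + 1) = E k - g := by
          simp only [E, Model.used, Model.activeTime, Finset.sum_range_succ, M.ffDecision_eq,
            Model.act_of_active h]
          rw [hg]; ring
        have hga : -g ≤ M.aBar := by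
          have : M.bid (M.price s B L t₁ k) (s (t₁ + k)) * M.A i (s (t₁ + k)) ≤ M.aBar :=
            (mul_le_of_le_one_left (hM.A_nonneg _ _) (M.bid_le_one _ _)).trans (M.le_aBar i _)
          linarith
        rcases lt_or_ge k k₀ with hk | hk
        · have hE1 : E (k + 1) ≤ M.aBar * (k + 1 : ℕ) := by
            have := ih.2.1 hk.le
            rw [hR]; push_cast; linarith
          have hk' : ((k + 1 : ℕ) : ℝ) ≤ k₀ := by exact_mod_cast hk
          have hE2 : E (k + 1) ≤ M.aBar * k₀ := hE1.trans (by gcongr)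
          have hp := (hM.price_mem (s := s) (L := L) (t₁ := t₁) hB (k + 1) i).1
          refine ⟨hE2.trans ?_, fun _ => hE1, fun _ _ => hE2.trans ?_⟩
          · exact le_add_of_nonneg_right (by positivity)
          · exact le_add_of_nonneg_right (by positivity)
        · set w := √((k + 1 : ℕ) : ℝ) with hw
          have hw0 : 0 < w := Real.sqrt_pos.2 (by positivity)
          have hp : M.price s B L t₁ (k + 1) i = min (max 0 (M.price s B L t₁ k i -
              M.thetaBar B / (M.slope B L * w) * g)) (M.thetaBar B) := by
            rw [Model.price, Model.ffState_succ_of_active h]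
            simp only [Model.priceStep, hM.step_size]
            rw [hw, hg]
          have hp0 := hM.price_mem (s := s) (L := L) (t₁ := t₁) hB k i
          have hstep : M.thetaBar B / (M.slope B L * w) * M.aBar ≤
              M.thetaBar B - M.alphaBar i := by
            have hww : √((k₀ + 1 : ℕ) : ℝ) ≤ w := Real.sqrt_le_sqrt (by exact_mod_cast (by lia))
            have h1 : M.thetaBar B ≤ (M.thetaBar B - M.alphaBar i) * w :=
              hk₀.trans (mul_le_mul_of_nonneg_left hww (by linarith))
            have h2 : M.aBar ≤ M.slope B L := by
              have := hM.nonempty_resources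
              have : 0 ≤ (⨆ i, B i) / L := div_nonneg (iSup_fin_pos hB).le hL.le
              rw [Model.slope]; linarith
            rw [div_mul_eq_mul_div, div_le_iff₀ (by positivity)]
            calc M.thetaBar B * M.aBar ≤ ((M.thetaBar B - M.alphaBar i) * w) * M.slope B L := by
                  gcongr
              _ = _ := by ring
          -- The upper clip does not act: the price only rises when a type using resource `i` is
          -- accepted, which needs a price below `ᾱ_i`, and by `hstep` a rise is at most `θ̄ - ᾱ_i`.
          have hle : M.price s B L t₁ k i - M.thetaBar B / (M.slope B L * w) * g ≤
              M.thetaBar B := by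
            have hη : 0 ≤ M.thetaBar B / (M.slope B L * w) := by positivity
            by_cases hacc : M.A i (s (t₁ + k)) ≠ 0 ∧
                M.bid (M.price s B L t₁ k) (s (t₁ + k)) = 1
            · have := hM.price_lt_alphaBar (fun i =>
                (hM.price_mem (s := s) (L := L) (t₁ := t₁) hB k i).1) hacc.1 hacc.2
              have := mul_le_mul_of_nonneg_left hga hη
              linarith
            · have hg0 : 0 ≤ g := by
                rw [hg]
                by_cases hA : M.A i (s (t₁ + k)) = 0
                · rw [hA]; simpa using hc
                · have : M.bid (M.price s B L t₁ k) (s (t₁ + k)) = 0 :=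
                    (M.bid_mem _ _).resolve_right fun hb => hacc ⟨hA, hb⟩
                  rw [this]; simpa using hc
              have := mul_nonneg hη hg0
              linarith [hp0.2]
          -- The lower clip at zero only raises the price, which is the harmless direction.
          have hge : M.price s B L t₁ k i - M.thetaBar B / (M.slope B L * w) * g ≤
              M.price s B L t₁ (k + 1) i := by
            rw [hp]; exact le_min (le_max_right _ _) hle
          have hgw : -g ≤ (M.price s B L t₁ (k + 1) i - M.price s B L t₁ k i) *
              (M.slope B L * w / M.thetaBar B) := by
            have h1 : M.thetaBar B / (M.slope B L * w) * (-g) ≤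
              M.price s B L t₁ (k + 1) i - M.price s B L t₁ k i := by linarith
            calc -g = M.thetaBar B / (M.slope B L * w) * (-g) *
                  (M.slope B L * w / M.thetaBar B) := by field_simp
              _ ≤ _ := by gcongr
          have hp1 := hM.price_mem (s := s) (L := L) (t₁ := t₁) hB (k + 1) i
          have hvw : M.price s B L t₁ k i * (M.slope B L * √(k : ℝ) / M.thetaBar B) ≤
              M.price s B L t₁ k i * (M.slope B L * w / M.thetaBar B) := by
            have := hp0.1
            gcongr
          have hmain : E (k + 1) ≤ M.aBar * k₀ +
              M.price s B L t₁ (k + 1) i * (M.slope B L * w / M.thetaBar B) := by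
            have := ih.2.2 hk h
            rw [hR]; linarith
          refine ⟨hmain.trans ?_, fun h' => by lia, fun _ _ => hmain⟩
          have : M.price s B L t₁ (k + 1) i * (M.slope B L * w / M.thetaBar B) ≤
              M.thetaBar B * (M.slope B L * w / M.thetaBar B) := by
            gcongr
            exact hp1.2
          have h2 : M.thetaBar B * (M.slope B L * w / M.thetaBar B) = M.slope B L * w := by
            field_simp
          linarith
      · have hR : E (k + 1) = E k := by
          simp only [E, Model.used, Model.activeTime, Finset.sum_range_succ, M.ffDecision_eq,
            Model.act_of_not_active h]
          ring
        rw [hR]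
        refine ⟨ih.1.trans (by gcongr), fun h' => (ih.2.1 (by lia)).trans ?_,
          fun _ h' => absurd h'.of_succ h⟩
        push_cast
        linarith
  exact (key k).1

end Excess

/-! ### The fluid problem -/

/-- Column `l` of the matrix `[A, I]`. -/
def Model.col (M : Model m n) (l : Fin n ⊕ Fin m) : Fin m → ℝ :=
  Sum.elim (fun j i => M.A i j) (fun k => Pi.single k 1) l

/-- Extended revenues `(r, 0)`. -/
def Model.rExt (M : Model m n) : Fin n ⊕ Fin m → ℝ := Sum.elim M.r fun _ => 0

open scoped Classical in
/-- Indices of the equations `pᵀ[A, I] = (r, 0)` satisfied by `p`. -/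
noncomputable def Model.tight (M : Model m n) (p : Fin m → ℝ) : Finset (Fin n ⊕ Fin m) :=
  Finset.univ.filter fun l => p ⬝ᵥ M.col l = M.rExt l

lemma Model.mem_tight (p : Fin m → ℝ) (l : Fin n ⊕ Fin m) :
    l ∈ M.tight p ↔ p ⬝ᵥ M.col l = M.rExt l := by
  simp [Model.tight]

lemma Model.mem_tight_inl (p : Fin m → ℝ) (j : Fin n) :
    Sum.inl j ∈ M.tight p ↔ ∑ i, p i * M.A i j = M.r j := by
  simp [Model.mem_tight, Model.col, Model.rExt, dotProduct]

lemma Model.mem_tight_inr (p : Fin m → ℝ) (i : Fin m) :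
    Sum.inr i ∈ M.tight p ↔ p i = 0 := by
  simp [Model.mem_tight, Model.col, Model.rExt]

lemma Model.GeneralPosition.card_tight_le (h : M.GeneralPosition) (p : Fin m → ℝ) :
    (M.tight p).card ≤ m := by
  convert h p using 1
  rw [← Set.ncard_coe_finset]
  congr 1
  ext l
  rw [Finset.mem_coe, Model.mem_tight]
  rcases l with j | i
  · simp [Model.col, Model.rExt, Matrix.vecMul, dotProduct]
  · simp [Model.col, Model.rExt, Matrix.vecMul, dotProduct, Matrix.one_apply, Pi.single_apply]

/-- A maximal set of tight equations has spanning columns. -/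
lemma Model.exists_tight_span (M : Model m n) (p : Fin m → ℝ) :
    ∃ p', M.tight p ⊆ M.tight p' ∧
      Submodule.span ℝ (M.col '' (M.tight p' : Set (Fin n ⊕ Fin m))) = ⊤ := by
  obtain ⟨F, hF, hmax⟩ := (Set.toFinite {F | ∃ p', M.tight p' = F}).exists_le_maximal
    (a := M.tight p) ⟨p, rfl⟩
  obtain ⟨p', rfl⟩ := hmax.1
  refine ⟨p', hF, ?_⟩
  by_contra hne
  -- If the tight columns did not span, a nonzero functional `f` would vanish on them. Moving `p'`
  -- along `f` keeps every tight equation, and a suitable step makes a coordinate `i` with `f (e_i)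
  -- ≠ 0` vanish. By maximality the equation for this coordinate was tight already, which forces `f
  -- (e_i) = 0`.
  obtain ⟨f, hf0, hf⟩ := Submodule.exists_le_ker_of_lt_top _ (lt_top_iff_ne_top.2 hne)
  have hfd : ∀ v, f v = (fun i => f (Pi.single i 1)) ⬝ᵥ v := by
    intro v
    conv_lhs => rw [← Finset.univ_sum_single v]
    rw [map_sum, dotProduct]
    refine Finset.sum_congr rfl fun i _ => ?_
    have : (Pi.single i (v i) : Fin m → ℝ) = v i • Pi.single i 1 := by
      rw [← Pi.single_smul]; simp
    rw [this, map_smul, smul_eq_mul, mul_comm]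
  have hvan : ∀ l ∈ M.tight p', f (M.col l) = 0 := fun l hl =>
    hf (Submodule.subset_span ⟨l, hl, rfl⟩)
  obtain ⟨i, hi⟩ : ∃ i, f (Pi.single i 1) ≠ 0 := by
    by_contra hall
    push Not at hall
    apply hf0
    ext i
    simp [hall i]
  set q := p' - (p' i / f (Pi.single i 1)) • fun i => f (Pi.single i 1) with hq
  have hsub : M.tight p' ⊆ M.tight q := fun l hl => by
    rw [Model.mem_tight, hq, sub_dotProduct, smul_dotProduct, ← hfd, hvan l hl]
    simpa using (Model.mem_tight p' l).1 hl
  have hin : Sum.inr i ∈ M.tight q := by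
    rw [Model.mem_tight_inr, hq]
    simp [hi]
  have := hmax.2 ⟨q, rfl⟩ hsub hin
  exact hi (by simpa [Model.col] using hvan _ this)

/-- Under general position the columns of the tight equations are part of a basis; `d` is the dual
basis. -/
lemma Model.GeneralPosition.exists_dual_basis (h : M.GeneralPosition) (p : Fin m → ℝ) :
    ∃ (E : Finset (Fin n ⊕ Fin m)) (d : Fin n ⊕ Fin m → Fin m → ℝ), M.tight p ⊆ E ∧
      (∀ l ∈ E, ∀ l' ∈ E, d l ⬝ᵥ M.col l' = if l = l' then 1 else 0) ∧
      ∀ v : Fin m → ℝ, v = ∑ l ∈ E, (d l ⬝ᵥ v) • M.col l := by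
  obtain ⟨p', hsub, hspan⟩ := M.exists_tight_span p
  set E := M.tight p' with hE
  have hspan' : ⊤ ≤ Submodule.span ℝ (Set.range fun l : E => M.col l) := by
    rw [← hspan]
    apply Submodule.span_mono
    rintro _ ⟨l, hl, rfl⟩
    exact ⟨⟨l, hl⟩, rfl⟩
  -- General position gives at most `m` tight columns, spanning gives at least `m`; so they form a
  -- basis.
  have hcard : Fintype.card E = Module.finrank ℝ (Fin m → ℝ) := by
    apply le_antisymm
    · simpa using h.card_tight_le p'
    · have := finrank_range_le_card (R := ℝ) (fun l : E => M.col l)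
      rw [Set.finrank, top_le_iff.1 hspan', finrank_top] at this
      exact this
  set b := basisOfTopLeSpanOfCardEqFinrank (fun l : E => M.col l) hspan' hcard with hb
  have hbl : ∀ l : E, b l = M.col l := fun l => by simp [hb]
  classical
  set d : Fin n ⊕ Fin m → Fin m → ℝ := fun l i =>
    if hl : l ∈ E then b.coord ⟨l, hl⟩ (Pi.single i 1) else 0 with hd
  have hdv : ∀ (l) (hl : l ∈ E) (v : Fin m → ℝ), d l ⬝ᵥ v = b.coord ⟨l, hl⟩ v := by
    intro l hl v
    conv_rhs => rw [← Finset.univ_sum_single v]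
    rw [map_sum, dotProduct]
    refine Finset.sum_congr rfl fun i _ => ?_
    have : (Pi.single i (v i) : Fin m → ℝ) = v i • Pi.single i 1 := by
      rw [← Pi.single_smul]; simp
    rw [this, map_smul, smul_eq_mul, mul_comm]
    simp [hd, hl]
  refine ⟨E, d, hsub, fun l hl l' hl' => ?_, fun v => ?_⟩
  · rw [hdv l hl, ← hbl ⟨l', hl'⟩, Module.Basis.coord_apply, Module.Basis.repr_self,
      Finsupp.single_apply]
    simp [eq_comm]
  · conv_lhs => rw [← b.sum_repr v]
    rw [← Finset.sum_coe_sort E]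
    refine Finset.sum_congr rfl fun l _ => ?_
    rw [hdv l l.2, hbl, Module.Basis.coord_apply]

/-- All terms of the dual objective are nonnegative. This makes its sublevel sets bounded when the
capacities are positive. -/
lemma Model.Valid.dual_zero_le (hM : M.Valid) {c p : Fin m → ℝ} (hc : ∀ i, 0 ≤ c i)
    (hp : ∀ i, 0 ≤ p i) (i : Fin m) : p i * c i ≤ M.dual c p := by
  have h1 : p i * c i ≤ ∑ i, p i * c i := Finset.single_le_sum (f := fun i => p i * c i)
    (fun i _ => mul_nonneg (hp i) (hc i)) (Finset.mem_univ i)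
  have h2 : 0 ≤ ∑ j, M.lam j * max 0 (M.r j - ∑ i, p i * M.A i j) :=
    Finset.sum_nonneg fun j _ => mul_nonneg (hM.lam_nonneg j) (le_max_left _ _)
  rw [Model.dual]
  linarith

/-- `p` is a nonnegative minimizer of the dual of the fluid problem with capacity `c`. -/
structure Model.IsDualMin (M : Model m n) (c p : Fin m → ℝ) : Prop where
  nonneg : ∀ i, 0 ≤ p i
  le : ∀ q : Fin m → ℝ, (∀ i, 0 ≤ q i) → M.dual c p ≤ M.dual c q

/-- Outside the box `[0, dual 0 / c_i]` the objective exceeds its value at zero, so a minimum over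
the compact box is a global one. -/
lemma Model.Valid.exists_isDualMin (hM : M.Valid) {c : Fin m → ℝ} (hc : ∀ i, 0 < c i) :
    ∃ p, M.IsDualMin c p := by
  set K : Set (Fin m → ℝ) := Set.Icc 0 fun i => M.dual c 0 / c i with hK
  have hcont : Continuous (M.dual c) := by unfold Model.dual; fun_prop
  have h0nn : 0 ≤ M.dual c 0 := by
    obtain ⟨i⟩ := hM.nonempty_resources
    simpa using hM.dual_zero_le (p := 0) (fun i => (hc i).le) (fun _ => le_rfl) i
  have h0 : (0 : Fin m → ℝ) ∈ K := ⟨le_rfl, fun i => div_nonneg h0nn (hc i).le⟩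
  obtain ⟨p, hpK, hp⟩ := (isCompact_Icc : IsCompact K).exists_isMinOn ⟨0, h0⟩ hcont.continuousOn
  refine ⟨p, fun i => hpK.1 i, fun q hq => ?_⟩
  by_cases hqK : q ∈ K
  · exact hp hqK
  · have : ∃ i, M.dual c 0 / c i < q i := by
      by_contra hall
      push Not at hall
      exact hqK ⟨hq, hall⟩
    obtain ⟨i, hi⟩ := this
    rw [div_lt_iff₀ (hc i)] at hi
    exact (hp h0).trans (hi.le.trans (hM.dual_zero_le (fun i => (hc i).le) hq i))

/-- At the prices `ᾱ` no type has a positive margin, so only the capacity term survives. -/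
lemma Model.Valid.dual_alphaBar (hM : M.Valid) (c : Fin m → ℝ) :
    M.dual c M.alphaBar = ∑ i, M.alphaBar i * c i := by
  rw [Model.dual, Finset.sum_eq_zero (s := Finset.univ (α := Fin n)), add_zero]
  intro j _
  rw [max_eq_left (by linarith [hM.r_le_sum_alphaBar j]), mul_zero]

/-- Reduced revenue of type `j` at prices `p`. -/
noncomputable def Model.margin (M : Model m n) (p : Fin m → ℝ) (j : Fin n) : ℝ :=
  M.r j - ∑ i, p i * M.A i j

/-- `x` solves the fluid problem with capacity `rho`, and complementary slackness holds relative to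
the bid prices `p`. -/
structure Model.IsFluid (M : Model m n) (p : Fin m → ℝ) (x : Fin n → ℝ) : Prop where
  price_nonneg : ∀ i, 0 ≤ p i
  nonneg : ∀ j, 0 ≤ x j
  le_lam : ∀ j, x j ≤ M.lam j
  le_rho : ∀ i, ∑ j, M.A i j * x j ≤ M.rho i
  eq_rho : ∀ i, 0 < p i → ∑ j, M.A i j * x j = M.rho i
  eq_lam : ∀ j, 0 < M.margin p j → x j = M.lam j
  eq_zero : ∀ j, M.margin p j < 0 → x j = 0

/-- First order condition at a minimizer of the dual objective. -/
lemma Model.IsDualMin.deriv_nonneg {p : Fin m → ℝ} (hp : M.IsDualMin M.rho p)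
    {d : Fin m → ℝ} (hd : ∀ i, p i = 0 → 0 ≤ d i) :
    0 ≤ ∑ i, d i * M.rho i - ∑ j, (if 0 < M.margin p j then
        M.lam j * ∑ i, d i * M.A i j else 0) +
      ∑ j, (if M.margin p j = 0 then M.lam j * max 0 (-∑ i, d i * M.A i j) else 0) := by
  have hlin : ∀ (t : ℝ) (j : Fin n), M.r j - ∑ i, (p i + t * d i) * M.A i j =
      M.margin p j - t * ∑ i, d i * M.A i j := by
    intro t j
    rw [Model.margin, Finset.mul_sum, sub_sub, ← Finset.sum_add_distrib]
    congr 1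
    exact Finset.sum_congr rfl fun i _ => by ring
  have h0 : Tendsto (fun t : ℝ => t) (𝓝[>] 0) (𝓝 0) := nhdsWithin_le_nhds
  -- For small `t > 0` no positive price and no nonzero margin changes sign, so the dual objective
  -- is exactly affine in `t` along the direction `d`; no differentiation is needed.
  have ev1 : ∀ᶠ t : ℝ in 𝓝[>] 0, ∀ i, 0 < p i → 0 < p i + t * d i := by
    rw [eventually_all]
    intro i
    rw [eventually_imp_distrib_left]
    intro hi
    have : Tendsto (fun t : ℝ => p i + t * d i) (𝓝[>] 0) (𝓝 (p i + 0 * d i)) :=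
      tendsto_const_nhds.add (h0.mul_const _)
    exact this.eventually (lt_mem_nhds (by simpa using hi))
  have ht : ∀ j, Tendsto (fun t : ℝ => M.margin p j - t * ∑ i, d i * M.A i j) (𝓝[>] 0)
      (𝓝 (M.margin p j - 0 * ∑ i, d i * M.A i j)) := fun j =>
    tendsto_const_nhds.sub (h0.mul_const _)
  have ev2 : ∀ᶠ t : ℝ in 𝓝[>] 0, ∀ j, 0 < M.margin p j →
      0 < M.margin p j - t * ∑ i, d i * M.A i j := by
    rw [eventually_all]
    intro j
    rw [eventually_imp_distrib_left]
    intro hj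
    exact (ht j).eventually (lt_mem_nhds (by simpa using hj))
  have ev3 : ∀ᶠ t : ℝ in 𝓝[>] 0, ∀ j, M.margin p j < 0 →
      M.margin p j - t * ∑ i, d i * M.A i j < 0 := by
    rw [eventually_all]
    intro j
    rw [eventually_imp_distrib_left]
    intro hj
    exact (ht j).eventually (gt_mem_nhds (by simpa using hj))
  obtain ⟨t, ⟨⟨h1, h2⟩, h3⟩, htpos⟩ :=
    ((ev1.and ev2).and ev3 |>.and (eventually_mem_nhdsWithin (a := (0 : ℝ)) (s := Set.Ioi 0))).exists
  have htpos : 0 < t := htpos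
  have hle := hp.le (fun i => p i + t * d i) fun i => by
    rcases (hp.nonneg i).eq_or_lt with hi | hi
    · rw [← hi, zero_add]
      exact mul_nonneg htpos.le (hd i hi.symm)
    · exact (h1 i hi).le
  have hterm : ∀ j, M.lam j * max 0 (M.r j - ∑ i, (p i + t * d i) * M.A i j) =
      M.lam j * max 0 (M.r j - ∑ i, p i * M.A i j) + t * (-(if 0 < M.margin p j then
        M.lam j * ∑ i, d i * M.A i j else 0) +
      (if M.margin p j = 0 then M.lam j * max 0 (-∑ i, d i * M.A i j) else 0)) := by
    intro j
    rw [hlin, ← Model.margin]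
    rcases lt_trichotomy (M.margin p j) 0 with hj | hj | hj
    · rw [if_neg hj.not_gt, if_neg hj.ne, max_eq_left hj.le, max_eq_left (h3 j hj).le]
      ring
    · have : max 0 (-(t * ∑ i, d i * M.A i j)) = t * max 0 (-∑ i, d i * M.A i j) := by
        rw [mul_max_of_nonneg _ _ htpos.le]; simp
      rw [if_neg hj.not_gt, if_pos hj, hj, max_self, zero_sub, this]
      ring
    · rw [if_pos hj, if_neg hj.ne', max_eq_right hj.le, max_eq_right (h2 j hj).le]
      ring
  have hsum : ∑ i, (p i + t * d i) * M.rho i = ∑ i, p i * M.rho i + t * ∑ i, d i * M.rho i := by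
    rw [Finset.mul_sum, ← Finset.sum_add_distrib]
    exact Finset.sum_congr rfl fun i _ => by ring
  rw [Model.dual, Model.dual, hsum, Finset.sum_congr rfl fun j _ => hterm j,
    Finset.sum_add_distrib, ← Finset.mul_sum, Finset.sum_add_distrib, Finset.sum_neg_distrib] at hle
  nlinarith

/-- Every dual minimizer is complemented by a solution of the fluid problem. -/
lemma Model.GeneralPosition.exists_isFluid (h : M.GeneralPosition) (hM : M.Valid)
    {p : Fin m → ℝ} (hp : M.IsDualMin M.rho p) : ∃ x, M.IsFluid p x := by
  obtain ⟨E, d, hE, hdual, hexp⟩ := h.exists_dual_basis p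
  -- `g` is the capacity left after full service of the types with positive margin. Its coordinates
  -- in the basis that contains the tight columns will be the service rates of the types with zero
  -- margin and the slacks of the resources with price zero.
  set g : Fin m → ℝ := fun i => M.rho i - ∑ j, if 0 < M.margin p j then
    M.lam j * M.A i j else 0 with hg
  have hgd : ∀ v : Fin m → ℝ, v ⬝ᵥ g = ∑ i, v i * M.rho i -
      ∑ j, (if 0 < M.margin p j then M.lam j * ∑ i, v i * M.A i j else 0) := by
    intro v
    simp only [dotProduct, hg, mul_sub, Finset.sum_sub_distrib]
    congr 1
    simp_rw [Finset.mul_sum]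
    rw [Finset.sum_comm]
    refine Finset.sum_congr rfl fun j _ => ?_
    split_ifs
    · exact Finset.sum_congr rfl fun i _ => by ring
    · simp
  have hfoc : ∀ v : Fin m → ℝ, (∀ i, p i = 0 → 0 ≤ v i) → 0 ≤ v ⬝ᵥ g +
      ∑ j, (if M.margin p j = 0 then M.lam j * max 0 (-(v ⬝ᵥ M.col (Sum.inl j))) else 0) := by
    intro v hv
    rw [hgd]
    exact hp.deriv_nonneg hv
  have htj : ∀ j, M.margin p j = 0 → Sum.inl j ∈ M.tight p := fun j hj => by
    rw [Model.mem_tight_inl]; rw [Model.margin] at hj; linarith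
  have hti : ∀ i, p i = 0 → Sum.inr i ∈ M.tight p := fun i hi => (M.mem_tight_inr p i).2 hi
  have hvr : ∀ (v : Fin m → ℝ) (i : Fin m), v ⬝ᵥ M.col (Sum.inr i) = v i := fun v i => by
    simp [Model.col]
  -- the first order condition along `± d l`
  have hdir : ∀ l ∈ E, ∀ σ : ℝ, (∀ i, p i = 0 → Sum.inr i = l → 0 ≤ σ) →
      0 ≤ σ * (d l ⬝ᵥ g) + ∑ j, (if M.margin p j = 0 then
        M.lam j * max 0 (-(σ * if l = Sum.inl j then 1 else 0)) else 0) := by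
    intro l hl σ hσ
    have := hfoc (σ • d l) (fun i hi => by
      have h1 := hdual l hl _ (hE (hti i hi))
      rw [hvr] at h1
      rw [Pi.smul_apply, smul_eq_mul, h1]
      split_ifs with h2
      · rw [mul_one]; exact hσ i hi h2.symm
      · simp)
    rw [smul_dotProduct, smul_eq_mul] at this
    convert this using 2
    refine Finset.sum_congr rfl fun j _ => ?_
    split_ifs with h1 h2
    · rw [smul_dotProduct, hdual l hl _ (hE (htj j h1)), if_pos h2, smul_eq_mul]
    · rw [smul_dotProduct, hdual l hl _ (hE (htj j h1)), if_neg h2, smul_eq_mul]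
    · rfl
  -- Off the tight set both directions `± d l` are admissible and meet no kink of the objective, so
  -- the coordinate vanishes.
  have hzero : ∀ l ∈ E, l ∉ M.tight p → d l ⬝ᵥ g = 0 := by
    intro l hl hlt
    have hs : ∀ σ : ℝ, 0 ≤ σ * (d l ⬝ᵥ g) := by
      intro σ
      have := hdir l hl σ fun i hi hil => absurd (hil ▸ hti i hi) hlt
      rwa [Finset.sum_eq_zero, add_zero] at this
      intro j _
      split_ifs with h1 h2
      · exact absurd (h2 ▸ htj j h1) hlt
      · simp
      · rfl
    have := hs 1
    have := hs (-1)
    linarith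
  have hinr : ∀ i, p i = 0 → 0 ≤ d (Sum.inr i) ⬝ᵥ g := by
    intro i hi
    simpa using hdir _ (hE (hti i hi)) 1 fun _ _ _ => zero_le_one
  -- The direction `+ d` gives nonnegativity; along `- d` the kink of type `j` contributes `λ_j`,
  -- which gives the upper bound.
  have hinl : ∀ j, M.margin p j = 0 → 0 ≤ d (Sum.inl j) ⬝ᵥ g ∧ d (Sum.inl j) ⬝ᵥ g ≤ M.lam j := by
    intro j hj
    constructor
    · have := hdir _ (hE (htj j hj)) 1 fun _ _ _ => zero_le_one
      rw [Finset.sum_eq_zero, add_zero, one_mul] at this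
      · exact this
      · intro j' _
        split_ifs <;> simp
    · have := hdir _ (hE (htj j hj)) (-1) fun i _ hi => by simp at hi
      rw [Finset.sum_eq_single j] at this
      · simp [hj] at this
        linarith
      · intro j' _ hne
        rw [if_neg (c := Sum.inl j = Sum.inl j') (by simpa using hne.symm)]
        simp
      · simp
  set x : Fin n → ℝ := fun j => if 0 < M.margin p j then M.lam j else
    if M.margin p j = 0 then d (Sum.inl j) ⬝ᵥ g else 0 with hx
  have hbal : ∀ i, ∑ j, M.A i j * x j + (if p i = 0 then d (Sum.inr i) ⬝ᵥ g else 0) =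
      M.rho i := by
    intro i
    have h1 := congrFun (hexp g) i
    rw [← Finset.sum_subset hE fun l hl hlt => by rw [hzero l hl hlt, zero_smul],
      Finset.sum_apply, Model.tight, Finset.sum_filter, Fintype.sum_sum_type] at h1
    have h2 : ∑ j, (if p ⬝ᵥ M.col (Sum.inl j) = M.rExt (Sum.inl j) then
        ((d (Sum.inl j) ⬝ᵥ g) • M.col (Sum.inl j)) i else 0) =
        ∑ j, M.A i j * (if M.margin p j = 0 then d (Sum.inl j) ⬝ᵥ g else 0) := by
      refine Finset.sum_congr rfl fun j _ => ?_
      have : p ⬝ᵥ M.col (Sum.inl j) = M.rExt (Sum.inl j) ↔ M.margin p j = 0 := by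
        rw [← Model.mem_tight, Model.mem_tight_inl, Model.margin, sub_eq_zero, eq_comm]
      simp only [this]
      split_ifs
      · simp [Model.col, mul_comm]
      · simp
    have h3 : ∑ k, (if p ⬝ᵥ M.col (Sum.inr k) = M.rExt (Sum.inr k) then
        ((d (Sum.inr k) ⬝ᵥ g) • M.col (Sum.inr k)) i else 0) =
        if p i = 0 then d (Sum.inr i) ⬝ᵥ g else 0 := by
      rw [Finset.sum_eq_single i]
      · have : p ⬝ᵥ M.col (Sum.inr i) = M.rExt (Sum.inr i) ↔ p i = 0 := by
          rw [← Model.mem_tight, Model.mem_tight_inr]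
        simp only [this]
        simp [Model.col]
      · intro k _ hk
        simp [Model.col, hk.symm]
      · simp
    rw [h2, h3] at h1
    have h4 : ∑ j, M.A i j * x j = ∑ j, (if 0 < M.margin p j then M.lam j * M.A i j else 0) +
        ∑ j, M.A i j * (if M.margin p j = 0 then d (Sum.inl j) ⬝ᵥ g else 0) := by
      rw [← Finset.sum_add_distrib]
      refine Finset.sum_congr rfl fun j _ => ?_
      simp only [hx]
      split_ifs with h5 h6
      · exact absurd h6 h5.ne'
      all_goals ring
    rw [h4]
    simp only [hg] at h1
    linarith
  refine ⟨x, hp.nonneg, fun j => ?_, fun j => ?_, fun i => ?_, fun i hi => ?_, fun j hj => ?_,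
    fun j hj => ?_⟩
  · simp only [hx]
    split_ifs with h1 h2
    exacts [hM.lam_nonneg j, (hinl j h2).1, le_rfl]
  · simp only [hx]
    split_ifs with h1 h2
    exacts [le_rfl, (hinl j h2).2, hM.lam_nonneg j]
  · have := hbal i
    split_ifs at this with h1
    · linarith [hinr i h1]
    · linarith
  · have := hbal i
    rwa [if_neg hi.ne', add_zero] at this
  · simp only [hx, if_pos hj]
  · simp only [hx, if_neg hj.not_gt, if_neg hj.ne]

/-- Revenue as consumption cost plus reduced revenue. -/
lemma Model.sum_r_mul (M : Model m n) (p : Fin m → ℝ) (z : Fin n → ℝ) :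
    ∑ j, M.r j * z j = ∑ i, p i * ∑ j, M.A i j * z j + ∑ j, M.margin p j * z j := by
  simp_rw [Finset.mul_sum]
  rw [Finset.sum_comm, ← Finset.sum_add_distrib]
  refine Finset.sum_congr rfl fun j _ => ?_
  rw [Model.margin, sub_mul, Finset.sum_mul]
  simp_rw [mul_assoc]
  ring

lemma Model.IsFluid.margin_mul {p : Fin m → ℝ} {x : Fin n → ℝ} (h : M.IsFluid p x) (j : Fin n) :
    M.margin p j * x j = M.lam j * max 0 (M.margin p j) := by
  rcases lt_trichotomy (M.margin p j) 0 with hj | hj | hj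
  · rw [h.eq_zero j hj, max_eq_left hj.le]; ring
  · rw [hj]; simp
  · rw [h.eq_lam j hj, max_eq_right hj.le]; ring

lemma Model.IsFluid.price_mul {p : Fin m → ℝ} {x : Fin n → ℝ} (h : M.IsFluid p x) (i : Fin m) :
    p i * ∑ j, M.A i j * x j = p i * M.rho i := by
  rcases (h.price_nonneg i).eq_or_lt with hi | hi
  · rw [← hi]; ring
  · rw [h.eq_rho i hi]

/-- Strong duality, read off complementary slackness term by term. -/
lemma Model.IsFluid.revenue {p : Fin m → ℝ} {x : Fin n → ℝ} (h : M.IsFluid p x) :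
    ∑ j, M.r j * x j = M.dual M.rho p := by
  rw [M.sum_r_mul p, Model.dual, Finset.sum_congr rfl fun i _ => h.price_mul i,
    Finset.sum_congr rfl fun j _ => h.margin_mul j]
  rfl

/-- The fluid solution is a sharp maximum: nearly optimal and nearly feasible points are near
to it. -/
lemma Model.GeneralPosition.exists_sharp (h : M.GeneralPosition) {p : Fin m → ℝ} {x : Fin n → ℝ}
    (hx : M.IsFluid p x) :
    ∃ K : ℝ, 0 ≤ K ∧ ∀ (z : Fin n → ℝ) (τ e : ℝ), 0 ≤ e → (∀ j, 0 ≤ z j) →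
      (∀ j, z j ≤ τ * M.lam j + e) → (∀ i, ∑ j, M.A i j * z j ≤ τ * M.rho i + e) →
      τ * M.dual M.rho p - e ≤ ∑ j, M.r j * z j → ∀ j, |z j - τ * x j| ≤ K * e := by
  obtain ⟨E, d, hE, hdual, hexp⟩ := h.exists_dual_basis p
  set S : ℝ := 1 + ∑ i, p i + ∑ j, |M.margin p j| with hS
  have hS0 : 0 ≤ S := by
    have h1 : 0 ≤ ∑ i, p i := Finset.sum_nonneg fun i _ => hx.price_nonneg i
    have h2 : 0 ≤ ∑ j, |M.margin p j| := Finset.sum_nonneg fun j _ => abs_nonneg _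
    linarith
  -- bounds for the components outside the tight set
  set κ : Fin n ⊕ Fin m → ℝ := Sum.elim (fun j => S / |M.margin p j|) (fun i => S / p i) with hκ
  have hκ0 : ∀ l, 0 ≤ κ l := by
    rintro (j | i)
    · exact div_nonneg hS0 (abs_nonneg _)
    · exact div_nonneg hS0 (hx.price_nonneg i)
  refine ⟨∑ l, κ l + ∑ l, ∑ l', κ l' * |d l ⬝ᵥ M.col l'|, ?_, ?_⟩
  · exact add_nonneg (Finset.sum_nonneg fun l _ => hκ0 l) (Finset.sum_nonneg fun l _ =>
      Finset.sum_nonneg fun l' _ => mul_nonneg (hκ0 l') (abs_nonneg _))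
  intro z τ e he hz0 hzl hzr hzv
  -- Deviations of service and of resource slack from the scaled fluid solution, as coefficients on
  -- the columns of `[A, I]`; the capacity balance says that they form a linear relation.
  set D : Fin n ⊕ Fin m → ℝ := Sum.elim (fun j => z j - τ * x j)
    (fun i => τ * ∑ j, M.A i j * x j - ∑ j, M.A i j * z j) with hD
  have hrel : ∑ l, D l • M.col l = 0 := by
    ext i
    rw [Finset.sum_apply, Fintype.sum_sum_type]
    simp only [hD, Sum.elim_inl, Sum.elim_inr, Model.col, Pi.smul_apply, smul_eq_mul,
      Pi.single_apply, mul_ite, mul_one, mul_zero, Finset.sum_ite_eq, Finset.mem_univ, if_true,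
      Pi.zero_apply]
    rw [Finset.mul_sum, ← Finset.sum_sub_distrib, ← Finset.sum_add_distrib]
    exact Finset.sum_eq_zero fun j _ => by ring
  have hPi : ∀ i, p i * (∑ j, M.A i j * z j - τ * M.rho i) ≤ p i * e := fun i =>
    mul_le_mul_of_nonneg_left (by linarith [hzr i]) (hx.price_nonneg i)
  have hQj : ∀ j, M.margin p j * (z j - τ * x j) ≤ |M.margin p j| * e := by
    intro j
    rcases lt_trichotomy (M.margin p j) 0 with hj | hj | hj
    · rw [hx.eq_zero j hj, mul_zero, sub_zero]
      exact (mul_nonpos_of_nonpos_of_nonneg hj.le (hz0 j)).trans (by positivity)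
    · rw [hj]; simp
    · rw [hx.eq_lam j hj, abs_of_pos hj]
      exact mul_le_mul_of_nonneg_left (by linarith [hzl j]) hj.le
  have hdec : ∑ i, p i * (∑ j, M.A i j * z j - τ * M.rho i) +
      ∑ j, M.margin p j * (z j - τ * x j) = ∑ j, M.r j * z j - τ * M.dual M.rho p := by
    rw [← hx.revenue, M.sum_r_mul p z, M.sum_r_mul p x,
      Finset.sum_congr rfl fun i _ => hx.price_mul i]
    simp_rw [mul_sub, Finset.sum_sub_distrib, mul_add, Finset.mul_sum]
    have h1 : ∑ i, p i * (τ * M.rho i) = ∑ i, τ * (p i * M.rho i) :=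
      Finset.sum_congr rfl fun i _ => by ring
    have h2 : ∑ j, M.margin p j * (τ * x j) = ∑ j, τ * (M.margin p j * x j) :=
      Finset.sum_congr rfl fun i _ => by ring
    rw [h1, h2]
    ring
  have htot : ∑ i, p i * e + ∑ j, |M.margin p j| * e + e = S * e := by
    rw [hS, ← Finset.sum_mul, ← Finset.sum_mul]; ring
  -- The duality gap is a sum of terms that are nonnegative up to `O(e)`, with total at most `S e`.
  -- Each term is a deviation times a price or a margin, so where that factor is nonzero the
  -- deviation itself is `O(e)`.
  have hgap : ∀ (l : Fin n ⊕ Fin m), l ∉ M.tight p → |D l| ≤ κ l * e := by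
    have hsub : ∑ i, (p i * e - p i * (∑ j, M.A i j * z j - τ * M.rho i)) +
        ∑ j, (|M.margin p j| * e - M.margin p j * (z j - τ * x j)) ≤ S * e := by
      rw [Finset.sum_sub_distrib, Finset.sum_sub_distrib]
      linarith
    have hn1 : ∀ i, 0 ≤ p i * e - p i * (∑ j, M.A i j * z j - τ * M.rho i) := fun i => by
      linarith [hPi i]
    have hn2 : ∀ j, 0 ≤ |M.margin p j| * e - M.margin p j * (z j - τ * x j) := fun j => by
      linarith [hQj j]
    rintro (j | i) hl
    · have hj : M.margin p j ≠ 0 := fun h0 => hl (by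
        rw [Model.mem_tight_inl]; rw [Model.margin] at h0; linarith)
      have h1 := Finset.single_le_sum (fun j _ => hn2 j) (Finset.mem_univ j)
      have h2 := Finset.sum_nonneg fun i (_ : i ∈ Finset.univ) => hn1 i
      have h3 : -(S * e) ≤ M.margin p j * (z j - τ * x j) := by
        have : 0 ≤ |M.margin p j| * e := by positivity
        linarith
      have h4 : M.margin p j * (z j - τ * x j) ≤ S * e := by
        refine (hQj j).trans (mul_le_mul_of_nonneg_right ?_ he)
        have := Finset.single_le_sum (fun j _ => abs_nonneg (M.margin p j)) (Finset.mem_univ j)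
        have h5 : 0 ≤ ∑ i, p i := Finset.sum_nonneg fun i _ => hx.price_nonneg i
        linarith
      have h5 : |M.margin p j| * |z j - τ * x j| ≤ S * e := by
        rw [← abs_mul]; exact abs_le.2 ⟨h3, h4⟩
      simp only [hD, hκ, Sum.elim_inl]
      rw [div_mul_eq_mul_div, le_div_iff₀ (abs_pos.2 hj), mul_comm]
      exact h5
    · have hi : 0 < p i := lt_of_le_of_ne (hx.price_nonneg i) fun h0 => hl (by
        rw [Model.mem_tight_inr]; exact h0.symm)
      have h1 := Finset.single_le_sum (fun i _ => hn1 i) (Finset.mem_univ i)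
      have h2 := Finset.sum_nonneg fun j (_ : j ∈ Finset.univ) => hn2 j
      have h3 : -(S * e) ≤ p i * (∑ j, M.A i j * z j - τ * M.rho i) := by
        have : 0 ≤ p i * e := by positivity
        linarith
      have h4 : p i * (∑ j, M.A i j * z j - τ * M.rho i) ≤ S * e := by
        refine (hPi i).trans (mul_le_mul_of_nonneg_right ?_ he)
        have := Finset.single_le_sum (fun i _ => hx.price_nonneg i) (Finset.mem_univ i)
        have h5 : 0 ≤ ∑ j, |M.margin p j| := Finset.sum_nonneg fun j _ => abs_nonneg _
        linarith
      have h5 : p i * |τ * M.rho i - ∑ j, M.A i j * z j| ≤ S * e := by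
        calc p i * |τ * M.rho i - ∑ j, M.A i j * z j|
            = |p i * (τ * M.rho i - ∑ j, M.A i j * z j)| := by rw [abs_mul, abs_of_pos hi]
          _ ≤ S * e := by
            rw [abs_le]
            constructor <;> linarith
      simp only [hD, hκ, Sum.elim_inr, hx.eq_rho i hi]
      rw [div_mul_eq_mul_div, le_div_iff₀ hi, mul_comm]
      exact h5
  have hall : ∀ l, |D l| ≤ (∑ l, κ l + ∑ l, ∑ l', κ l' * |d l ⬝ᵥ M.col l'|) * e := by
    intro l
    rw [add_mul]
    have hk1 : 0 ≤ (∑ l, κ l) * e := mul_nonneg (Finset.sum_nonneg fun l _ => hκ0 l) he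
    have hk2 : 0 ≤ (∑ l, ∑ l', κ l' * |d l ⬝ᵥ M.col l'|) * e :=
      mul_nonneg (Finset.sum_nonneg fun l _ => Finset.sum_nonneg fun l' _ =>
        mul_nonneg (hκ0 l') (abs_nonneg _)) he
    by_cases hl : l ∈ M.tight p
    -- On the tight set, applying the dual basis vector `d l` to the linear relation expresses `D l`
    -- through the deviations off the tight set, which are already bounded.
    · have h1 : D l = -∑ l' ∈ Finset.univ \ M.tight p, D l' * (d l ⬝ᵥ M.col l') := by
        have h2 := congrArg (fun v => d l ⬝ᵥ v) hrel
        simp only [dotProduct_sum, dotProduct_smul, smul_eq_mul, dotProduct_zero] at h2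
        rw [← Finset.sum_sdiff (Finset.subset_univ (M.tight p))] at h2
        have h3 : ∑ l' ∈ M.tight p, D l' * (d l ⬝ᵥ M.col l') = D l := by
          rw [Finset.sum_eq_single l]
          · rw [hdual l (hE hl) l (hE hl)]; simp
          · intro l' hl' hne
            rw [hdual l (hE hl) l' (hE hl')]; simp [hne.symm]
          · exact fun h => absurd hl h
        linarith
      have h2 : |D l| ≤ ∑ l', κ l' * |d l ⬝ᵥ M.col l'| * e := by
        rw [h1, abs_neg]
        refine (Finset.abs_sum_le_sum_abs _ _).trans ?_
        refine (Finset.sum_le_sum (g := fun l' => κ l' * |d l ⬝ᵥ M.col l'| * e)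
          fun l' hl' => ?_).trans ?_
        · rw [abs_mul]
          have := hgap l' (Finset.mem_sdiff.1 hl').2
          calc |D l'| * |d l ⬝ᵥ M.col l'| ≤ κ l' * e * |d l ⬝ᵥ M.col l'| := by gcongr
            _ = _ := by ring
        · exact Finset.sum_le_sum_of_subset_of_nonneg (Finset.subset_univ _) fun l' _ _ =>
            mul_nonneg (mul_nonneg (hκ0 l') (abs_nonneg _)) he
      rw [← Finset.sum_mul] at h2
      have h3 : ∑ l', κ l' * |d l ⬝ᵥ M.col l'| ≤ ∑ l, ∑ l', κ l' * |d l ⬝ᵥ M.col l'| :=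
        Finset.single_le_sum (f := fun l => ∑ l', κ l' * |d l ⬝ᵥ M.col l'|)
          (fun l _ => Finset.sum_nonneg fun l' _ => mul_nonneg (hκ0 l') (abs_nonneg _))
          (Finset.mem_univ l)
      linarith [mul_le_mul_of_nonneg_right h3 he]
    · have h1 := Finset.single_le_sum (fun l _ => hκ0 l) (Finset.mem_univ l)
      linarith [hgap l hl, mul_le_mul_of_nonneg_right h1 he]
  exact fun j => hall (Sum.inl j)


/-! ### Functionals of finitely many arrivals -/

/-- `J` is a sequence of i.i.d. arrivals with the type distribution of the model. -/
structure Model.IsArrivalSequence (M : Model m n) {Ω : Type*} [MeasurableSpace Ω] (μ : Measure Ω)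
    (J : ℕ → Ω → Fin n) : Prop where
  measurable : ∀ t, Measurable (J t)
  indep : iIndepFun J μ
  law : ∀ t j, μ.real (J t ⁻¹' {j}) = M.lam j

section Probability

variable {Ω : Type*} [MeasurableSpace Ω] {μ : Measure Ω}
  {J : ℕ → Ω → Fin n}

/-- A functional of the arrivals before `N` factors through a finite set. This makes all revenues
measurable and bounded without any look at their definition. -/
lemma exists_factor {β : Type*} {N : ℕ} {g : (ℕ → Fin n) → β} (hg : DependsOn g (Set.Iio N))
    (j₀ : Fin n) : ∃ G : (Finset.range N → Fin n) → β, ∀ s, g s = G fun i => s i := by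
  refine ⟨fun v => g fun t => if h : t ∈ Finset.range N then v ⟨t, h⟩ else j₀, fun s => ?_⟩
  refine hg fun t ht => ?_
  rw [dif_pos (Finset.mem_range.2 ht)]

lemma Model.IsArrivalSequence.measurable_of_dependsOn (hJ : M.IsArrivalSequence μ J) {β : Type*}
    [MeasurableSpace β] {N : ℕ} {g : (ℕ → Fin n) → β} (hg : DependsOn g (Set.Iio N)) :
    Measurable fun ω => g fun t => J t ω := by
  rcases isEmpty_or_nonempty Ω with h | ⟨⟨ω⟩⟩
  · exact measurable_of_empty _
  obtain ⟨G, hG⟩ := exists_factor hg (J 0 ω)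
  simp_rw [hG]
  exact (measurable_of_finite G).comp (measurable_pi_lambda _ fun i => hJ.measurable i)

lemma Model.IsArrivalSequence.integrable_of_dependsOn [IsProbabilityMeasure μ]
    (hJ : M.IsArrivalSequence μ J) {N : ℕ}
    {g : (ℕ → Fin n) → ℝ} (hg : DependsOn g (Set.Iio N)) :
    Integrable (fun ω => g fun t => J t ω) μ := by
  rcases isEmpty_or_nonempty Ω with h | ⟨⟨ω⟩⟩
  · have := IsProbabilityMeasure.ne_zero μ
    exact absurd (Measure.eq_zero_of_isEmpty μ) this
  obtain ⟨G, hG⟩ := exists_factor hg (J 0 ω)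
  obtain ⟨C, hC⟩ := (Set.finite_range fun v => ‖G v‖).bddAbove
  refine Integrable.of_bound (hJ.measurable_of_dependsOn hg).aestronglyMeasurable C
    (Eventually.of_forall fun ω => ?_)
  rw [hG]
  exact hC ⟨_, rfl⟩

/-- The arrival in period `N` is independent of everything determined before it. -/
lemma Model.IsArrivalSequence.integral_ite (hJ : M.IsArrivalSequence μ J) {N : ℕ}
    {g : (ℕ → Fin n) → ℝ} (hg : DependsOn g (Set.Iio N)) (j : Fin n) :
    ∫ ω, (if J N ω = j then g (fun t => J t ω) else 0) ∂μ =
      M.lam j * ∫ ω, g (fun t => J t ω) ∂μ := by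
  have hind : IndepFun (fun ω => if J N ω = j then (1 : ℝ) else 0)
      (fun ω => g fun t => J t ω) μ := by
    obtain ⟨G, hG⟩ := exists_factor hg j
    have h := hJ.indep.indepFun_finset {N} (Finset.range N) (by simp) hJ.measurable
    have := h.comp (φ := fun v => if v ⟨N, Finset.mem_singleton_self N⟩ = j then (1 : ℝ) else 0)
      (ψ := G) (measurable_of_finite _) (measurable_of_finite _)
    have h2 : (fun ω => g fun t => J t ω) = G ∘ fun ω (i : Finset.range N) => J i ω := by
      ext ω
      exact hG _
    rw [h2]
    convert this using 1
    ext ω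
    simp
  have hm : MeasurableSet (J N ⁻¹' {j}) := hJ.measurable N (measurableSet_singleton j)
  have h1 : (fun ω => if J N ω = j then (1 : ℝ) else 0) =
      (J N ⁻¹' {j}).indicator fun _ => 1 := by
    funext ω
    by_cases h : J N ω = j <;> simp [h]
  have h2 : ∫ ω, (if J N ω = j then (1 : ℝ) else 0) ∂μ = M.lam j := by
    rw [h1, integral_indicator hm]
    simpa using hJ.law N j
  rw [← h2, ← hind.integral_fun_mul_eq_mul_integral]
  · simp
  · rw [h1]
    exact (measurable_const.indicator hm).aestronglyMeasurable
  · exact (hJ.measurable_of_dependsOn hg).aestronglyMeasurable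

variable [IsProbabilityMeasure μ]

/-- Averaging over the arrival in period `N`. -/
lemma Model.IsArrivalSequence.integral_step (hJ : M.IsArrivalSequence μ J) {N : ℕ}
    {h : (ℕ → Fin n) → Fin n → ℝ} (hh : ∀ j, DependsOn (fun s => h s j) (Set.Iio N)) :
    ∫ ω, h (fun t => J t ω) (J N ω) ∂μ = ∫ ω, ∑ j, M.lam j * h (fun t => J t ω) j ∂μ := by
  have hdec : ∀ ω, h (fun t => J t ω) (J N ω) =
      ∑ j, if J N ω = j then h (fun t => J t ω) j else 0 := fun ω => by simp
  have hint : ∀ j, Integrable (fun ω => h (fun t => J t ω) j) μ := fun j =>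
    hJ.integrable_of_dependsOn (hh j)
  simp_rw [hdec]
  rw [integral_finsetSum, integral_finsetSum]
  · refine Finset.sum_congr rfl fun j _ => ?_
    rw [hJ.integral_ite (hh j), integral_const_mul]
  · exact fun j _ => (hint j).const_mul _
  · intro j _
    refine hJ.integrable_of_dependsOn (N := N + 1)
      (g := fun s => if s N = j then h s j else 0) fun s s' hs => ?_
    have h1 : s N = s' N := hs N (Nat.lt_succ_self N)
    have h2 : h s j = h s' j := hh j fun t ht => hs t (Nat.lt_succ_of_lt ht)
    simp only [h1, h2]

/-- Predictable increments `D k` of conditional mean zero, for periods `t₁ + k`. -/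
structure Model.IsIncrement (M : Model m n) (t₁ : ℕ) (D : ℕ → (ℕ → Fin n) → Fin n → ℝ) :
    Prop where
  dependsOn : ∀ k j, DependsOn (fun s => D k s j) (Set.Iio (t₁ + k))
  mean : ∀ k s, ∑ j, M.lam j * D k s j = 0

lemma Model.IsIncrement.neg {t₁ : ℕ} {D : ℕ → (ℕ → Fin n) → Fin n → ℝ}
    (hD : M.IsIncrement t₁ D) : M.IsIncrement t₁ fun k s j => -D k s j where
  dependsOn k j := fun s s' h => by simpa using hD.dependsOn k j h
  mean k s := by simpa using hD.mean k s

lemma Model.IsIncrement.dependsOn_sum {t₁ : ℕ} {D : ℕ → (ℕ → Fin n) → Fin n → ℝ}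
    (hD : M.IsIncrement t₁ D) (k : ℕ) :
    DependsOn (fun s => ∑ t ∈ Finset.range k, D t s (s (t₁ + t))) (Set.Iio (t₁ + k)) := by
  intro s s' h
  refine Finset.sum_congr rfl fun t ht => ?_
  have ht' := Finset.mem_range.1 ht
  rw [h (t₁ + t) (Set.mem_Iio.2 (by lia))]
  exact hD.dependsOn t _ fun i hi => h i ((Set.mem_Iio.1 hi).trans (by lia))

lemma Model.IsArrivalSequence.integral_sum_increment (hJ : M.IsArrivalSequence μ J) {t₁ : ℕ}
    {D : ℕ → (ℕ → Fin n) → Fin n → ℝ} (hD : M.IsIncrement t₁ D) (k : ℕ) :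
    ∫ ω, ∑ t ∈ Finset.range k, D t (fun i => J i ω) (J (t₁ + t) ω) ∂μ = 0 := by
  rw [integral_finsetSum]
  · refine Finset.sum_eq_zero fun t _ => ?_
    rw [hJ.integral_step (hD.dependsOn t)]
    simp [hD.mean]
  · intro t _
    refine hJ.integrable_of_dependsOn (N := t₁ + t + 1) (g := fun s => D t s (s (t₁ + t)))
      fun s s' h => ?_
    have h1 : s (t₁ + t) = s' (t₁ + t) := h (t₁ + t) (Set.mem_Iio.2 (by lia))
    simp only [h1]
    exact hD.dependsOn t _ fun i hi => h i ((Set.mem_Iio.1 hi).trans (by lia))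

lemma exp_le_of_abs_le_one {x : ℝ} (hx : |x| ≤ 1) : Real.exp x ≤ 1 + x + x ^ 2 := by
  have := (abs_le.1 (Real.abs_exp_sub_one_sub_id_le hx)).2
  linarith

/-- Average the last factor first: `exp x ≤ 1 + x + x²` for `|x| ≤ 1`, the linear term has
conditional mean zero, so each period contributes at most `exp ((θ c)²)`. -/
lemma Model.IsArrivalSequence.integral_exp_le (hJ : M.IsArrivalSequence μ J) (hM : M.Valid) {t₁ : ℕ}
    {D : ℕ → (ℕ → Fin n) → Fin n → ℝ} (hD : M.IsIncrement t₁ D) {c θ : ℝ}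
    (hc : ∀ k s j, |D k s j| ≤ c) (hθ : 0 ≤ θ) (hθc : θ * c ≤ 1) (k : ℕ) :
    ∫ ω, Real.exp (θ * ∑ t ∈ Finset.range k, D t (fun i => J i ω) (J (t₁ + t) ω)) ∂μ ≤
      Real.exp (k * (θ * c) ^ 2) := by
  induction k with
  | zero => simp
  | succ k ih =>
    set S : (ℕ → Fin n) → ℝ := fun s => ∑ t ∈ Finset.range k, D t s (s (t₁ + t)) with hS
    have h1 : ∀ ω, Real.exp (θ * ∑ t ∈ Finset.range (k + 1),
        D t (fun i => J i ω) (J (t₁ + t) ω)) =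
        (fun s j => Real.exp (θ * S s) * Real.exp (θ * D k s j)) (fun i => J i ω)
          (J (t₁ + k) ω) := by
      intro ω
      rw [Finset.sum_range_succ, mul_add, Real.exp_add]
    have hdep : DependsOn (fun s => Real.exp (θ * S s)) (Set.Iio (t₁ + k)) := fun s s' h => by
      have h9 : S s = S s' := hD.dependsOn_sum k h
      simp only [h9]
    have hstep := hJ.integral_step (N := t₁ + k)
      (h := fun s j => Real.exp (θ * S s) * Real.exp (θ * D k s j)) fun j s s' h => by
        have h8 : D k s j = D k s' j := hD.dependsOn k j h
        have h9 : S s = S s' := hD.dependsOn_sum k h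
        simp only [h8, h9]
    rw [integral_congr_ae (Eventually.of_forall h1), hstep]
    · have h2 : ∀ s, ∑ j, M.lam j * (Real.exp (θ * S s) * Real.exp (θ * D k s j)) ≤
          Real.exp ((θ * c) ^ 2) * Real.exp (θ * S s) := by
        intro s
        have h3 : ∑ j, M.lam j * Real.exp (θ * D k s j) ≤ Real.exp ((θ * c) ^ 2) := by
          have h4 : ∀ j, M.lam j * Real.exp (θ * D k s j) ≤
              M.lam j * (1 + (θ * c) ^ 2) + θ * (M.lam j * D k s j) := by
            intro j
            have h5 : |θ * D k s j| ≤ θ * c := by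
              rw [abs_mul, abs_of_nonneg hθ]
              exact mul_le_mul_of_nonneg_left (hc k s j) hθ
            have h6 : (θ * D k s j) ^ 2 ≤ (θ * c) ^ 2 :=
              sq_le_sq' (by linarith [neg_abs_le (θ * D k s j)]) ((le_abs_self _).trans h5)
            have h7 := exp_le_of_abs_le_one (h5.trans hθc)
            nlinarith [hM.lam_nonneg j]
          refine (Finset.sum_le_sum fun j _ => h4 j).trans ?_
          rw [Finset.sum_add_distrib, ← Finset.sum_mul, hM.lam_sum, ← Finset.mul_sum, hD.mean]
          linarith [Real.add_one_le_exp ((θ * c) ^ 2)]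
        calc ∑ j, M.lam j * (Real.exp (θ * S s) * Real.exp (θ * D k s j))
            = (∑ j, M.lam j * Real.exp (θ * D k s j)) * Real.exp (θ * S s) := by
              rw [Finset.sum_mul]
              exact Finset.sum_congr rfl fun j _ => by ring
          _ ≤ _ := mul_le_mul_of_nonneg_right h3 (Real.exp_pos _).le
      refine (integral_mono (μ := μ) ?_ ?_ fun ω => h2 fun i => J i ω).trans ?_
      · refine hJ.integrable_of_dependsOn (N := t₁ + k) (g := fun s => ∑ j, M.lam j *
          (Real.exp (θ * S s) * Real.exp (θ * D k s j))) fun s s' h => ?_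
        refine Finset.sum_congr rfl fun j _ => ?_
        have h8 : D k s j = D k s' j := hD.dependsOn k j h
        have h9 : S s = S s' := hD.dependsOn_sum k h
        rw [h8, h9]
      · exact (hJ.integrable_of_dependsOn hdep).const_mul _
      · rw [integral_const_mul]
        have : Real.exp ((k + 1 : ℕ) * (θ * c) ^ 2) =
            Real.exp ((θ * c) ^ 2) * Real.exp (k * (θ * c) ^ 2) := by
          rw [← Real.exp_add]; push_cast; ring_nf
        rw [this]
        exact mul_le_mul_of_nonneg_left ih (Real.exp_pos _).le

/-- Azuma's inequality for sums of bounded increments. -/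
lemma Model.IsArrivalSequence.azuma (hJ : M.IsArrivalSequence μ J) (hM : M.Valid) {t₁ : ℕ}
    {D : ℕ → (ℕ → Fin n) → Fin n → ℝ} (hD : M.IsIncrement t₁ D) {c u N : ℝ} (hc0 : 0 < c)
    (hc : ∀ k s j, |D k s j| ≤ c) (hu : 0 ≤ u) (hN : 0 < N) (huN : u ≤ 2 * N * c) {k : ℕ}
    (hk : k ≤ N) :
    μ.real {ω | u ≤ ∑ t ∈ Finset.range k, D t (fun i => J i ω) (J (t₁ + t) ω)} ≤
      Real.exp (-(u ^ 2 / (4 * N * c ^ 2))) := by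
  -- The minimizer of `N (θ c)² - θ u`; the hypothesis `u ≤ 2 N c` keeps `θ c ≤ 1`, as the
  -- exponential estimate requires.
  set θ := u / (2 * N * c ^ 2) with hθ
  have hθ0 : 0 ≤ θ := by positivity
  have hθc : θ * c ≤ 1 := by
    rw [hθ, div_mul_eq_mul_div, div_le_one (by positivity)]
    nlinarith
  have h1 := hJ.integral_exp_le hM hD hc hθ0 hθc k
  have hdep := hD.dependsOn_sum k
  have h2 := mul_meas_ge_le_integral_of_nonneg (μ := μ)
    (f := fun ω => Real.exp (θ * ∑ t ∈ Finset.range k, D t (fun i => J i ω) (J (t₁ + t) ω)))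
    (Eventually.of_forall fun ω => (Real.exp_pos _).le)
    (hJ.integrable_of_dependsOn (N := t₁ + k)
      (g := fun s => Real.exp (θ * ∑ t ∈ Finset.range k, D t s (s (t₁ + t)))) fun s s' h => by
        have h9 := hdep h
        simp only at h9 ⊢
        rw [h9]) (Real.exp (θ * u))
  have h3 : μ.real {ω | u ≤ ∑ t ∈ Finset.range k, D t (fun i => J i ω) (J (t₁ + t) ω)} ≤
      μ.real {ω | Real.exp (θ * u) ≤
        Real.exp (θ * ∑ t ∈ Finset.range k, D t (fun i => J i ω) (J (t₁ + t) ω))} := by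
    refine measureReal_mono (fun ω hω => ?_) (measure_ne_top _ _)
    exact Real.exp_le_exp.2 (mul_le_mul_of_nonneg_left hω hθ0)
  have h4 : Real.exp (k * (θ * c) ^ 2) ≤ Real.exp (N * (θ * c) ^ 2) := by
    gcongr
  have h5 : Real.exp (-(u ^ 2 / (4 * N * c ^ 2))) * Real.exp (θ * u) =
      Real.exp (N * (θ * c) ^ 2) := by
    rw [← Real.exp_add]
    congr 1
    rw [hθ]
    field_simp
    ring
  refine h3.trans ?_
  have h6 := (h2.trans h1).trans h4
  rw [← h5, mul_comm] at h6
  exact le_of_mul_le_mul_right h6 (Real.exp_pos _)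

end Probability


/-! ### The algorithm is nonanticipating -/

section Congr

variable {s s' : ℕ → Fin n}

lemma Model.ffState_congr (M : Model m n) (B : Fin m → ℝ) (L : ℝ) (t₁ : ℕ) {k : ℕ}
    (h : ∀ t < t₁ + k, s t = s' t) : M.ffState s B L t₁ k = M.ffState s' B L t₁ k := by
  induction k with
  | zero => rfl
  | succ k ih =>
    have h1 := ih fun t ht => h t (by lia)
    have h2 := h (t₁ + k) (by lia)
    simp only [Model.ffState]
    rw [h1, h2]

lemma Model.act_congr (M : Model m n) (B : Fin m → ℝ) (L : ℝ) (t₁ : ℕ) {k : ℕ}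
    (h : ∀ t < t₁ + k, s t = s' t) : M.act s B L t₁ k = M.act s' B L t₁ k := by
  unfold Model.act Model.Active
  rw [M.ffState_congr B L t₁ h]

lemma Model.price_congr (M : Model m n) (B : Fin m → ℝ) (L : ℝ) (t₁ : ℕ) {k : ℕ}
    (h : ∀ t < t₁ + k, s t = s' t) : M.price s B L t₁ k = M.price s' B L t₁ k := by
  unfold Model.price
  rw [M.ffState_congr B L t₁ h]

lemma Model.ffDecision_congr (M : Model m n) (B : Fin m → ℝ) (L : ℝ) (t₁ : ℕ) {k : ℕ}
    (h : ∀ t < t₁ + k + 1, s t = s' t) :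
    M.ffDecision s B L t₁ k = M.ffDecision s' B L t₁ k := by
  rw [M.ffDecision_eq, M.ffDecision_eq, M.act_congr B L t₁ fun t ht => h t (by lia),
    M.price_congr B L t₁ fun t ht => h t (by lia), h (t₁ + k) (by lia)]

lemma Model.acceptedI_congr (M : Model m n) (T : ℕ) (α : ℝ)
    (h : ∀ t < 1 + len1 T α, s t = s' t) : M.acceptedI T α s = M.acceptedI T α s' := by
  funext j
  refine Finset.sum_congr rfl fun k hk => ?_
  have hk' := Finset.mem_range.1 hk
  rw [h (1 + k) (by lia), Model.decI, Model.decI,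
    M.ffDecision_congr _ _ _ fun t ht => h t (by lia)]

lemma Model.rejectClass_congr (M : Model m n) (T : ℕ) (α γ : ℝ)
    (h : ∀ t < 1 + len1 T α, s t = s' t) : M.rejectClass T α γ s = M.rejectClass T α γ s' := by
  simp only [Model.rejectClass, M.acceptedI_congr T α h]

lemma Model.acceptClass_congr (M : Model m n) (T : ℕ) (α γ : ℝ)
    (h : ∀ t < 1 + len1 T α, s t = s' t) : M.acceptClass T α γ s = M.acceptClass T α γ s' := by
  simp only [Model.acceptClass, M.acceptedI_congr T α h]

lemma Model.decII_congr (M : Model m n) (T : ℕ) (α γ : ℝ) (B : Fin m → ℝ) {k : ℕ}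
    (h : ∀ t < 1 + len1 T α + k + 1, s t = s' t) :
    M.decII T α γ s B k = M.decII T α γ s' B k := by
  unfold Model.decII Model.subII
  rw [M.rejectClass_congr T α γ fun t ht => h t (by lia),
    M.acceptClass_congr T α γ fun t ht => h t (by lia), h (1 + len1 T α + k) (by lia),
    M.ffDecision_congr _ _ (1 + len1 T α) (s' := s') fun t ht => h t (by lia)]

lemma Model.capII_congr (M : Model m n) (T : ℕ) (α γ : ℝ) {k : ℕ}
    (h : ∀ t < 1 + len1 T α + k, s t = s' t) : M.capII T α γ s k = M.capII T α γ s' k := by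
  induction k with
  | zero => rfl
  | succ k ih =>
    have h1 := ih fun t ht => h t (by lia)
    have h2 := h (1 + len1 T α + k) (by lia)
    simp only [Model.capII]
    rw [h1, h2, M.decII_congr T α γ (M.capII T α γ s' k) (k := k) fun t ht => h t (by lia)]

lemma Model.virtCapIII_congr (M : Model m n) (T : ℕ) (α β γ : ℝ)
    (h : ∀ t < 1 + len1 T α + len2 T α β, s t = s' t) :
    M.virtCapIII T α β γ s = M.virtCapIII T α β γ s' := by
  funext i
  simp only [Model.virtCapIII, Model.capStartIII, M.capII_congr T α γ h]

lemma Model.decIII_congr (M : Model m n) (T : ℕ) (α β γ : ℝ) (B : Fin m → ℝ) {k : ℕ}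
    (h : ∀ t < 1 + len1 T α + len2 T α β + k + 1, s t = s' t) :
    M.decIII T α β γ s B k = M.decIII T α β γ s' B k := by
  unfold Model.decIII Model.subIII
  rw [M.virtCapIII_congr T α β γ fun t ht => h t (by lia),
    h (1 + len1 T α + len2 T α β + k) (by lia),
    M.ffDecision_congr _ _ (1 + len1 T α + len2 T α β) (s' := s') fun t ht => h t (by lia)]

lemma Model.capIII_congr (M : Model m n) (T : ℕ) (α β γ : ℝ) {k : ℕ}
    (h : ∀ t < 1 + len1 T α + len2 T α β + k, s t = s' t) :
    M.capIII T α β γ s k = M.capIII T α β γ s' k := by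
  induction k with
  | zero => exact M.capII_congr T α γ h
  | succ k ih =>
    have h1 := ih fun t ht => h t (by lia)
    have h2 := h (1 + len1 T α + len2 T α β + k) (by lia)
    simp only [Model.capIII]
    rw [h1, h2, M.decIII_congr T α β γ (M.capIII T α β γ s' k) (k := k) fun t ht => h t (by lia)]

lemma Model.hindsight_congr (M : Model m n) (B : Fin m → ℝ) (t T : ℕ)
    (h : ∀ t < T + 1, s t = s' t) : M.hindsight s B t T = M.hindsight s' B t T := by
  have : ∀ j, arrivals s j t T = arrivals s' j t T := by
    intro j
    unfold arrivals
    congr 1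
    refine Finset.filter_congr fun u hu => ?_
    rw [h u (by have := (Finset.mem_Icc.1 hu).2; lia)]
  simp only [Model.hindsight, this]

lemma Model.revI_congr (M : Model m n) (T : ℕ) (α : ℝ) (h : ∀ t < 1 + len1 T α, s t = s' t) :
    M.revI T α s = M.revI T α s' := by
  refine Finset.sum_congr rfl fun k hk => ?_
  have hk' := Finset.mem_range.1 hk
  rw [h (1 + k) (by lia), Model.decI, Model.decI,
    M.ffDecision_congr _ _ _ fun t ht => h t (by lia)]

lemma Model.revII_congr (M : Model m n) (T : ℕ) (α β γ : ℝ)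
    (h : ∀ t < 1 + len1 T α + len2 T α β, s t = s' t) :
    M.revII T α β γ s = M.revII T α β γ s' := by
  refine Finset.sum_congr rfl fun k hk => ?_
  have hk' := Finset.mem_range.1 hk
  rw [h (1 + len1 T α + k) (by lia), M.capII_congr T α γ fun t ht => h t (by lia),
    M.decII_congr T α γ _ fun t ht => h t (by lia)]

lemma Model.revIII_congr (M : Model m n) (T : ℕ) (α β γ : ℝ)
    (h : ∀ t < 1 + len1 T α + len2 T α β + (T - (len1 T α + len2 T α β)), s t = s' t) :
    M.revIII T α β γ s = M.revIII T α β γ s' := by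
  refine Finset.sum_congr rfl fun k hk => ?_
  have hk' := Finset.mem_range.1 hk
  rw [h (1 + len1 T α + len2 T α β + k) (by lia),
    M.capIII_congr T α β γ fun t ht => h t (by lia),
    M.decIII_congr T α β γ _ fun t ht => h t (by lia)]

end Congr

lemma Model.dependsOn_VHO (M : Model m n) (T : ℕ) : DependsOn (M.VHO T) (Set.Iio (T + 1)) :=
  fun _ _ h => M.hindsight_congr _ _ _ h

lemma Model.dependsOn_VHI (M : Model m n) (T : ℕ) (α : ℝ) :
    DependsOn (M.VHI T α) (Set.Iio (1 + len1 T α + T)) := by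
  intro s s' h
  rw [Model.VHI, Model.VHI, M.revI_congr T α fun t ht => h t (Set.mem_Iio.2 (by lia)),
    M.hindsight_congr _ _ _ fun t ht => h t (Set.mem_Iio.2 (by lia))]

lemma Model.dependsOn_VHII (M : Model m n) (T : ℕ) (α β γ : ℝ) :
    DependsOn (M.VHII T α β γ) (Set.Iio (1 + len1 T α + len2 T α β + T)) := by
  intro s s' h
  rw [Model.VHII, Model.VHII, M.revI_congr T α fun t ht => h t (Set.mem_Iio.2 (by lia)),
    M.revII_congr T α β γ fun t ht => h t (Set.mem_Iio.2 (by lia)),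
    M.hindsight_congr _ _ _ fun t ht => h t (Set.mem_Iio.2 (by lia)), Model.capStartIII,
    Model.capStartIII, M.capII_congr T α γ fun t ht => h t (Set.mem_Iio.2 (by lia))]

lemma Model.dependsOn_VFD (M : Model m n) (T : ℕ) (α β γ : ℝ) :
    DependsOn (M.VFD T α β γ) (Set.Iio (1 + len1 T α + len2 T α β + T)) := by
  intro s s' h
  rw [Model.VFD, Model.VFD, M.revI_congr T α fun t ht => h t (Set.mem_Iio.2 (by lia)),
    M.revII_congr T α β γ fun t ht => h t (Set.mem_Iio.2 (by lia)),
    M.revIII_congr T α β γ fun t ht => h t (Set.mem_Iio.2 (by lia))]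


/-! ### The linear program -/

/-- Optimal value of the linear program with capacity `B` and numbers of customers `N`. -/
noncomputable def Model.lpVal (M : Model m n) (B : Fin m → ℝ) (N : Fin n → ℝ) : ℝ :=
  sSup {v : ℝ | ∃ z : Fin n → ℝ, (∀ i, ∑ j, M.A i j * z j ≤ B i) ∧
    (∀ j, 0 ≤ z j ∧ z j ≤ N j) ∧ v = ∑ j, M.r j * z j}

lemma Model.hindsight_eq_lpVal (M : Model m n) (s : ℕ → Fin n) (B : Fin m → ℝ) (t T : ℕ) :
    M.hindsight s B t T = M.lpVal B fun j => arrivals s j t T := rfl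

lemma Model.Valid.lpVal_nonneg (hM : M.Valid) (B : Fin m → ℝ) (N : Fin n → ℝ) :
    0 ≤ M.lpVal B N := by
  apply Real.sSup_nonneg
  rintro _ ⟨z, -, hz, rfl⟩
  exact Finset.sum_nonneg fun j _ => mul_nonneg (hM.r_nonneg j) (hz j).1

lemma Model.Valid.le_lpVal (hM : M.Valid) {B : Fin m → ℝ} {N z : Fin n → ℝ}
    (h1 : ∀ i, ∑ j, M.A i j * z j ≤ B i) (h2 : ∀ j, 0 ≤ z j ∧ z j ≤ N j) :
    ∑ j, M.r j * z j ≤ M.lpVal B N := by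
  refine le_csSup ⟨∑ j, M.r j * N j, ?_⟩ ⟨z, h1, h2, rfl⟩
  rintro _ ⟨z, -, hz, rfl⟩
  exact Finset.sum_le_sum fun j _ => mul_le_mul_of_nonneg_left (hz j).2 (hM.r_nonneg j)

lemma Model.lpVal_le {B : Fin m → ℝ} {N : Fin n → ℝ} {a : ℝ} (ha : 0 ≤ a)
    (h : ∀ z : Fin n → ℝ, (∀ i, ∑ j, M.A i j * z j ≤ B i) → (∀ j, 0 ≤ z j ∧ z j ≤ N j) →
      ∑ j, M.r j * z j ≤ a) : M.lpVal B N ≤ a := by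
  refine Real.sSup_le ?_ ha
  rintro _ ⟨z, h1, h2, rfl⟩
  exact h z h1 h2

lemma Model.Valid.lpVal_mono (hM : M.Valid) {B B' : Fin m → ℝ} {N N' : Fin n → ℝ}
    (hB : ∀ i, B i ≤ B' i) (hN : ∀ j, N j ≤ N' j) : M.lpVal B N ≤ M.lpVal B' N' :=
  Model.lpVal_le (hM.lpVal_nonneg _ _) fun _ h1 h2 =>
    hM.le_lpVal (fun i => (h1 i).trans (hB i)) fun j => ⟨(h2 j).1, (h2 j).2.trans (hN j)⟩

/-- Weak duality. -/
lemma Model.lpVal_le_dual {B : Fin m → ℝ} {N : Fin n → ℝ}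
    (hB : ∀ i, 0 ≤ B i) (hN : ∀ j, 0 ≤ N j) {p : Fin m → ℝ} (hp : ∀ i, 0 ≤ p i) :
    M.lpVal B N ≤ ∑ i, p i * B i + ∑ j, max 0 (M.margin p j) * N j := by
  refine Model.lpVal_le (add_nonneg (Finset.sum_nonneg fun i _ => mul_nonneg (hp i) (hB i))
    (Finset.sum_nonneg fun j _ => mul_nonneg (le_max_left _ _) (hN j))) fun z h1 h2 => ?_
  rw [M.sum_r_mul p]
  refine add_le_add (Finset.sum_le_sum fun i _ => mul_le_mul_of_nonneg_left (h1 i) (hp i))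
    (Finset.sum_le_sum fun j _ => ?_)
  exact (mul_le_mul_of_nonneg_right (le_max_right 0 _) (h2 j).1).trans
    (mul_le_mul_of_nonneg_left (h2 j).2 (le_max_left _ _))

/-- Serving `w` first and continuing optimally is no better than the optimum. -/
lemma Model.Valid.add_lpVal_le (hM : M.Valid) {B : Fin m → ℝ} {N₁ N₂ w : Fin n → ℝ}
    (hw : ∀ j, 0 ≤ w j ∧ w j ≤ N₁ j) (hN₂ : ∀ j, 0 ≤ N₂ j)
    (hB : ∀ i, ∑ j, M.A i j * w j ≤ B i) :
    ∑ j, M.r j * w j + M.lpVal (fun i => B i - ∑ j, M.A i j * w j) N₂ ≤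
      M.lpVal B fun j => N₁ j + N₂ j := by
  have h0 : ∑ j, M.r j * w j ≤ M.lpVal B fun j => N₁ j + N₂ j :=
    hM.le_lpVal hB fun j => ⟨(hw j).1, by linarith [(hw j).2, hN₂ j]⟩
  have : M.lpVal (fun i => B i - ∑ j, M.A i j * w j) N₂ ≤
      (M.lpVal B fun j => N₁ j + N₂ j) - ∑ j, M.r j * w j := by
    refine Model.lpVal_le (by linarith) fun z h1 h2 => ?_
    have h3 := hM.le_lpVal (B := B) (N := fun j => N₁ j + N₂ j) (z := fun j => w j + z j)
      (fun i => by
        simp_rw [mul_add, Finset.sum_add_distrib]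
        linarith [h1 i])
      (fun j => ⟨add_nonneg (hw j).1 (h2 j).1, add_le_add (hw j).2 (h2 j).2⟩)
    simp_rw [mul_add, Finset.sum_add_distrib] at h3
    linarith
  linarith

/-! ### Counting arrivals -/

/-- Number of type-`j` arrivals in the `k` periods `t₁, …, t₁ + k - 1`. -/
noncomputable def winCount (s : ℕ → Fin n) (t₁ k : ℕ) (j : Fin n) : ℝ :=
  ∑ t ∈ Finset.range k, if s (t₁ + t) = j then 1 else 0

lemma winCount_nonneg (s : ℕ → Fin n) (t₁ k : ℕ) (j : Fin n) : 0 ≤ winCount s t₁ k j :=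
  Finset.sum_nonneg fun _ _ => by split_ifs <;> norm_num

lemma winCount_add (s : ℕ → Fin n) (t₁ k l : ℕ) (j : Fin n) :
    winCount s t₁ (k + l) j = winCount s t₁ k j + winCount s (t₁ + k) l j := by
  simp only [winCount, Finset.sum_range_add, add_assoc]

lemma sum_mul_winCount (v : Fin n → ℝ) (s : ℕ → Fin n) (t₁ k : ℕ) :
    ∑ j, v j * winCount s t₁ k j = ∑ t ∈ Finset.range k, v (s (t₁ + t)) := by
  unfold winCount
  rw [sum_mul_count v s t₁ k fun _ => 1]
  simp

lemma arrivals_eq_winCount (s : ℕ → Fin n) (j : Fin n) (l T : ℕ) :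
    (arrivals s j (l + 1) T : ℝ) = winCount s (1 + l) (T - l) j := by
  unfold arrivals winCount
  rw [Finset.card_filter, ← Finset.Ico_add_one_right_eq_Icc, Finset.sum_Ico_eq_sum_range]
  push_cast
  simp [add_comm l 1]

lemma Model.hindsight_succ (M : Model m n) (s : ℕ → Fin n) (B : Fin m → ℝ) (l T : ℕ) :
    M.hindsight s B (l + 1) T = M.lpVal B (winCount s (1 + l) (T - l)) := by
  rw [Model.hindsight_eq_lpVal]
  congr 1
  funext j
  exact arrivals_eq_winCount s j l T

lemma Model.Valid.sum_r_winCount_le (hM : M.Valid) (s : ℕ → Fin n) (t₁ k : ℕ) :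
    ∑ j, M.r j * winCount s t₁ k j ≤ M.rTot * k := by
  rw [sum_mul_winCount]
  refine (Finset.sum_le_sum fun t _ => hM.r_le_rTot (s (t₁ + t))).trans ?_
  rw [Finset.sum_const, Finset.card_range, nsmul_eq_mul, mul_comm]

lemma Model.Valid.lpVal_winCount_le (hM : M.Valid) (B : Fin m → ℝ) (s : ℕ → Fin n) (t₁ k : ℕ) :
    M.lpVal B (winCount s t₁ k) ≤ M.rTot * k :=
  Model.lpVal_le (mul_nonneg hM.rTot_nonneg (Nat.cast_nonneg k)) fun _ _ h2 =>
    (Finset.sum_le_sum fun j _ => mul_le_mul_of_nonneg_left (h2 j).2 (hM.r_nonneg j)).trans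
      (hM.sum_r_winCount_le s t₁ k)

/-- Number of type-`j` customers accepted by the decisions `dec` for periods `t₁, t₁ + 1, …`. -/
noncomputable def decCount (s : ℕ → Fin n) (dec : ℕ → ℝ) (t₁ k : ℕ) (j : Fin n) : ℝ :=
  ∑ t ∈ Finset.range k, if s (t₁ + t) = j then dec t else 0

lemma sum_mul_decCount (v : Fin n → ℝ) (s : ℕ → Fin n) (dec : ℕ → ℝ) (t₁ k : ℕ) :
    ∑ j, v j * decCount s dec t₁ k j = ∑ t ∈ Finset.range k, v (s (t₁ + t)) * dec t :=
  sum_mul_count v s t₁ k dec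

lemma decCount_mem {s : ℕ → Fin n} {dec : ℕ → ℝ} (h : ∀ t, 0 ≤ dec t ∧ dec t ≤ 1) (t₁ k : ℕ)
    (j : Fin n) : 0 ≤ decCount s dec t₁ k j ∧ decCount s dec t₁ k j ≤ winCount s t₁ k j := by
  constructor
  · exact Finset.sum_nonneg fun t _ => by split_ifs; exacts [(h t).1, le_rfl]
  · exact Finset.sum_le_sum fun t _ => by split_ifs; exacts [(h t).2, le_rfl]

/-! ### Phase I -/

lemma Model.revI_mem (hM : M.Valid) (T : ℕ) (α : ℝ) (s : ℕ → Fin n) :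
    0 ≤ M.revI T α s ∧ M.revI T α s ≤ M.rTot * len1 T α := by
  constructor
  · exact Finset.sum_nonneg fun k _ => mul_nonneg (hM.r_nonneg _) (M.ffDecision_nonneg ..)
  · refine (Finset.sum_le_sum fun k _ =>
      (mul_le_of_le_one_right (hM.r_nonneg _) (M.ffDecision_le_one ..)).trans
        (hM.r_le_rTot (s (1 + k)))).trans ?_
    rw [Finset.sum_const, Finset.card_range, nsmul_eq_mul, mul_comm]

/-- The loss of phase I is at most proportional to its length. -/
lemma Model.Valid.abs_VHO_sub_VHI_le (hM : M.Valid) {T : ℕ} {α : ℝ} (hT : 0 < T)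
    (hl : len1 T α ≤ T) (s : ℕ → Fin n) :
    |M.VHO T s - M.VHI T α s| ≤ 2 * M.rTot * len1 T α := by
  set l := len1 T α with hl_def
  obtain ⟨k, hk⟩ := Nat.exists_eq_add_of_le hl
  have hTl : T - l = k := by lia
  have hT0 : (0 : ℝ) < T := by exact_mod_cast hT
  have hr := hM.rTot_nonneg
  have hI := Model.revI_mem hM T α s
  rw [← hl_def] at hI
  have hO : M.VHO T s = M.lpVal (M.C T) (winCount s 1 T) := by
    rw [Model.VHO, show (1 : ℕ) = 0 + 1 from rfl, Model.hindsight_succ]; rfl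
  have hI' : M.VHI T α s =
      M.revI T α s + M.lpVal (M.capStartII T α) (winCount s (1 + l) k) := by
    rw [Model.VHI, Model.hindsight_succ, ← hl_def, hTl]
  have hsplit : ∀ j, winCount s 1 T j = winCount s 1 l j + winCount s (1 + l) k j := fun j => by
    rw [← winCount_add, ← hk]
  have hC0 : ∀ i, 0 ≤ M.C T i := fun i => mul_nonneg hT0.le (hM.rho_pos i).le
  set f : ℝ := ((T : ℝ) - l) / T with hf
  have hlT : (l : ℝ) ≤ T := by exact_mod_cast hl
  have hf0 : 0 ≤ f := div_nonneg (by linarith) hT0.le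
  have hf1 : f ≤ 1 := by
    rw [hf, div_le_one hT0]
    linarith [Nat.cast_nonneg (α := ℝ) l]
  have hlow : M.lpVal (M.capStartII T α) (winCount s (1 + l) k) ≤
      M.lpVal (M.C T) (winCount s 1 T) :=
    hM.lpVal_mono (fun i => mul_le_of_le_one_right (hC0 i) hf1) fun j => by
      rw [hsplit]; linarith [winCount_nonneg s 1 l j]
  have hup : M.lpVal (M.C T) (winCount s 1 T) ≤
      M.lpVal (M.capStartII T α) (winCount s (1 + l) k) + 2 * M.rTot * l := by
    have h0 := hM.lpVal_nonneg (M.capStartII T α) (winCount s (1 + l) k)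
    refine Model.lpVal_le (by positivity) fun z h1 h2 => ?_
    -- Shrinking loses at most the share `l / T` of all arrivals, truncation at most the arrivals of
    -- phase I; each is worth at most `rTot * l`.
    set z' : Fin n → ℝ := fun j => min (f * z j) (winCount s (1 + l) k j) with hz'
    have hfeas := hM.le_lpVal (B := M.capStartII T α) (N := winCount s (1 + l) k) (z := z')
      (fun i => by
        calc ∑ j, M.A i j * z' j ≤ ∑ j, f * (M.A i j * z j) :=
              Finset.sum_le_sum fun j _ => by
                have := mul_le_mul_of_nonneg_left (min_le_left (f * z j)
                  (winCount s (1 + l) k j)) (hM.A_nonneg i j)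
                simp only [hz']
                linarith
          _ = f * ∑ j, M.A i j * z j := by rw [Finset.mul_sum]
          _ ≤ f * M.C T i := mul_le_mul_of_nonneg_left (h1 i) hf0
          _ = M.capStartII T α i := by rw [Model.capStartII, ← hl_def, mul_comm])
      (fun j => ⟨le_min (mul_nonneg hf0 (h2 j).1) (winCount_nonneg ..), min_le_right _ _⟩)
    have hzj : ∀ j, M.r j * z j ≤ M.r j * z' j +
        ((l : ℝ) / T * (M.r j * winCount s 1 T j) + M.r j * winCount s 1 l j) := by
      intro j
      have hlz : (l : ℝ) / T * z j ≤ (l : ℝ) / T * winCount s 1 T j :=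
        mul_le_mul_of_nonneg_left (h2 j).2 (by positivity)
      have hfz : f * z j = z j - (l : ℝ) / T * z j := by rw [hf]; field_simp
      have hzz : z j ≤ z' j + ((l : ℝ) / T * winCount s 1 T j + winCount s 1 l j) := by
        have hlw : 0 ≤ (l : ℝ) / T * winCount s 1 T j :=
          mul_nonneg (by positivity) (winCount_nonneg ..)
        simp only [hz']
        rcases min_choice (f * z j) (winCount s (1 + l) k j) with h | h
        · rw [h]; linarith [winCount_nonneg s 1 l j]
        · rw [h]; linarith [(h2 j).2, hsplit j]
      have := mul_le_mul_of_nonneg_left hzz (hM.r_nonneg j)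
      linarith
    have hs := Finset.sum_le_sum fun j (_ : j ∈ Finset.univ) => hzj j
    rw [Finset.sum_add_distrib, Finset.sum_add_distrib, ← Finset.mul_sum] at hs
    have h3 := hM.sum_r_winCount_le s 1 l
    have h4 : (l : ℝ) / T * ∑ j, M.r j * winCount s 1 T j ≤ M.rTot * l := by
      calc (l : ℝ) / T * ∑ j, M.r j * winCount s 1 T j ≤ (l : ℝ) / T * (M.rTot * T) :=
            mul_le_mul_of_nonneg_left (hM.sum_r_winCount_le s 1 T) (by positivity)
        _ = M.rTot * l := by field_simp
    linarith
  rw [hO, hI', abs_le]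
  have : 0 ≤ M.rTot * l := by positivity
  constructor <;> linarith

/-! ### Phase II -/

section PhaseII

variable (M) (T : ℕ) (α β γ : ℝ) (s : ℕ → Fin n)

/-- Number of type-`j` customers accepted in the first `k` periods of phase II. -/
noncomputable def Model.countII (k : ℕ) (j : Fin n) : ℝ :=
  decCount s (fun k => M.decII T α γ s (M.capII T α γ s k) k) (1 + len1 T α) k j

/-- Number of type-`j` customers accepted in the first `k` periods of phase III. -/
noncomputable def Model.countIII (k : ℕ) (j : Fin n) : ℝ :=
  decCount s (fun k => M.decIII T α β γ s (M.capIII T α β γ s k) k)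
    (1 + len1 T α + len2 T α β) k j

lemma Model.decII_mem (B : Fin m → ℝ) (k : ℕ) :
    0 ≤ M.decII T α γ s B k ∧ M.decII T α γ s B k ≤ 1 := by
  unfold Model.decII
  split_ifs
  · simp
  · simp
  · exact ⟨M.ffDecision_nonneg .., M.ffDecision_le_one ..⟩
  · simp

lemma Model.decIII_mem (B : Fin m → ℝ) (k : ℕ) :
    0 ≤ M.decIII T α β γ s B k ∧ M.decIII T α β γ s B k ≤ 1 := by
  unfold Model.decIII
  split_ifs
  · exact ⟨M.ffDecision_nonneg .., M.ffDecision_le_one ..⟩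
  · simp

lemma Model.revII_eq : M.revII T α β γ s = ∑ j, M.r j * M.countII T α γ s (len2 T α β) j :=
  (sum_mul_decCount ..).symm

lemma Model.revIII_eq : M.revIII T α β γ s =
    ∑ j, M.r j * M.countIII T α β γ s (T - (len1 T α + len2 T α β)) j :=
  (sum_mul_decCount ..).symm

lemma Model.capII_succ (k : ℕ) (i : Fin m) : M.capII T α γ s (k + 1) i =
    M.capII T α γ s k i -
      M.decII T α γ s (M.capII T α γ s k) k * M.A i (s (1 + len1 T α + k)) := rfl

lemma Model.capIII_succ (k : ℕ) (i : Fin m) : M.capIII T α β γ s (k + 1) i =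
    M.capIII T α β γ s k i -
      M.decIII T α β γ s (M.capIII T α β γ s k) k *
        M.A i (s (1 + len1 T α + len2 T α β + k)) := rfl

lemma Model.capII_eq (k : ℕ) (i : Fin m) :
    M.capII T α γ s k i = M.capStartII T α i - ∑ j, M.A i j * M.countII T α γ s k j := by
  unfold Model.countII
  rw [sum_mul_decCount]
  induction k with
  | zero => simp [Model.capII]
  | succ k ih =>
    rw [Finset.sum_range_succ, M.capII_succ, ih]
    ring

lemma Model.capIII_eq (k : ℕ) (i : Fin m) :
    M.capIII T α β γ s k i =
      M.capStartIII T α β γ s i - ∑ j, M.A i j * M.countIII T α β γ s k j := by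
  unfold Model.countIII
  rw [sum_mul_decCount]
  induction k with
  | zero => simp [Model.capIII]
  | succ k ih =>
    rw [Finset.sum_range_succ, M.capIII_succ, ih]
    ring

variable {M T α β γ s}

lemma Model.Valid.capStartII_nonneg (hM : M.Valid) (hl : len1 T α ≤ T) (i : Fin m) :
    0 ≤ M.capStartII T α i := by
  have : (len1 T α : ℝ) ≤ T := by exact_mod_cast hl
  exact mul_nonneg (mul_nonneg (Nat.cast_nonneg T) (hM.rho_pos i).le)
    (div_nonneg (by linarith) (Nat.cast_nonneg T))

lemma Model.Valid.capII_nonneg (hM : M.Valid) (hl : len1 T α ≤ T) (k : ℕ) (i : Fin m) :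
    0 ≤ M.capII T α γ s k i := by
  induction k with
  | zero => exact hM.capStartII_nonneg hl i
  | succ k ih =>
    rw [M.capII_succ]
    by_cases h : M.Sufficient (M.capII T α γ s k)
    · have h1 := h i (s (1 + len1 T α + k))
      have h2 := mul_le_of_le_one_left (hM.A_nonneg i (s (1 + len1 T α + k)))
        (M.decII_mem T α γ s (M.capII T α γ s k) k).2
      linarith
    · rw [Model.decII, if_neg h]
      linarith

lemma Model.Valid.capIII_nonneg (hM : M.Valid) (hl : len1 T α ≤ T) (k : ℕ) (i : Fin m) :
    0 ≤ M.capIII T α β γ s k i := by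
  induction k with
  | zero => exact hM.capII_nonneg hl _ i
  | succ k ih =>
    rw [M.capIII_succ]
    by_cases h : ∀ i, M.A i (s (1 + len1 T α + len2 T α β + k)) ≤ M.capIII T α β γ s k i
    · have h2 := mul_le_of_le_one_left (hM.A_nonneg i (s (1 + len1 T α + len2 T α β + k)))
        (M.decIII_mem T α β γ s (M.capIII T α β γ s k) k).2
      linarith [h i]
    · rw [Model.decIII, if_neg h]
      linarith

lemma Model.VHI_eq (M : Model m n) (T : ℕ) (α : ℝ) (s : ℕ → Fin n) :
    M.VHI T α s = M.revI T α s +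
      M.lpVal (M.capStartII T α) (winCount s (1 + len1 T α) (T - len1 T α)) := by
  rw [Model.VHI, Model.hindsight_succ]

lemma Model.VHII_eq (M : Model m n) (T : ℕ) (α β γ : ℝ) (s : ℕ → Fin n) :
    M.VHII T α β γ s = M.revI T α s + ∑ j, M.r j * M.countII T α γ s (len2 T α β) j +
      M.lpVal (fun i => M.capStartII T α i - ∑ j, M.A i j * M.countII T α γ s (len2 T α β) j)
        (winCount s (1 + len1 T α + len2 T α β) (T - (len1 T α + len2 T α β))) := by
  rw [Model.VHII, Model.hindsight_succ, M.revII_eq, add_assoc 1]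
  congr 2
  funext i
  exact M.capII_eq ..

/-- The acceptances of phase II followed by the hindsight optimum form a feasible plan of the
program that H-I solves. So the loss is nonnegative, and only its upper bound matters later. -/
lemma Model.Valid.VHII_le_VHI (hM : M.Valid) (hl : len1 T α + len2 T α β ≤ T) (s : ℕ → Fin n) :
    M.VHII T α β γ s ≤ M.VHI T α s := by
  have hsplit : winCount s (1 + len1 T α) (T - len1 T α) = fun j =>
      winCount s (1 + len1 T α) (len2 T α β) j +
      winCount s (1 + len1 T α + len2 T α β) (T - (len1 T α + len2 T α β)) j := by
    funext j
    rw [← winCount_add]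
    congr 1
    lia
  rw [M.VHI_eq, M.VHII_eq, hsplit, add_assoc]
  refine add_le_add_right (hM.add_lpVal_le (fun j => ?_) (fun j => winCount_nonneg ..)
    fun i => ?_) _
  · exact decCount_mem (fun t => M.decII_mem ..) _ _ j
  · have := hM.capII_nonneg (γ := γ) (s := s) (T := T) (α := α) (by lia) (len2 T α β) i
    rw [M.capII_eq] at this
    linarith

lemma Model.Valid.VHI_sub_VHII_le (hM : M.Valid) (s : ℕ → Fin n) :
    M.VHI T α s - M.VHII T α β γ s ≤ M.rTot * T := by
  rw [M.VHI_eq, M.VHII_eq]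
  have h1 := hM.lpVal_winCount_le (M.capStartII T α) s (1 + len1 T α) (T - len1 T α)
  have h2 : M.rTot * ((T - len1 T α : ℕ) : ℝ) ≤ M.rTot * T :=
    mul_le_mul_of_nonneg_left (by exact_mod_cast Nat.sub_le _ _) hM.rTot_nonneg
  have h3 := hM.lpVal_nonneg
    (fun i => M.capStartII T α i - ∑ j, M.A i j * M.countII T α γ s (len2 T α β) j)
    (winCount s (1 + len1 T α + len2 T α β) (T - (len1 T α + len2 T α β)))
  have h4 : 0 ≤ ∑ j, M.r j * M.countII T α γ s (len2 T α β) j := Finset.sum_nonneg fun j _ =>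
    mul_nonneg (hM.r_nonneg j) (decCount_mem (fun t => M.decII_mem ..) _ _ j).1
  linarith

lemma Model.VHII_sub_VFD (M : Model m n) (T : ℕ) (α β γ : ℝ) (s : ℕ → Fin n) :
    M.VHII T α β γ s - M.VFD T α β γ s =
      M.lpVal (M.capStartIII T α β γ s)
        (winCount s (1 + len1 T α + len2 T α β) (T - (len1 T α + len2 T α β))) -
      M.revIII T α β γ s := by
  rw [Model.VHII, Model.VFD, Model.hindsight_succ, add_assoc 1]
  ring

lemma Model.Valid.VFD_le_VHII (hM : M.Valid) (hl : len1 T α ≤ T) (s : ℕ → Fin n) :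
    M.VFD T α β γ s ≤ M.VHII T α β γ s := by
  have h := M.VHII_sub_VFD T α β γ s
  have : M.revIII T α β γ s ≤ M.lpVal (M.capStartIII T α β γ s)
      (winCount s (1 + len1 T α + len2 T α β) (T - (len1 T α + len2 T α β))) := by
    rw [M.revIII_eq]
    refine hM.le_lpVal (fun i => ?_) fun j => decCount_mem (fun t => M.decIII_mem ..) _ _ j
    have := hM.capIII_nonneg (β := β) (γ := γ) (s := s) hl (T - (len1 T α + len2 T α β)) i
    rw [M.capIII_eq] at this
    linarith
  linarith

end PhaseII


/-! ### Revenue of a full run of Algorithm FF -/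

lemma Model.Valid.sum_alphaBar_nonneg (hM : M.Valid) : 0 ≤ ∑ i, M.alphaBar i :=
  Finset.sum_nonneg fun i _ => hM.alphaBar_nonneg i

/-- This is what the factor `B_max / B_min` in `θ̄` is for: the price `θ̄` on any one resource
outweighs the dual value at `ᾱ`, and with it the minimal dual value. -/
lemma Model.Valid.dual_alphaBar_le (hM : M.Valid) {B : Fin m → ℝ} (hB : ∀ i, 0 < B i) {L : ℝ}
    (hL : 0 < L) (i : Fin m) :
    M.dual (fun i => B i / L) M.alphaBar ≤ M.thetaBar B * (B i / L) := by
  have := hM.nonempty_resources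
  have hinf := iInf_fin_pos hB
  have hsup := iSup_fin_pos hB
  have hs := hM.sum_alphaBar_nonneg
  rw [hM.dual_alphaBar]
  have h1 : ∑ i, M.alphaBar i * (B i / L) ≤ (∑ i, M.alphaBar i) * ((⨆ i, B i) / L) := by
    rw [Finset.sum_mul]
    exact Finset.sum_le_sum fun i _ => mul_le_mul_of_nonneg_left
      (div_le_div_of_nonneg_right (le_iSup_fin B i) hL.le) (hM.alphaBar_nonneg i)
  have h2 : (⨆ i, B i) ≤ (⨆ i, B i) / (⨅ i, B i) * B i := by
    rw [div_mul_eq_mul_div, le_div_iff₀ hinf]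
    exact mul_le_mul_of_nonneg_left (iInf_fin_le B i) hsup.le
  calc _ ≤ (∑ i, M.alphaBar i) * ((⨆ i, B i) / L) := h1
    _ ≤ (∑ i, M.alphaBar i) * (((⨆ i, B i) / (⨅ i, B i) * B i) / L) := by gcongr
    _ = _ := by rw [Model.thetaBar]; ring

/-- Error term in the analysis of a run of Algorithm FF over `k` periods. -/
noncomputable def Model.ffError (M : Model m n) (B : Fin m → ℝ) (L : ℝ) (k : ℕ) : ℝ :=
  M.thetaBar B * M.aBar + m * (3 / 2 * M.thetaBar B * M.slope B L * √(k : ℝ))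

/-- Over a full horizon, stopping early costs nothing essential. If the run is still active at the
end, compare with `u = 0`. Otherwise some resource `i` has consumption above `B_i - ā`; comparing
with `u = θ̄ e_i` yields `θ̄ B_i / L` per stopped period, which is at least `v`. -/
lemma Model.Valid.revenue_full_ge (hM : M.Valid) {s : ℕ → Fin n} {B : Fin m → ℝ} {L : ℝ}
    {t₁ k : ℕ} (hB : ∀ i, 0 < B i) (hL : 0 < L) (hk : (k : ℝ) = L) {v : ℝ}
    (hv : v ≤ M.dual (fun i => B i / L) M.alphaBar) :
    ∑ t ∈ Finset.range k, M.act s B L t₁ t *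
        M.dualAt (fun i => B i / L) (M.price s B L t₁ t) (s (t₁ + t)) +
      (k - M.activeTime s B L t₁ k) * v - M.ffError B L k ≤
    ∑ t ∈ Finset.range k, M.r (s (t₁ + t)) * M.ffDecision s B L t₁ t := by
  have hΘ := hM.thetaBar_nonneg hB
  have ha := hM.aBar_pos
  have hΘa : 0 ≤ M.thetaBar B * M.aBar := mul_nonneg hΘ ha.le
  rw [Model.ffError]
  by_cases hact : M.Active s B L t₁ k
  · have h := hM.revenue_ge (s := s) (t₁ := t₁) hB hL (u := fun _ => 0)
      (fun _ => ⟨le_rfl, hΘ⟩) k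
    rw [Model.activeTime_of_active fun t ht => hact.mono ht.le]
    simp only [zero_mul, Finset.sum_const_zero] at h
    linarith
  · obtain ⟨i, hi⟩ := Model.exists_lt_used_of_not_active hact
    classical
    have h := hM.revenue_ge (s := s) (t₁ := t₁) hB hL
      (u := fun l => if l = i then M.thetaBar B else 0)
      (fun l => by split_ifs; exacts [⟨hΘ, le_rfl⟩, ⟨le_rfl, hΘ⟩]) k
    simp only [ite_mul, zero_mul, Finset.sum_ite_eq', Finset.mem_univ, if_true] at h
    have h1 : (k - M.activeTime s B L t₁ k) * v ≤
        (k - M.activeTime s B L t₁ k) * (M.thetaBar B * (B i / L)) :=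
      mul_le_mul_of_nonneg_left (hv.trans (hM.dual_alphaBar_le hB hL i))
        (by linarith [M.activeTime_le s B L t₁ k])
    have h2 : (k : ℝ) * (B i / L) = B i := by rw [hk]; field_simp
    have h3 : (k - M.activeTime s B L t₁ k) * (M.thetaBar B * (B i / L)) - M.thetaBar B * M.aBar ≤
        M.thetaBar B * (M.used s B L t₁ i k - M.activeTime s B L t₁ k * (B i / L)) := by
      have := mul_le_mul_of_nonneg_left hi.le hΘ
      have h4 : (k - M.activeTime s B L t₁ k) * (M.thetaBar B * (B i / L)) =
        M.thetaBar B * (B i - M.activeTime s B L t₁ k * (B i / L)) := by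
        linear_combination M.thetaBar B * h2
      rw [h4]
      linarith
    linarith

lemma Model.Valid.sum_lam_mul_dualAt (hM : M.Valid) (c p : Fin m → ℝ) :
    ∑ j, M.lam j * M.dualAt c p j = M.dual c p := by
  simp_rw [Model.dualAt, mul_add, Finset.sum_add_distrib, ← Finset.sum_mul, hM.lam_sum, one_mul]
  rfl

lemma Model.Valid.sum_lam_mul_sub (hM : M.Valid) (c p : Fin m → ℝ) :
    ∑ j, M.lam j * (M.dualAt c p j - M.dual c p) = 0 := by
  simp_rw [mul_sub, Finset.sum_sub_distrib, ← Finset.sum_mul, hM.lam_sum, one_mul,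
    hM.sum_lam_mul_dualAt, sub_self]

lemma Model.Valid.exists_entry_lower_bound (hM : M.Valid) :
    ∃ a₀ : ℝ, 0 < a₀ ∧ ∀ i j, M.A i j ≠ 0 → a₀ ≤ M.A i j := by
  have hfin := Set.toFinite {q : Fin m × Fin n | M.A q.1 q.2 ≠ 0}
  obtain ⟨j⟩ := hM.nonempty_types
  obtain ⟨i, hi⟩ := hM.A_used j
  obtain ⟨q, hq, hmin⟩ := Set.exists_min_image _ (fun q => M.A q.1 q.2) hfin ⟨(i, j), hi⟩
  exact ⟨M.A q.1 q.2, lt_of_le_of_ne (hM.A_nonneg _ _) (Ne.symm hq),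
    fun i j h => hmin (i, j) h⟩

/-! ### Phase III -/

section PhaseIII

variable {T : ℕ} {α β γ : ℝ} {s : ℕ → Fin n}

lemma Model.virtCapIII_pos (M : Model m n) (hT : 0 < T) (i : Fin m) :
    0 < M.virtCapIII T α β γ s i :=
  lt_max_of_lt_left (Real.rpow_pos_of_pos (by exact_mod_cast hT) _)

lemma Model.Valid.virtCapIII_le (hM : M.Valid) (hl : len1 T α ≤ T) (i : Fin m) :
    M.virtCapIII T α β γ s i ≤
      M.capStartIII T α β γ s i + (T : ℝ) ^ (3 / 4 * (1 / 2 + β)) := by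
  have h1 : 0 ≤ M.capStartIII T α β γ s i := hM.capII_nonneg hl _ i
  have h2 : 0 ≤ (T : ℝ) ^ (3 / 4 * (1 / 2 + β)) := Real.rpow_nonneg (Nat.cast_nonneg T) _
  refine max_le (by linarith) ((min_le_left _ _).trans (by linarith))

open scoped Classical in
/-- Number of customers accepted by the virtual run of phase III for whom resource `i` is
lacking. -/
noncomputable def Model.lackCount (M : Model m n) (T : ℕ) (α β γ : ℝ) (s : ℕ → Fin n) (i : Fin m)
    (k : ℕ) : ℝ :=
  ∑ t ∈ Finset.range k,
    if M.capIII T α β γ s t i < M.A i (s (1 + len1 T α + len2 T α β + t)) then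
      M.subIII T α β γ s t else 0

/-- When resource `i` is first lacking, its real capacity is below `ā`, so its virtual capacity is
below `T^(3b/4) + ā`. Each counted acceptance uses at least `a₀` of the virtual capacity, which
never becomes negative. -/
lemma Model.Valid.lackCount_le (hM : M.Valid) (hT : 0 < T) (hl : len1 T α ≤ T) {a₀ : ℝ}
    (ha₀ : 0 < a₀) (ha : ∀ i j, M.A i j ≠ 0 → a₀ ≤ M.A i j) (i : Fin m) (k : ℕ) :
    M.lackCount T α β γ s i k ≤ ((T : ℝ) ^ (3 / 4 * (1 / 2 + β)) + M.aBar) / a₀ := by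
  set W := (T : ℝ) ^ (3 / 4 * (1 / 2 + β)) with hW
  have hW0 : 0 ≤ W := Real.rpow_nonneg (Nat.cast_nonneg T) _
  set V := fun k => M.virtCapIII T α β γ s i - M.used s (M.virtCapIII T α β γ s)
    ((T : ℝ) - len1 T α - len2 T α β) (1 + len1 T α + len2 T α β) i k with hV
  have hVsucc : ∀ k, V (k + 1) = V k - M.subIII T α β γ s k *
      M.A i (s (1 + len1 T α + len2 T α β + k)) := fun k => by
    simp only [hV, Model.used, Finset.sum_range_succ, Model.subIII]
    ring
  have hy : ∀ k, 0 ≤ M.subIII T α β γ s k ∧ M.subIII T α β γ s k ≤ 1 := fun k =>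
    ⟨M.ffDecision_nonneg .., M.ffDecision_le_one ..⟩
  have hy01 : ∀ k, M.subIII T α β γ s k = 0 ∨ M.subIII T α β γ s k = 1 := fun k => by
    unfold Model.subIII Model.ffDecision
    split_ifs
    exacts [M.bid_mem _ _, Or.inl rfl]
  have hdec : ∀ k, M.decIII T α β γ s (M.capIII T α β γ s k) k ≤ M.subIII T α β γ s k := by
    intro k
    unfold Model.decIII
    split_ifs
    exacts [le_rfl, (hy k).1]
  -- The virtual capacity leads the real one by at most `W` at all times, because every real
  -- acceptance is also a virtual one. The second part starts with the first counted customer.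
  have key : ∀ k, V k - M.capIII T α β γ s k i ≤ W ∧
      (M.lackCount T α β γ s i k = 0 ∨
        a₀ * M.lackCount T α β γ s i k + V k ≤ W + M.aBar) := by
    intro k
    induction k with
    | zero =>
      refine ⟨?_, Or.inl (by simp [Model.lackCount])⟩
      have := hM.virtCapIII_le (β := β) (γ := γ) (s := s) hl i
      simp only [hV, Model.used, Finset.range_zero, Finset.sum_empty, Model.capIII]
      linarith
    | succ k ih =>
      obtain ⟨ih1, ih2⟩ := ih
      set j := s (1 + len1 T α + len2 T α β + k) with hj
      have hAj := hM.A_nonneg i j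
      refine ⟨?_, ?_⟩
      · rw [hVsucc, M.capIII_succ]
        have := mul_le_mul_of_nonneg_right (hdec k) hAj
        linarith
      · have hl : M.lackCount T α β γ s i (k + 1) = M.lackCount T α β γ s i k +
            if M.capIII T α β γ s k i < M.A i j then M.subIII T α β γ s k else 0 := by
          rw [Model.lackCount, Finset.sum_range_succ]; rfl
        have hdecr : 0 ≤ M.subIII T α β γ s k * M.A i j := mul_nonneg (hy k).1 hAj
        rw [hl, hVsucc]
        split_ifs with hlt
        · rcases hy01 k with h0 | h1
          · rw [h0]
            simpa using ih2
          · have hcap := hM.capIII_nonneg (β := β) (γ := γ) (s := s) ‹len1 T α ≤ T› k i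
            have ha1 := ha i j (hcap.trans_lt hlt).ne'
            right
            rw [h1]
            rcases ih2 with h2 | h2
            · rw [h2]
              have := M.le_aBar i j
              linarith
            · linarith
        · rw [add_zero]
          exact ih2.imp id fun h => by linarith
  have hVk : 0 ≤ V k := by
    have := hM.used_le (s := s) (L := (T : ℝ) - len1 T α - len2 T α β)
      (t₁ := 1 + len1 T α + len2 T α β)
      (fun i => (M.virtCapIII_pos (α := α) (β := β) (γ := γ) (s := s) hT i).le) k i
    simp only [hV]
    linarith
  rw [le_div_iff₀ ha₀]
  rcases (key k).2 with h | h
  · rw [h, zero_mul]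
    linarith [hM.aBar_pos]
  · linarith

/-- Revenue lost in phase III since the real capacities are smaller than the virtual ones. -/
lemma Model.Valid.sub_revIII_le (hM : M.Valid) (hT : 0 < T) (hl : len1 T α ≤ T) {a₀ : ℝ}
    (ha₀ : 0 < a₀) (ha : ∀ i j, M.A i j ≠ 0 → a₀ ≤ M.A i j) :
    ∑ t ∈ Finset.range (T - (len1 T α + len2 T α β)),
        M.r (s (1 + len1 T α + len2 T α β + t)) * M.subIII T α β γ s t - M.revIII T α β γ s ≤
      M.rTot * (m * (((T : ℝ) ^ (3 / 4 * (1 / 2 + β)) + M.aBar) / a₀)) := by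
  have hy : ∀ k, 0 ≤ M.subIII T α β γ s k := fun k => M.ffDecision_nonneg ..
  have hterm : ∀ k, M.subIII T α β γ s k - M.decIII T α β γ s (M.capIII T α β γ s k) k ≤
      ∑ i, if M.capIII T α β γ s k i < M.A i (s (1 + len1 T α + len2 T α β + k)) then
        M.subIII T α β γ s k else 0 := by
    intro k
    have hnn : ∀ i ∈ Finset.univ (α := Fin m), 0 ≤ (if M.capIII T α β γ s k i <
        M.A i (s (1 + len1 T α + len2 T α β + k)) then M.subIII T α β γ s k else 0) := by
      intro i _
      split_ifs
      exacts [hy k, le_rfl]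
    unfold Model.decIII
    split_ifs with h
    · rw [sub_self]
      exact Finset.sum_nonneg hnn
    · push Not at h
      obtain ⟨i, hi⟩ := h
      rw [sub_zero]
      have := Finset.single_le_sum hnn (Finset.mem_univ i)
      rwa [if_pos hi] at this
  rw [Model.revIII, ← Finset.sum_sub_distrib]
  calc _ ≤ ∑ t ∈ Finset.range (T - (len1 T α + len2 T α β)), M.rTot *
        ∑ i, (if M.capIII T α β γ s t i < M.A i (s (1 + len1 T α + len2 T α β + t)) then
          M.subIII T α β γ s t else 0) := by
        refine Finset.sum_le_sum fun t _ => ?_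
        rw [← mul_sub]
        have hd : 0 ≤ M.subIII T α β γ s t - M.decIII T α β γ s (M.capIII T α β γ s t) t := by
          unfold Model.decIII
          split_ifs
          · simp
          · simpa using hy t
        exact mul_le_mul (hM.r_le_rTot _) (hterm t) hd hM.rTot_nonneg
    _ = M.rTot * ∑ i, M.lackCount T α β γ s i (T - (len1 T α + len2 T α β)) := by
        rw [← Finset.mul_sum, Finset.sum_comm]
        congr 1
    _ ≤ M.rTot * ∑ _i : Fin m, ((T : ℝ) ^ (3 / 4 * (1 / 2 + β)) + M.aBar) / a₀ :=
        mul_le_mul_of_nonneg_left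
          (Finset.sum_le_sum fun i _ => hM.lackCount_le hT hl ha₀ ha i _) hM.rTot_nonneg
    _ = _ := by rw [Finset.sum_const, Finset.card_univ, Fintype.card_fin, nsmul_eq_mul]

open scoped Classical in
/-- A chosen minimizer of the dual objective. -/
noncomputable def Model.argDual (M : Model m n) (c : Fin m → ℝ) : Fin m → ℝ :=
  if h : ∃ p, M.IsDualMin c p then h.choose else 0

lemma Model.Valid.argDual_spec (hM : M.Valid) {c : Fin m → ℝ} (hc : ∀ i, 0 < c i) :
    M.IsDualMin c (M.argDual c) := by
  unfold Model.argDual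
  rw [dif_pos (hM.exists_isDualMin hc)]
  exact (hM.exists_isDualMin hc).choose_spec

/-- Martingale differences that compare the hindsight optimum with Algorithm FF in phase III. -/
noncomputable def Model.incIII (M : Model m n) (T : ℕ) (α β γ : ℝ) (k : ℕ) (s : ℕ → Fin n)
    (j : Fin n) : ℝ :=
  let L := (T : ℝ) - len1 T α - len2 T α β
  let B := M.virtCapIII T α β γ s
  let c := fun i => B i / L
  let θ := M.price s B L (1 + len1 T α + len2 T α β) k
  (M.dualAt c (M.argDual c) j - M.dual c (M.argDual c)) -
    M.act s B L (1 + len1 T α + len2 T α β) k * (M.dualAt c θ j - M.dual c θ)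

/-- The virtual capacity, hence the dual minimizer, is known when phase III starts, and the current
price before the customer arrives; `dualAt` averages to `dual`. -/
lemma Model.Valid.isIncrement_incIII (hM : M.Valid) (T : ℕ) (α β γ : ℝ) :
    M.IsIncrement (1 + len1 T α + len2 T α β) (M.incIII T α β γ) where
  dependsOn k j s s' h := by
    have h1 := M.virtCapIII_congr T α β γ (s := s) (s' := s') fun t ht =>
      h t (Set.mem_Iio.2 (by lia))
    simp only [Model.incIII]
    rw [h1, M.act_congr _ _ _ (s' := s') h, M.price_congr _ _ _ (s' := s') h]
  mean k s := by
    simp only [Model.incIII, mul_sub (M.lam _), Finset.sum_sub_distrib]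
    simp only [mul_left_comm (M.lam _), ← Finset.mul_sum]
    simp_rw [mul_sub (M.lam _), Finset.sum_sub_distrib, ← Finset.sum_mul, hM.lam_sum, one_mul,
      hM.sum_lam_mul_dualAt]
    simp

/-- Phase III, path by path. -/
lemma Model.Valid.VHII_sub_VFD_le (hM : M.Valid) (hT : 0 < T) {k : ℕ}
    (hk : len1 T α + len2 T α β + k = T) (hk0 : 0 < k) (hkb : (k : ℝ) ≤ (T : ℝ) ^ (1 / 2 + β))
    {a₀ : ℝ} (ha₀ : 0 < a₀) (ha : ∀ i j, M.A i j ≠ 0 → a₀ ≤ M.A i j) :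
    M.VHII T α β γ s - M.VFD T α β γ s ≤
      ∑ t ∈ Finset.range k, M.incIII T α β γ t s (s (1 + len1 T α + len2 T α β + t)) +
        M.ffError (M.virtCapIII T α β γ s) k k +
        M.rTot * (m * (((T : ℝ) ^ (3 / 4 * (1 / 2 + β)) + M.aBar) / a₀)) := by
  have hTk : T - (len1 T α + len2 T α β) = k := by lia
  have hL : (T : ℝ) - len1 T α - len2 T α β = k := by
    have : (len1 T α : ℝ) + len2 T α β + k = T := by exact_mod_cast hk
    linarith
  have hk0' : (0 : ℝ) < k := by exact_mod_cast hk0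
  have hloss := hM.sub_revIII_le (α := α) (β := β) (γ := γ) (s := s) hT (by lia) ha₀ ha
  set t₁ := 1 + len1 T α + len2 T α β with ht₁
  set B := M.virtCapIII T α β γ s with hB
  have hBpos : ∀ i, 0 < B i := fun i => M.virtCapIII_pos hT i
  set c : Fin m → ℝ := fun i => B i / k with hc
  have hcpos : ∀ i, 0 < c i := fun i => div_pos (hBpos i) hk0'
  set p := M.argDual c with hp
  have hpmin : M.IsDualMin c p := hM.argDual_spec hcpos
  have hff := hM.revenue_full_ge (s := s) (t₁ := t₁) (k := k) hBpos hk0' rfl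
    (hpmin.le _ hM.alphaBar_nonneg)
  rw [M.VHII_sub_VFD, ← ht₁, hTk]
  rw [hTk] at hloss
  -- the hindsight optimum
  have hcap : M.lpVal (M.capStartIII T α β γ s) (winCount s t₁ k) ≤
      M.lpVal B (winCount s t₁ k) := by
    refine Model.lpVal_le (hM.lpVal_nonneg _ _) fun z h1 h2 => hM.le_lpVal (fun i => ?_) h2
    -- The cap `ā T^b` in the virtual capacity does not bind: `k ≤ T^b` arrivals cannot consume more
    -- than that.
    refine le_max_of_le_right (le_min (h1 i) ?_)
    have ha0 := hM.aBar_pos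
    calc ∑ j, M.A i j * z j ≤ ∑ j, M.aBar * winCount s t₁ k j :=
          Finset.sum_le_sum fun j _ => mul_le_mul (M.le_aBar i j) (h2 j).2 (h2 j).1 ha0.le
      _ = M.aBar * k := by
          rw [sum_mul_winCount (fun _ => M.aBar)]
          simp [mul_comm]
      _ ≤ M.aBar * (T : ℝ) ^ (1 / 2 + β) := mul_le_mul_of_nonneg_left hkb ha0.le
  have hdual : M.lpVal B (winCount s t₁ k) ≤
      ∑ t ∈ Finset.range k, M.dualAt c p (s (t₁ + t)) := by
    refine (Model.lpVal_le_dual (fun i => (hBpos i).le) (fun j => winCount_nonneg ..)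
      hpmin.nonneg).trans (le_of_eq ?_)
    rw [sum_mul_winCount (fun j => max 0 (M.margin p j))]
    simp only [Model.dualAt, Finset.sum_add_distrib, Finset.sum_const, Finset.card_range,
      nsmul_eq_mul, hc]
    congr 1
    rw [Finset.mul_sum]
    refine Finset.sum_congr rfl fun i _ => ?_
    field_simp
  have hinc : ∑ t ∈ Finset.range k, M.incIII T α β γ t s (s (t₁ + t)) =
      ∑ t ∈ Finset.range k, M.dualAt c p (s (t₁ + t)) - k * M.dual c p -
      ∑ t ∈ Finset.range k, M.act s B k t₁ t * M.dualAt c (M.price s B k t₁ t) (s (t₁ + t)) +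
      ∑ t ∈ Finset.range k, M.act s B k t₁ t * M.dual c (M.price s B k t₁ t) := by
    simp only [Model.incIII, hL]
    rw [← ht₁, ← hB, ← hc, ← hp]
    simp only [mul_sub, Finset.sum_sub_distrib, Finset.sum_const, Finset.card_range,
      nsmul_eq_mul]
    ring
  have hact : M.activeTime s B k t₁ k * M.dual c p ≤
      ∑ t ∈ Finset.range k, M.act s B k t₁ t * M.dual c (M.price s B k t₁ t) := by
    rw [Model.activeTime, Finset.sum_mul]
    exact Finset.sum_le_sum fun t _ => mul_le_mul_of_nonneg_left
      (hpmin.le _ fun i => (hM.price_mem hBpos t i).1) (M.act_nonneg ..)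
  have hsub : ∀ t, M.subIII T α β γ s t = M.ffDecision s B k t₁ t := fun t => by
    rw [Model.subIII, hL]
  simp only [hsub] at hloss
  rw [hinc]
  linarith

/-- The error term of phase III is of the order `T ^ (3b/4)`. -/
lemma Model.Valid.ffError_virtCapIII_le (hM : M.Valid) (hT : 0 < T) {k : ℕ} (hβ : 0 ≤ 1 / 2 + β)
    (hk1 : (k : ℝ) ≤ (T : ℝ) ^ (1 / 2 + β)) (hk2 : (T : ℝ) ^ (1 / 2 + β) / 2 ≤ k) :
    M.ffError (M.virtCapIII T α β γ s) k k ≤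
      (1 + M.aBar) * (∑ i, M.alphaBar i) * (M.aBar + m * (3 / 2 * (2 + 3 * M.aBar))) *
        (T : ℝ) ^ (3 / 4 * (1 / 2 + β)) := by
  have := hM.nonempty_resources
  have hT0 : (0 : ℝ) ≤ T := Nat.cast_nonneg T
  have hT1 : (1 : ℝ) ≤ T := by exact_mod_cast hT
  have ha := hM.aBar_pos
  have hs := hM.sum_alphaBar_nonneg
  set B := M.virtCapIII T α β γ s with hB
  have hBpos : ∀ i, 0 < B i := fun i => M.virtCapIII_pos hT i
  -- In units of `X = T^(b/4)`: capacities lie between `X³` and `O(X⁴)`, so `θ̄ = O(X)`; with `√k ≤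
  -- X²` and bounded gradients the regret is `O(X³)`. The floor `T^(3b/4)` balances this against the
  -- overdraft of the virtual capacity.
  set X := (T : ℝ) ^ ((1 / 2 + β) / 4) with hX
  have hX1 : 1 ≤ X := Real.one_le_rpow hT1 (by linarith)
  have hX0 : 0 < X := by linarith
  have h3 : (T : ℝ) ^ (3 / 4 * (1 / 2 + β)) = X ^ 3 := by
    rw [hX, ← Real.rpow_natCast, ← Real.rpow_mul hT0]
    congr 1
    push_cast; ring
  have h4 : (T : ℝ) ^ (1 / 2 + β) = X ^ 4 := by
    rw [hX, ← Real.rpow_natCast, ← Real.rpow_mul hT0]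
    congr 1
    push_cast; ring
  rw [h4] at hk1 hk2
  rw [h3]
  have hk0 : (0 : ℝ) < k := lt_of_lt_of_le (by positivity) hk2
  have hBup : (⨆ i, B i) ≤ (1 + M.aBar) * X ^ 4 := by
    refine ciSup_le fun i => ?_
    simp only [hB, Model.virtCapIII, h3, h4]
    have h5 : X ^ 3 ≤ X ^ 4 := pow_le_pow_right₀ hX1 (by norm_num)
    refine max_le ?_ ((min_le_right _ _).trans ?_)
    · nlinarith [pow_pos hX0 4]
    · nlinarith [pow_pos hX0 4]
  have hBlow : X ^ 3 ≤ ⨅ i, B i := le_ciInf fun i => by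
    simp only [hB, Model.virtCapIII, h3]
    exact le_max_left _ _
  have hΘ : M.thetaBar B ≤ (1 + M.aBar) * (∑ i, M.alphaBar i) * X := by
    rw [Model.thetaBar]
    have h6 : (⨆ i, B i) / (⨅ i, B i) ≤ (1 + M.aBar) * X := by
      rw [div_le_iff₀ (iInf_fin_pos hBpos)]
      calc (⨆ i, B i) ≤ (1 + M.aBar) * X * X ^ 3 := by linarith
        _ ≤ _ := by gcongr
    calc _ ≤ (1 + M.aBar) * X * ∑ i, M.alphaBar i := by gcongr
      _ = _ := by ring
  have hG : M.slope B k ≤ 2 + 3 * M.aBar := by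
    rw [Model.slope]
    have : (⨆ i, B i) / (k : ℝ) ≤ 2 * (1 + M.aBar) := by
      rw [div_le_iff₀ hk0]
      nlinarith
    linarith
  have hG0 := hM.slope_pos hBpos hk0
  have hsq : √(k : ℝ) ≤ X ^ 2 := by
    rw [Real.sqrt_le_left (by positivity)]
    calc (k : ℝ) ≤ X ^ 4 := hk1
      _ = (X ^ 2) ^ 2 := by ring
  have hΘ0 := hM.thetaBar_nonneg hBpos
  rw [Model.ffError]
  set Q := (1 + M.aBar) * ∑ i, M.alphaBar i with hQ
  have hQ0 : 0 ≤ Q := by positivity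
  have e1 : M.thetaBar B * M.aBar ≤ Q * M.aBar * X ^ 3 := by
    have : X ≤ X ^ 3 := le_self_pow₀ hX1 (by norm_num)
    calc M.thetaBar B * M.aBar ≤ Q * X * M.aBar := by gcongr
      _ ≤ Q * X ^ 3 * M.aBar := by gcongr
      _ = _ := by ring
  have e2 : (m : ℝ) * (3 / 2 * M.thetaBar B * M.slope B k * √(k : ℝ)) ≤
      Q * (m * (3 / 2 * (2 + 3 * M.aBar))) * X ^ 3 := by
    calc (m : ℝ) * (3 / 2 * M.thetaBar B * M.slope B k * √(k : ℝ)) ≤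
          m * (3 / 2 * (Q * X) * (2 + 3 * M.aBar) * X ^ 2) := by gcongr
      _ = _ := by ring
  nlinarith

/-- On every path the loss is a martingale plus a multiple of `T^(3b/4)`; in expectation the
martingale disappears. -/
lemma Model.Valid.exists_phaseIII_bound (hM : M.Valid) :
    ∃ K : ℝ, 0 ≤ K ∧ ∀ {Ω : Type*} [MeasurableSpace Ω] {μ : Measure Ω} [IsProbabilityMeasure μ]
      {J : ℕ → Ω → Fin n}, M.IsArrivalSequence μ J → ∀ (T : ℕ) (α β γ : ℝ) (k : ℕ), 0 < T →
      0 ≤ 1 / 2 + β → len1 T α + len2 T α β + k = T → (k : ℝ) ≤ (T : ℝ) ^ (1 / 2 + β) →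
      (T : ℝ) ^ (1 / 2 + β) / 2 ≤ k →
      |∫ ω, (M.VHII T α β γ (fun t => J t ω) - M.VFD T α β γ (fun t => J t ω)) ∂μ| ≤
        K * (T : ℝ) ^ (3 / 4 * (1 / 2 + β)) := by
  obtain ⟨a₀, ha₀, ha⟩ := hM.exists_entry_lower_bound
  have ha0 := hM.aBar_pos
  have hs := hM.sum_alphaBar_nonneg
  have hr := hM.rTot_nonneg
  set K₁ := (1 + M.aBar) * (∑ i, M.alphaBar i) * (M.aBar + m * (3 / 2 * (2 + 3 * M.aBar)))
    with hK₁
  set K₂ := M.rTot * (m * ((1 + M.aBar) / a₀)) with hK₂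
  have hK₁0 : 0 ≤ K₁ := by positivity
  have hK₂0 : 0 ≤ K₂ := by positivity
  refine ⟨K₁ + K₂, by positivity, ?_⟩
  intro Ω _ μ _ J hJ T α β γ k hT hβ hk hk1 hk2
  have hT1 : (1 : ℝ) ≤ T := by exact_mod_cast hT
  set W := (T : ℝ) ^ (3 / 4 * (1 / 2 + β)) with hW
  have hW1 : 1 ≤ W := Real.one_le_rpow hT1 (by linarith)
  have hk0 : 0 < k := by
    have : (0 : ℝ) < k := lt_of_lt_of_le
      (half_pos (Real.rpow_pos_of_pos (by linarith) _)) hk2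
    exact_mod_cast this
  have hup : ∀ s, M.VHII T α β γ s - M.VFD T α β γ s ≤
      ∑ t ∈ Finset.range k, M.incIII T α β γ t s (s (1 + len1 T α + len2 T α β + t)) +
        (K₁ + K₂) * W := by
    intro s
    have h1 := hM.VHII_sub_VFD_le (γ := γ) (s := s) hT hk hk0 hk1 ha₀ ha
    have h2 := hM.ffError_virtCapIII_le (α := α) (γ := γ) (s := s) hT hβ hk1 hk2
    rw [← hW] at h1 h2
    rw [← hK₁] at h2
    have h3 : M.rTot * (m * ((W + M.aBar) / a₀)) ≤ K₂ * W := by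
      calc M.rTot * (m * ((W + M.aBar) / a₀)) ≤ M.rTot * (m * (((1 + M.aBar) * W) / a₀)) := by
            gcongr
            nlinarith
        _ = K₂ * W := by rw [hK₂]; ring
    linarith
  have hinc := hM.isIncrement_incIII T α β γ
  have hint1 := hJ.integrable_of_dependsOn (M.dependsOn_VHII T α β γ)
  have hint2 := hJ.integrable_of_dependsOn (M.dependsOn_VFD T α β γ)
  have hint3 := hJ.integrable_of_dependsOn (hinc.dependsOn_sum k)
  rw [abs_of_nonneg (integral_nonneg fun ω => sub_nonneg.2 (hM.VFD_le_VHII (by lia) _))]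
  refine (integral_mono (hint1.sub hint2) (hint3.add (integrable_const ((K₁ + K₂) * W)))
    fun ω => hup fun t => J t ω).trans (le_of_eq ?_)
  simp only [Pi.add_apply]
  rw [integral_add hint3 (integrable_const _), hJ.integral_sum_increment hinc k]
  simp

end PhaseIII


/-! ### Runs of Algorithm FF with capacities proportional to `rho` -/

/-- Capacities for a horizon of length `L`. -/
def Model.rhoCap (M : Model m n) (L : ℝ) : Fin m → ℝ := fun i => L * M.rho i

lemma Model.Valid.rhoCap_pos (hM : M.Valid) {L : ℝ} (hL : 0 < L) (i : Fin m) :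
    0 < M.rhoCap L i := mul_pos hL (hM.rho_pos i)

lemma Model.rhoCap_div (M : Model m n) {L : ℝ} (hL : 0 < L) :
    (fun i => M.rhoCap L i / L) = M.rho := by
  funext i
  rw [Model.rhoCap, mul_div_cancel_left₀ _ hL.ne']

lemma Model.thetaBar_rhoCap (M : Model m n) {L : ℝ} (hL : 0 < L) :
    M.thetaBar (M.rhoCap L) = M.thetaBar M.rho := by
  unfold Model.thetaBar Model.rhoCap
  rw [← Real.mul_iSup_of_nonneg hL.le, ← Real.mul_iInf_of_nonneg hL.le,
    mul_div_mul_left _ _ hL.ne']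

lemma Model.slope_rhoCap (M : Model m n) {L : ℝ} (hL : 0 < L) :
    M.slope (M.rhoCap L) L = M.slope M.rho 1 := by
  unfold Model.slope Model.rhoCap
  rw [← Real.mul_iSup_of_nonneg hL.le, mul_div_cancel_left₀ _ hL.ne', div_one]

/-- Constant for the error terms of runs with capacities proportional to `rho`. -/
noncomputable def Model.runConst (M : Model m n) : ℝ :=
  M.thetaBar M.rho * M.aBar + m * (3 / 2 * M.thetaBar M.rho * M.slope M.rho 1) + 1

lemma Model.Valid.one_le_runConst (hM : M.Valid) : 1 ≤ M.runConst := by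
  have h1 := hM.thetaBar_nonneg hM.rho_pos
  have h2 := hM.slope_pos hM.rho_pos one_pos
  have h3 := hM.aBar_pos
  have : 0 ≤ M.thetaBar M.rho * M.aBar +
    m * (3 / 2 * M.thetaBar M.rho * M.slope M.rho 1) := by positivity
  rw [Model.runConst]
  linarith

/-- The random fluctuations in the first `k` periods of a run are at most `e`. -/
structure Model.GoodRun (M : Model m n) (s : ℕ → Fin n) (L : ℝ) (t₁ k : ℕ) (e : ℝ) : Prop where
  rev : -e ≤ ∑ t ∈ Finset.range k, M.act s (M.rhoCap L) L t₁ t *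
    (M.dualAt M.rho (M.price s (M.rhoCap L) L t₁ t) (s (t₁ + t)) -
      M.dual M.rho (M.price s (M.rhoCap L) L t₁ t))
  arr : ∀ j, M.ffArrivals s (M.rhoCap L) L t₁ k j ≤
    M.activeTime s (M.rhoCap L) L t₁ k * M.lam j + e

section GoodRun

variable {s : ℕ → Fin n} {L e : ℝ} {t₁ k : ℕ} {p : Fin m → ℝ}

lemma Model.sum_r_mul_ffCount (M : Model m n) (s : ℕ → Fin n) (B : Fin m → ℝ) (L : ℝ)
    (t₁ k : ℕ) : ∑ j, M.r j * M.ffCount s B L t₁ k j =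
      ∑ t ∈ Finset.range k, M.r (s (t₁ + t)) * M.ffDecision s B L t₁ t :=
  sum_mul_count _ _ _ _ _

lemma Model.GoodRun.sum_dualAt_ge (h : M.GoodRun s L t₁ k e) (hM : M.Valid) (hL : 0 < L)
    (hp : M.IsDualMin M.rho p) :
    M.activeTime s (M.rhoCap L) L t₁ k * M.dual M.rho p - e ≤
      ∑ t ∈ Finset.range k, M.act s (M.rhoCap L) L t₁ t *
        M.dualAt M.rho (M.price s (M.rhoCap L) L t₁ t) (s (t₁ + t)) := by
  have h1 := h.rev
  simp only [mul_sub, Finset.sum_sub_distrib] at h1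
  have h2 : M.activeTime s (M.rhoCap L) L t₁ k * M.dual M.rho p ≤
      ∑ t ∈ Finset.range k, M.act s (M.rhoCap L) L t₁ t *
        M.dual M.rho (M.price s (M.rhoCap L) L t₁ t) := by
    rw [Model.activeTime, Finset.sum_mul]
    exact Finset.sum_le_sum fun t _ => mul_le_mul_of_nonneg_left
      (hp.le _ fun i => (hM.price_mem (hM.rhoCap_pos hL) t i).1) (M.act_nonneg ..)
  linarith

/-- On a good run the dual contributions are close to their conditional means, each of which is at
least the dual minimum. The comparison price `u` stays free, to penalize whatever resource is
overused. -/
lemma Model.GoodRun.revenue_ge (h : M.GoodRun s L t₁ k e) (hM : M.Valid) (hL : 0 < L)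
    (he : 0 ≤ e) (hp : M.IsDualMin M.rho p) {u : Fin m → ℝ}
    (hu : ∀ i, 0 ≤ u i ∧ u i ≤ M.thetaBar M.rho) :
    M.activeTime s (M.rhoCap L) L t₁ k * M.dual M.rho p +
      ∑ i, u i * (M.used s (M.rhoCap L) L t₁ i k -
        M.activeTime s (M.rhoCap L) L t₁ k * M.rho i) - M.runConst * (e + 1 + √(k : ℝ)) ≤
      ∑ j, M.r j * M.ffCount s (M.rhoCap L) L t₁ k j := by
  have h1 := h.sum_dualAt_ge hM hL hp
  have h2 := hM.revenue_ge (s := s) (t₁ := t₁) (hM.rhoCap_pos hL) hL (u := u)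
    (fun i => by rw [M.thetaBar_rhoCap hL]; exact hu i) k
  rw [M.thetaBar_rhoCap hL, M.slope_rhoCap hL, M.rhoCap_div hL] at h2
  have h3 : ∀ i, M.rhoCap L i / L = M.rho i := fun i => congrFun (M.rhoCap_div hL) i
  simp only [h3] at h2
  rw [M.sum_r_mul_ffCount]
  have hΘ := hM.thetaBar_nonneg hM.rho_pos
  have hG := hM.slope_pos hM.rho_pos one_pos
  have ha := hM.aBar_pos
  have hc := hM.one_le_runConst
  have hs := Real.sqrt_nonneg (k : ℝ)
  have h4 : m * (3 / 2 * M.thetaBar M.rho * M.slope M.rho 1 * √(k : ℝ)) + e ≤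
      M.runConst * (e + 1 + √(k : ℝ)) := by
    have h5 : m * (3 / 2 * M.thetaBar M.rho * M.slope M.rho 1) ≤ M.runConst := by
      rw [Model.runConst]
      have : 0 ≤ M.thetaBar M.rho * M.aBar := mul_nonneg hΘ ha.le
      linarith
    have h6 := mul_le_mul_of_nonneg_right h5 hs
    nlinarith
  linarith

lemma Model.GoodRun.revenue_full_ge (h : M.GoodRun s L t₁ k e) (hM : M.Valid) (hL : 0 < L)
    (he : 0 ≤ e) (hk : (k : ℝ) = L) (hp : M.IsDualMin M.rho p) :
    k * M.dual M.rho p - M.runConst * (e + 1 + √(k : ℝ)) ≤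
      ∑ j, M.r j * M.ffCount s (M.rhoCap L) L t₁ k j := by
  have h1 := h.sum_dualAt_ge hM hL hp
  have h2 := hM.revenue_full_ge (s := s) (t₁ := t₁) (hM.rhoCap_pos hL) hL hk
    (v := M.dual M.rho p) (by rw [M.rhoCap_div hL]; exact hp.le _ hM.alphaBar_nonneg)
  rw [M.rhoCap_div hL, Model.ffError, M.thetaBar_rhoCap hL, M.slope_rhoCap hL] at h2
  rw [M.sum_r_mul_ffCount]
  have hΘ := hM.thetaBar_nonneg hM.rho_pos
  have hG := hM.slope_pos hM.rho_pos one_pos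
  have ha := hM.aBar_pos
  have hs := Real.sqrt_nonneg (k : ℝ)
  have h4 : M.thetaBar M.rho * M.aBar +
      m * (3 / 2 * M.thetaBar M.rho * M.slope M.rho 1 * √(k : ℝ)) + e ≤
      M.runConst * (e + 1 + √(k : ℝ)) := by
    rw [Model.runConst]
    have h5 : 0 ≤ M.thetaBar M.rho * M.aBar := mul_nonneg hΘ ha.le
    have h6 : 0 ≤ m * (3 / 2 * M.thetaBar M.rho * M.slope M.rho 1) := by positivity
    nlinarith [mul_nonneg h5 he, mul_nonneg h5 hs, mul_nonneg h6 he]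
  linarith

lemma Model.GoodRun.ffCount_le (h : M.GoodRun s L t₁ k e) (hM : M.Valid) (j : Fin n) :
    M.ffCount s (M.rhoCap L) L t₁ k j ≤ k * M.lam j + e := by
  have h1 := M.ffCount_le_ffArrivals s (M.rhoCap L) L t₁ k j
  have h2 := mul_le_mul_of_nonneg_right (M.activeTime_le s (M.rhoCap L) L t₁ k) (hM.lam_nonneg j)
  linarith [h.arr j]

end GoodRun

/-- Constants for a solution of the fluid problem: the counts of accepted customers follow the
fluid solution. -/
lemma Model.Valid.exists_full_run_const (hM : M.Valid) (hgen : M.GeneralPosition)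
    {p : Fin m → ℝ} {x : Fin n → ℝ} (hp : M.IsDualMin M.rho p) (hx : M.IsFluid p x) :
    ∃ K : ℝ, 0 ≤ K ∧ ∀ (s : ℕ → Fin n) (t₁ k : ℕ) (e : ℝ), 0 < k → 0 ≤ e →
      M.GoodRun s k t₁ k e → ∀ j,
        |M.ffCount s (M.rhoCap k) k t₁ k j - k * x j| ≤ K * (e + 1 + √(k : ℝ)) := by
  obtain ⟨K, hK, hsharp⟩ := hgen.exists_sharp hx
  have hc := hM.one_le_runConst
  refine ⟨K * M.runConst, by positivity, fun s t₁ k e hk he hgood j => ?_⟩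
  have hk' : (0 : ℝ) < k := by exact_mod_cast hk
  have hs := Real.sqrt_nonneg (k : ℝ)
  have hee : e ≤ M.runConst * (e + 1 + √(k : ℝ)) := by nlinarith
  rw [mul_assoc]
  refine hsharp _ _ _ (by positivity) (fun j => M.ffCount_nonneg ..)
    (fun j => (hgood.ffCount_le hM j).trans (by linarith)) (fun i => ?_)
    (hgood.revenue_full_ge hM hk' he rfl hp) j
  rw [← M.used_eq_sum_ffCount]
  -- At the end of the horizon feasibility is automatic: a run never consumes more than its capacity
  -- `k ρ`.
  have h1 := hM.used_le (s := s) (t₁ := t₁) (L := k) (fun i => (hM.rhoCap_pos hk' i).le) k i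
  rw [Model.rhoCap] at h1
  have : 0 ≤ M.runConst * (e + 1 + √(k : ℝ)) := by positivity
  linarith

/-- Runs of Algorithm FF do not consume resources much faster than at the target rate. -/
def Model.ExcessControl (M : Model m n) : Prop :=
  ∃ K : ℝ, 0 ≤ K ∧ ∀ (s : ℕ → Fin n) (L : ℝ) (t₁ k : ℕ) (e : ℝ), 0 < L → 0 ≤ e →
    M.GoodRun s L t₁ k e → ∀ i, M.used s (M.rhoCap L) L t₁ i k -
      M.activeTime s (M.rhoCap L) L t₁ k * M.rho i ≤ K * (e + 1 + √(k : ℝ))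

/-- Steps shrink like `1 / √k`, so after a fixed number `k₀` of periods they are shorter than every
gap `θ̄ - ᾱ_i`, and the prices are never clipped from above again. -/
lemma Model.Valid.excessControl_of_alphaBar_lt (hM : M.Valid)
    (h : ∀ i, M.alphaBar i < M.thetaBar M.rho) : M.ExcessControl := by
  have hev : ∀ᶠ k₀ : ℕ in atTop, ∀ i, M.thetaBar M.rho ≤
      (M.thetaBar M.rho - M.alphaBar i) * √((k₀ + 1 : ℕ) : ℝ) := by
    rw [eventually_all]
    intro i
    have h1 : Tendsto (fun k : ℕ => √((k + 1 : ℕ) : ℝ)) atTop atTop :=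
      Real.tendsto_sqrt_atTop.comp
        (tendsto_natCast_atTop_atTop.comp (tendsto_add_atTop_nat 1))
    exact (h1.const_mul_atTop (sub_pos.2 (h i))).eventually_ge_atTop _
  obtain ⟨k₀, hk₀⟩ := hev.exists
  have ha := hM.aBar_pos
  have hG := hM.slope_pos hM.rho_pos one_pos
  refine ⟨M.aBar * k₀ + M.slope M.rho 1, by positivity, fun s L t₁ k e hL he _ i => ?_⟩
  have h1 := hM.excess_le (s := s) (t₁ := t₁) (hM.rhoCap_pos hL) hL (i := i) (k₀ := k₀)
    (by rw [M.thetaBar_rhoCap hL]; exact h i) (by rw [M.thetaBar_rhoCap hL]; exact hk₀ i) k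
  rw [M.slope_rhoCap hL, congrFun (M.rhoCap_div hL) i] at h1
  refine h1.trans ?_
  have hs := Real.sqrt_nonneg (k : ℝ)
  have h2 : 0 ≤ M.aBar * k₀ := by positivity
  nlinarith [mul_nonneg h2 he, mul_nonneg h2 hs, mul_nonneg hG.le he]

/-- Let `l` have the largest excess. Comparison with `u = θ̄ e_l` shows that the excess brings in at
least `θ̄` per unit, while pricing at `p` shows that it is worth at most `∑ p_i` per unit. Up to
fluctuations this is possible only for a small excess. -/
lemma Model.Valid.excessControl_of_sum_lt (hM : M.Valid) {p : Fin m → ℝ}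
    (hp : M.IsDualMin M.rho p) (h : ∑ i, p i < M.thetaBar M.rho) : M.ExcessControl := by
  have hc := hM.one_le_runConst
  set S : ℝ := M.runConst + ∑ j, max 0 (M.margin p j) with hS
  have hm0 : 0 ≤ ∑ j, max 0 (M.margin p j) := Finset.sum_nonneg fun j _ => le_max_left _ _
  have hS0 : 0 ≤ S := by positivity
  have hgap : 0 < M.thetaBar M.rho - ∑ i, p i := sub_pos.2 h
  refine ⟨S / (M.thetaBar M.rho - ∑ i, p i), by positivity,
    fun s L t₁ k e hL he hgood i => ?_⟩
  have hs := Real.sqrt_nonneg (k : ℝ)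
  have := hM.nonempty_resources
  set X : Fin m → ℝ := fun i => M.used s (M.rhoCap L) L t₁ i k -
      M.activeTime s (M.rhoCap L) L t₁ k * M.rho i with hX
  obtain ⟨l, hl⟩ := Finite.exists_max X
  change X i ≤ _
  refine (hl i).trans ?_
  rcases le_or_gt (X l) 0 with hneg | hpos
  · exact hneg.trans (by positivity)
  have hΘ := hM.thetaBar_nonneg hM.rho_pos
  classical
  have h1 := hgood.revenue_ge hM hL he hp (u := fun i => if i = l then M.thetaBar M.rho else 0)
    (fun i => by split_ifs; exacts [⟨hΘ, le_rfl⟩, ⟨le_rfl, hΘ⟩])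
  simp only [ite_mul, zero_mul, Finset.sum_ite_eq', Finset.mem_univ, if_true] at h1
  have h2 : ∑ j, M.r j * M.ffCount s (M.rhoCap L) L t₁ k j ≤
      M.activeTime s (M.rhoCap L) L t₁ k * M.dual M.rho p + (∑ i, p i) * X l +
        (∑ j, max 0 (M.margin p j)) * e := by
    rw [M.sum_r_mul p, Model.dual, mul_add, Finset.mul_sum, Finset.mul_sum]
    have h3 : ∑ i, p i * ∑ j, M.A i j * M.ffCount s (M.rhoCap L) L t₁ k j ≤
        ∑ i, M.activeTime s (M.rhoCap L) L t₁ k * (p i * M.rho i) + (∑ i, p i) * X l := by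
      rw [Finset.sum_mul, ← Finset.sum_add_distrib]
      refine Finset.sum_le_sum fun i _ => ?_
      have := mul_le_mul_of_nonneg_left (hl i) (hp.nonneg i)
      rw [← M.used_eq_sum_ffCount]
      simp only [hX] at this ⊢
      linarith
    have h4 : ∑ j, M.margin p j * M.ffCount s (M.rhoCap L) L t₁ k j ≤
        ∑ j, M.activeTime s (M.rhoCap L) L t₁ k * (M.lam j * max 0 (M.margin p j)) +
          (∑ j, max 0 (M.margin p j)) * e := by
      rw [Finset.sum_mul, ← Finset.sum_add_distrib]
      refine Finset.sum_le_sum fun j _ => ?_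
      have h5 := M.ffCount_nonneg s (M.rhoCap L) L t₁ k j
      have h6 := (M.ffCount_le_ffArrivals s (M.rhoCap L) L t₁ k j).trans (hgood.arr j)
      calc M.margin p j * M.ffCount s (M.rhoCap L) L t₁ k j ≤
            max 0 (M.margin p j) * M.ffCount s (M.rhoCap L) L t₁ k j :=
              mul_le_mul_of_nonneg_right (le_max_right _ _) h5
        _ ≤ max 0 (M.margin p j) * (M.activeTime s (M.rhoCap L) L t₁ k * M.lam j + e) :=
              mul_le_mul_of_nonneg_left h6 (le_max_left _ _)
        _ = _ := by ring
    simp only [Model.margin] at h4 ⊢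
    linarith
  have h7 : (M.thetaBar M.rho - ∑ i, p i) * X l ≤ S * (e + 1 + √(k : ℝ)) := by
    have h8 : (∑ j, max 0 (M.margin p j)) * e ≤
        (∑ j, max 0 (M.margin p j)) * (e + 1 + √(k : ℝ)) :=
      mul_le_mul_of_nonneg_left (by linarith) hm0
    rw [hS, add_mul]
    simp only [hX] at h2 ⊢
    linarith
  rw [div_mul_eq_mul_div, le_div_iff₀ hgap, mul_comm]
  exact h7

/-- With excess control, the counts of accepted customers follow the fluid solution at all
times, and the run does not stop early. -/
lemma Model.ExcessControl.exists_prefix_const (hE : M.ExcessControl) (hM : M.Valid)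
    (hgen : M.GeneralPosition) {p : Fin m → ℝ} {x : Fin n → ℝ} (hp : M.IsDualMin M.rho p)
    (hx : M.IsFluid p x) :
    ∃ K : ℝ, 0 ≤ K ∧ ∀ (s : ℕ → Fin n) (L : ℝ) (t₁ k : ℕ) (e : ℝ), 0 < L → 0 ≤ e →
      M.GoodRun s L t₁ k e → K * (e + 1 + √(k : ℝ)) ≤ L - k → ∀ j,
        |M.ffCount s (M.rhoCap L) L t₁ k j - k * x j| ≤ K * (e + 1 + √(k : ℝ)) := by
  obtain ⟨K₁, hK₁, hex⟩ := hE
  obtain ⟨K₂, hK₂, hsharp⟩ := hgen.exists_sharp hx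
  have hc := hM.one_le_runConst
  have ha := hM.aBar_pos
  have := hM.nonempty_resources
  have hinf := iInf_fin_pos hM.rho_pos
  set K₃ := (K₁ + M.aBar) / ⨅ i, M.rho i with hK₃
  have hK₃0 : 0 ≤ K₃ := by positivity
  refine ⟨K₃ + K₂ * (M.runConst + K₁), by positivity, fun s L t₁ k e hL he hgood hkL j => ?_⟩
  have hs := Real.sqrt_nonneg (k : ℝ)
  set E := e + 1 + √(k : ℝ) with hEdef
  have hE1 : 1 ≤ E := by linarith
  have hexk := hex s L t₁ k e hL he hgood
  -- A stopped run has used nearly `L ρ_i` of some resource, whereas excess control allows `k ρ_i`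
  -- plus an error; the hypothesis on `L - k` excludes this.
  have hact : M.Active s (M.rhoCap L) L t₁ k := by
    by_contra hna
    obtain ⟨i, hi⟩ := Model.exists_lt_used_of_not_active hna
    have h1 := hexk i
    have h2 := mul_le_mul_of_nonneg_right (M.activeTime_le s (M.rhoCap L) L t₁ k)
      (hM.rho_pos i).le
    have h3 : K₃ * E ≤ L - k := by
      have : 0 ≤ K₂ * (M.runConst + K₁) * E := by positivity
      linarith
    have h4 : (K₁ + M.aBar) * E ≤ (L - k) * M.rho i := by
      calc (K₁ + M.aBar) * E = K₃ * E * ⨅ i, M.rho i := by rw [hK₃]; field_simp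
        _ ≤ (L - k) * M.rho i := by
          have h0 : 0 ≤ L - k := le_trans (by positivity) h3
          exact mul_le_mul h3 (iInf_fin_le _ i) hinf.le h0
    have h5 : M.aBar ≤ M.aBar * E := le_mul_of_one_le_right ha.le hE1
    rw [Model.rhoCap] at hi
    linarith
  have hτ := Model.activeTime_of_active (k := k) fun t ht => hact.mono (le_of_lt ht)
  have hmain := hsharp (M.ffCount s (M.rhoCap L) L t₁ k) k ((M.runConst + K₁) * E)
    (by positivity) (fun j => M.ffCount_nonneg ..)
    (fun j => (hgood.ffCount_le hM j).trans (by nlinarith)) (fun i => by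
      rw [← M.used_eq_sum_ffCount]
      have := hexk i
      rw [hτ] at this
      nlinarith) (by
      have h1 := hgood.revenue_ge hM hL he hp (u := fun _ => 0)
        (fun _ => ⟨le_rfl, hM.thetaBar_nonneg hM.rho_pos⟩)
      rw [hτ] at h1
      simp only [zero_mul, Finset.sum_const_zero] at h1
      have : 0 ≤ K₁ * E := by positivity
      linarith) j
  refine hmain.trans ?_
  rw [← mul_assoc]
  exact mul_le_mul_of_nonneg_right (by linarith) (by linarith)


/-! ### Phase II -/

section PhaseIIAnalysis

variable {T : ℕ} {α β γ : ℝ} {s : ℕ → Fin n} {p : Fin m → ℝ} {x : Fin n → ℝ}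

lemma le_len1 (T : ℕ) (α : ℝ) : (T : ℝ) ^ α ≤ len1 T α := Nat.le_ceil _

lemma len1_le (T : ℕ) (α : ℝ) : (len1 T α : ℝ) ≤ (T : ℝ) ^ α + 1 :=
  (Nat.ceil_lt_add_one (Real.rpow_nonneg (Nat.cast_nonneg T) α)).le

lemma len1_pos (hT : 0 < T) (α : ℝ) : 0 < len1 T α :=
  Nat.ceil_pos.2 (Real.rpow_pos_of_pos (by exact_mod_cast hT) α)

/-- Phase I identifies the types that the fluid solution `x` rejects or accepts completely. -/
def Model.Classified (M : Model m n) (T : ℕ) (α γ : ℝ) (s : ℕ → Fin n) (x : Fin n → ℝ) : Prop :=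
  ∀ j, 0 < M.lam j → (j ∈ M.rejectClass T α γ s ↔ x j = 0) ∧
    (j ∈ M.acceptClass T α γ s ↔ x j = M.lam j)

lemma Model.acceptedI_eq_ffCount (M : Model m n) (hT : 0 < T) (α : ℝ) (s : ℕ → Fin n)
    (j : Fin n) : M.acceptedI T α s j =
      M.ffCount s (M.rhoCap (len1 T α)) (len1 T α) 1 (len1 T α) j := by
  have hT' : (T : ℝ) ≠ 0 := by exact_mod_cast hT.ne'
  have : (fun i => M.C T i * ((len1 T α : ℝ) / T)) = M.rhoCap (len1 T α) := by
    funext i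
    rw [Model.C, Model.rhoCap]
    field_simp
  simp only [Model.acceptedI, Model.decI, Model.ffCount, this]

lemma Model.capStartII_eq_rhoCap (M : Model m n) (hT : 0 < T) (α : ℝ) :
    M.capStartII T α = M.rhoCap ((T : ℝ) - len1 T α) := by
  have hT' : (T : ℝ) ≠ 0 := by exact_mod_cast hT.ne'
  funext i
  rw [Model.capStartII, Model.C, Model.rhoCap]
  field_simp

/-- Phase I is a full run, so its counts are within `O(E)` of `l₁ x`. Since `E ≪ T^c ≪ T^a`, the
thresholds separate `x_j = 0`, `x_j = λ_j` and the values in between; `K` must exceed constants that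
depend on the nonzero gaps `x_j` and `λ_j - x_j`. -/
lemma Model.Valid.eventually_classified (hM : M.Valid) (hgen : M.GeneralPosition)
    (hp : M.IsDualMin M.rho p) (hx : M.IsFluid p x) :
    ∀ᶠ K : ℝ in atTop, ∀ (T : ℕ) (α γ : ℝ) (s : ℕ → Fin n) (e : ℝ), 0 < T → 0 ≤ e →
      M.GoodRun s (len1 T α) 1 (len1 T α) e →
      K * (e + 1 + √(len1 T α : ℝ)) ≤ (T : ℝ) ^ (α / 2 + γ) →
      K * (T : ℝ) ^ (α / 2 + γ) ≤ (T : ℝ) ^ α → M.Classified T α γ s x := by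
  obtain ⟨K₀, hK₀, hrun⟩ := hM.exists_full_run_const hgen hp hx
  have hlin : ∀ {a : ℝ}, 0 < a → ∀ b : ℝ, ∀ᶠ K : ℝ in atTop, b ≤ a * K := fun ha b =>
    (tendsto_id.const_mul_atTop ha).eventually_ge_atTop b
  have hev : ∀ᶠ K : ℝ in atTop, ∀ j, (0 < M.lam j → K₀ + 1 ≤ M.lam j * K) ∧
      (0 < x j → M.lam j + K₀ ≤ x j * K) ∧
      (x j < M.lam j → 2 * M.lam j + K₀ ≤ (M.lam j - x j) * K) := by
    rw [eventually_all]
    intro j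
    refine (eventually_imp_distrib_left.2 fun h => hlin h _).and
      ((eventually_imp_distrib_left.2 fun h => hlin h _).and
        (eventually_imp_distrib_left.2 fun h => hlin (sub_pos.2 h) _))
  filter_upwards [hev, eventually_ge_atTop 1] with K hK hK1
  intro T α γ s e hT he hgood hc1 hc2 j hj
  obtain ⟨h1, h2, h3⟩ := hK j
  have hl := len1_pos hT α
  have hl' : (0 : ℝ) < len1 T α := by exact_mod_cast hl
  have hs := Real.sqrt_nonneg (len1 T α : ℝ)
  have hla := le_len1 T α
  have hlb := len1_le T α
  have hy := hrun s 1 (len1 T α) e hl he hgood j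
  rw [← M.acceptedI_eq_ffCount hT] at hy
  set y := M.acceptedI T α s j with hy_def
  set l : ℝ := (len1 T α : ℝ) with hl_def
  set E := e + 1 + √l with hE
  set C := (T : ℝ) ^ (α / 2 + γ) with hC
  have hE1 : 1 ≤ E := by linarith
  have hEC : E ≤ C := by nlinarith
  have hC1 : 1 ≤ C := hE1.trans hEC
  obtain ⟨hy1, hy2⟩ := abs_le.1 hy
  have hrej : j ∈ M.rejectClass T α γ s ↔ y < M.lam j * C := Iff.rfl
  have hacc : j ∈ M.acceptClass T α γ s ↔ ¬ y < M.lam j * C ∧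
      M.lam j * ((T : ℝ) ^ α - C) < y := Iff.rfl
  have hKE : K₀ * E < M.lam j * C := by
    calc K₀ * E < (K₀ + 1) * E := by linarith
      _ ≤ M.lam j * K * E := mul_le_mul_of_nonneg_right (h1 hj) (by linarith)
      _ = M.lam j * (K * E) := by ring
      _ ≤ M.lam j * C := mul_le_mul_of_nonneg_left hc1 hj.le
  have hKC : K₀ * E ≤ K₀ * C := mul_le_mul_of_nonneg_left hEC hK₀
  have hrej_iff : y < M.lam j * C ↔ x j = 0 := by
    constructor
    · intro hlt
      by_contra hne
      have hxj : 0 < x j := lt_of_le_of_ne (hx.nonneg j) (Ne.symm hne)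
      have h4 : (M.lam j + K₀) * C ≤ l * x j := by
        calc (M.lam j + K₀) * C ≤ x j * K * C :=
              mul_le_mul_of_nonneg_right (h2 hxj) (by linarith)
          _ = x j * (K * C) := by ring
          _ ≤ x j * l := mul_le_mul_of_nonneg_left (hc2.trans hla) hxj.le
          _ = l * x j := by ring
      linarith
    · intro h0
      rw [h0, mul_zero] at hy2
      linarith
  refine ⟨hrej.trans hrej_iff, ?_⟩
  rw [hacc]
  constructor
  · rintro ⟨h5, h6⟩
    by_contra hne
    have hxj : x j < M.lam j := lt_of_le_of_ne (hx.le_lam j) hne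
    -- One `λ_j C` is the width of the threshold, the other covers the rounding `l₁ ≤ T^a + 1`.
    have h7 : (2 * M.lam j + K₀) * C ≤ (M.lam j - x j) * l := by
      have h0 : 0 ≤ M.lam j - x j := by linarith
      calc (2 * M.lam j + K₀) * C ≤ (M.lam j - x j) * K * C :=
            mul_le_mul_of_nonneg_right (h3 hxj) (by linarith)
        _ = (M.lam j - x j) * (K * C) := by ring
        _ ≤ (M.lam j - x j) * l := mul_le_mul_of_nonneg_left (hc2.trans hla) h0
    have h8 : M.lam j * l ≤ M.lam j * ((T : ℝ) ^ α + 1) := mul_le_mul_of_nonneg_left hlb hj.le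
    have h9 : M.lam j * 1 ≤ M.lam j * C := mul_le_mul_of_nonneg_left hC1 hj.le
    linarith
  · intro heq
    have h5 : M.lam j * (T : ℝ) ^ α ≤ M.lam j * l := mul_le_mul_of_nonneg_left hla hj.le
    rw [heq] at hy1
    refine ⟨fun hlt => ?_, by linarith⟩
    have h0 := hrej_iff.1 hlt
    linarith

variable (M T α s x) in
/-- Decisions in phase II when the classification is correct and capacities suffice. -/
noncomputable def Model.idealDec (k : ℕ) : ℝ :=
  if x (s (1 + len1 T α + k)) = 0 then 0
  else if x (s (1 + len1 T α + k)) = M.lam (s (1 + len1 T α + k)) then 1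
  else M.subII T α s k

variable (M T α s x) in
/-- Numbers of acceptances under the ideal decisions. -/
noncomputable def Model.idealCount (k : ℕ) (j : Fin n) : ℝ :=
  decCount s (M.idealDec T α s x) (1 + len1 T α) k j

lemma Model.idealDec_mem (M : Model m n) (T : ℕ) (α : ℝ) (s : ℕ → Fin n) (x : Fin n → ℝ) (k : ℕ) :
    0 ≤ M.idealDec T α s x k ∧ M.idealDec T α s x k ≤ 1 := by
  unfold Model.idealDec
  split_ifs
  · simp
  · simp
  · exact ⟨M.ffDecision_nonneg .., M.ffDecision_le_one ..⟩

lemma Model.decII_eq_idealDec (hc : M.Classified T α γ s x) {k : ℕ}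
    (hpos : 0 < M.lam (s (1 + len1 T α + k))) {B : Fin m → ℝ} (hB : M.Sufficient B) :
    M.decII T α γ s B k = M.idealDec T α s x k := by
  unfold Model.decII Model.idealDec
  rw [if_pos hB]
  simp only [(hc _ hpos).1, (hc _ hpos).2]

lemma Model.decII_le_idealDec (hc : M.Classified T α γ s x) {k : ℕ}
    (hpos : 0 < M.lam (s (1 + len1 T α + k))) (B : Fin m → ℝ) :
    M.decII T α γ s B k ≤ M.idealDec T α s x k := by
  by_cases hB : M.Sufficient B
  · exact (Model.decII_eq_idealDec hc hpos hB).le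
  · rw [Model.decII, if_neg hB]
    exact (M.idealDec_mem T α s x k).1

/-- The virtual run updates itself with its own decisions for all types, so overriding some types
leaves the counts of the others equal to those of an unmodified FF run. -/
lemma Model.idealCount_eq (M : Model m n) (hT : 0 < T) (α : ℝ) (s : ℕ → Fin n) (x : Fin n → ℝ)
    (k : ℕ) (j : Fin n) : M.idealCount T α s x k j =
      if x j = 0 then 0 else if x j = M.lam j then winCount s (1 + len1 T α) k j
      else M.ffCount s (M.rhoCap ((T : ℝ) - len1 T α)) ((T : ℝ) - len1 T α) (1 + len1 T α) k j := by
  unfold Model.idealCount decCount winCount Model.ffCount Model.idealDec Model.subII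
  rw [M.capStartII_eq_rhoCap hT]
  split_ifs with h1 h2
  · refine Finset.sum_eq_zero fun t _ => ?_
    split_ifs with h3 h4 h5 <;> first | rfl | (rw [h3] at h4; exact absurd h1 h4)
  · refine Finset.sum_congr rfl fun t _ => ?_
    split_ifs with h3 h4 h5
    · rw [h3] at h4; exact absurd h4 h1
    · rfl
    · rw [h3] at h5; exact absurd h2 h5
    · rfl
  · refine Finset.sum_congr rfl fun t _ => ?_
    split_ifs with h3 h4 h5
    · rw [h3] at h4; exact absurd h4 h1
    · rw [h3] at h5; exact absurd h5 h2
    · rfl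
    · rfl

lemma Model.countII_le_idealCount (hc : M.Classified T α γ s x) {k : ℕ}
    (hpos : ∀ t < k, 0 < M.lam (s (1 + len1 T α + t))) (j : Fin n) :
    M.countII T α γ s k j ≤ M.idealCount T α s x k j := by
  unfold Model.countII Model.idealCount decCount
  refine Finset.sum_le_sum fun t ht => ?_
  split_ifs
  · exact Model.decII_le_idealDec hc (hpos t (Finset.mem_range.1 ht)) _
  · exact le_rfl

lemma Model.countII_eq_idealCount (hc : M.Classified T α γ s x) {k : ℕ}
    (hpos : ∀ t < k, 0 < M.lam (s (1 + len1 T α + t)))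
    (hsuf : ∀ t < k, M.Sufficient (M.capII T α γ s t)) (j : Fin n) :
    M.countII T α γ s k j = M.idealCount T α s x k j := by
  unfold Model.countII Model.idealCount decCount
  refine Finset.sum_congr rfl fun t ht => ?_
  have ht := Finset.mem_range.1 ht
  split_ifs
  · exact Model.decII_eq_idealDec hc (hpos t ht) (hsuf t ht)
  · rfl

lemma Model.idealCount_mono (M : Model m n) (T : ℕ) (α : ℝ) (s : ℕ → Fin n) (x : Fin n → ℝ)
    (j : Fin n) : Monotone fun k => M.idealCount T α s x k j := by
  refine monotone_nat_of_le_succ fun k => ?_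
  simp only [Model.idealCount, decCount, Finset.sum_range_succ]
  have : (0 : ℝ) ≤ if s (1 + len1 T α + k) = j then M.idealDec T α s x k else 0 := by
    split_ifs
    exacts [(M.idealDec_mem T α s x k).1, le_rfl]
  linarith

lemma Model.Valid.capII_antitone (hM : M.Valid) (T : ℕ) (α γ : ℝ) (s : ℕ → Fin n) (i : Fin m) :
    Antitone fun k => M.capII T α γ s k i := by
  refine antitone_nat_of_succ_le fun k => ?_
  rw [M.capII_succ]
  have := mul_nonneg (M.decII_mem T α γ s (M.capII T α γ s k) k).1
    (hM.A_nonneg i (s (1 + len1 T α + k)))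
  linarith

/-- A plan `z` that extends the acceptances `w` of phase II is worth at most `w` followed by the
optimum. -/
lemma Model.Valid.le_add_lpVal (hM : M.Valid) {B : Fin m → ℝ} {N w z : Fin n → ℝ}
    (hz : ∀ i, ∑ j, M.A i j * z j ≤ B i) (hwz : ∀ j, w j ≤ z j) (hzw : ∀ j, z j ≤ w j + N j) :
    ∑ j, M.r j * z j ≤
      ∑ j, M.r j * w j + M.lpVal (fun i => B i - ∑ j, M.A i j * w j) N := by
  have h := hM.le_lpVal (B := fun i => B i - ∑ j, M.A i j * w j) (N := N)
    (z := fun j => z j - w j) (fun i => by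
      simp_rw [mul_sub, Finset.sum_sub_distrib]
      linarith [hz i]) fun j => ⟨by linarith [hwz j], by linarith [hzw j]⟩
  simp_rw [mul_sub, Finset.sum_sub_distrib] at h
  linarith

/-- The random fluctuations in phases II and III are at most `e`; only types of positive
probability arrive. -/
structure Model.GoodII (M : Model m n) (T : ℕ) (α β : ℝ) (s : ℕ → Fin n) (e : ℝ) : Prop where
  win : ∀ j, |winCount s (1 + len1 T α) (len2 T α β) j - len2 T α β * M.lam j| ≤ e
  win' : ∀ j, |winCount s (1 + len1 T α + len2 T α β) (T - (len1 T α + len2 T α β)) j -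
    (T - (len1 T α + len2 T α β) : ℕ) * M.lam j| ≤ e
  support : ∀ k, len1 T α + k < T → 0 < M.lam (s (1 + len1 T α + k))
  run : M.GoodRun s (T - len1 T α : ℕ) (1 + len1 T α) (len2 T α β) e
  full : M.GoodRun s (T - len1 T α : ℕ) (1 + len1 T α) (T - len1 T α) e

lemma eventually_mul_ge {a : ℝ} (ha : 0 < a) (b : ℝ) : ∀ᶠ K : ℝ in atTop, b ≤ a * K :=
  (tendsto_id.const_mul_atTop ha).eventually_ge_atTop b

/-- If consumption is under control, then the decisions of phase II are optimal on a good event. -/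
lemma Model.ExcessControl.eventually_VHI_le (hE : M.ExcessControl) (hM : M.Valid)
    (hgen : M.GeneralPosition) (hp : M.IsDualMin M.rho p) (hx : M.IsFluid p x) :
    ∀ᶠ K : ℝ in atTop, ∀ (T : ℕ) (α β γ : ℝ) (k : ℕ) (s : ℕ → Fin n) (e : ℝ), 0 < T → 0 ≤ e →
      len1 T α + len2 T α β + k = T → K * (e + 1 + √(T : ℝ)) ≤ k → M.Classified T α γ s x →
      M.GoodII T α β s e → M.VHI T α s ≤ M.VHII T α β γ s := by
  obtain ⟨K₁, hK₁, hpre⟩ := hE.exists_prefix_const hM hgen hp hx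
  obtain ⟨K₂, hK₂, hsharp⟩ := hgen.exists_sharp hx
  have hr := hM.rTot_nonneg
  have ha := hM.aBar_pos
  set K₃ := K₂ * (2 * M.rTot + 2) with hK₃
  have hK₃0 : 0 ≤ K₃ := by positivity
  have hAs : ∀ i, 0 ≤ ∑ j, M.A i j := fun i => Finset.sum_nonneg fun j _ => hM.A_nonneg i j
  -- `K E ≤ k`, so for large `K` every positive gap `λ_j`, `x_j`, `λ_j - x_j`, `ρ_i`, times the
  -- length `k` of phase III, outweighs all errors.
  have hev : ∀ᶠ K : ℝ in atTop, (∀ j, (0 < M.lam j → K₃ + 1 ≤ M.lam j * K) ∧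
      (0 < x j → K₁ + K₃ ≤ x j * K) ∧
      (x j < M.lam j → K₁ + K₃ + 1 ≤ (M.lam j - x j) * K)) ∧
      ∀ i, (∑ j, M.A i j) * (K₁ + 1) + M.aBar ≤ M.rho i * K := by
    rw [eventually_and, eventually_all, eventually_all]
    refine ⟨fun j => ?_, fun i => eventually_mul_ge (hM.rho_pos i) _⟩
    exact (eventually_imp_distrib_left.2 fun h => eventually_mul_ge h _).and
      ((eventually_imp_distrib_left.2 fun h => eventually_mul_ge h _).and
        (eventually_imp_distrib_left.2 fun h => eventually_mul_ge (sub_pos.2 h) _))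
  filter_upwards [hev, eventually_ge_atTop (K₁ + 1)] with K hK hKK₁
  obtain ⟨hKj, hKi⟩ := hK
  intro T α β γ k s e hT he hk hKk hcl hgood
  set l₁ := len1 T α with hl₁
  set l₂ := len2 T α β with hl₂
  have hTl : T - l₁ = l₂ + k := by lia
  have hTll : T - (l₁ + l₂) = k := by lia
  have hTr : (T : ℝ) - l₁ = (l₂ + k : ℕ) := by
    rw [← hk]; push_cast; ring
  set N : ℝ := ((l₂ + k : ℕ) : ℝ) with hN
  have hNk : N = l₂ + k := by rw [hN]; push_cast; ring
  set E := e + 1 + √(T : ℝ) with hEdef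
  have hs := Real.sqrt_nonneg (T : ℝ)
  have hE1 : 1 ≤ E := by linarith
  have heE : e ≤ E := by linarith
  have hk0 : (0 : ℝ) < k := lt_of_lt_of_le (by nlinarith) hKk
  have hl₂0 : (0 : ℝ) ≤ l₂ := Nat.cast_nonneg _
  have hN0 : 0 < N := by linarith
  have hcap : M.capStartII T α = M.rhoCap N := by
    rw [M.capStartII_eq_rhoCap hT, ← hl₁, hTr]
  have hsq : √(l₂ : ℝ) ≤ √(T : ℝ) := Real.sqrt_le_sqrt (by exact_mod_cast (by lia))
  have hgr := hgood.run
  have hw2 := hgood.win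
  have hw3 := hgood.win'
  rw [← hl₁, ← hl₂] at hgr hw2 hw3
  rw [hTl] at hgr
  rw [hTll] at hw3
  -- constants times `E` compared with multiples of `k`
  have hcmp : ∀ {a b : ℝ}, 0 < a → b ≤ a * K → b * E ≤ a * k := fun {a b} ha' hb => by
    calc b * E ≤ a * K * E := mul_le_mul_of_nonneg_right hb (by linarith)
      _ = a * (K * E) := by ring
      _ ≤ a * k := mul_le_mul_of_nonneg_left hKk ha'.le
  have hcnt : ∀ j, |M.ffCount s (M.rhoCap N) N (1 + l₁) l₂ j - l₂ * x j| ≤ K₁ * E := by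
    intro j
    refine (hpre s N (1 + l₁) l₂ e hN0 he hgr ?_ j).trans
      (mul_le_mul_of_nonneg_left (by linarith) hK₁)
    have : K₁ * (e + 1 + √(l₂ : ℝ)) ≤ K₁ * E := mul_le_mul_of_nonneg_left (by linarith) hK₁
    have h2 : K₁ * E ≤ K * E := mul_le_mul_of_nonneg_right (by linarith) (by linarith)
    linarith
  have hid : ∀ j, M.idealCount T α s x l₂ j = if x j = 0 then 0 else
      if x j = M.lam j then winCount s (1 + l₁) l₂ j
      else M.ffCount s (M.rhoCap N) N (1 + l₁) l₂ j := fun j => by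
    rw [M.idealCount_eq hT, ← hl₁, hTr]
  have hid_le : ∀ j, M.idealCount T α s x l₂ j ≤ l₂ * x j + (K₁ + 1) * E := by
    intro j
    rw [hid]
    have hKE : 0 ≤ K₁ * E := by positivity
    split_ifs with h1 h2
    · rw [h1]; linarith
    · rw [h2]; linarith [(abs_le.1 (hw2 j)).2]
    · linarith [(abs_le.1 (hcnt j)).2]
  -- the capacities suffice throughout phase II
  have hposl : ∀ t < l₂, 0 < M.lam (s (1 + len1 T α + t)) := fun t ht =>
    hgood.support t (by rw [← hl₁]; lia)
  -- Ideal acceptances consume at most `l₂ ρ + O(E)`, which leaves about `k ρ`. Real acceptances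
  -- never exceed the ideal ones, so there is no circularity.
  have hsuf : ∀ t < l₂, M.Sufficient (M.capII T α γ s t) := by
    intro t ht i j
    have h1 : ∑ j, M.A i j * M.countII T α γ s t j ≤ ∑ j, M.A i j * (l₂ * x j + (K₁ + 1) * E) :=
      Finset.sum_le_sum fun j _ => mul_le_mul_of_nonneg_left
        ((Model.countII_le_idealCount hcl (fun u hu => hposl u (hu.trans ht)) j).trans
          ((M.idealCount_mono T α s x j ht.le).trans (hid_le j))) (hM.A_nonneg i j)
    have h2 : ∑ j, M.A i j * (l₂ * x j + (K₁ + 1) * E) =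
        l₂ * ∑ j, M.A i j * x j + (∑ j, M.A i j) * (K₁ + 1) * E := by
      rw [Finset.mul_sum, Finset.sum_mul, Finset.sum_mul, ← Finset.sum_add_distrib]
      exact Finset.sum_congr rfl fun j _ => by ring
    have h3 : l₂ * ∑ j, M.A i j * x j ≤ l₂ * M.rho i :=
      mul_le_mul_of_nonneg_left (hx.le_rho i) hl₂0
    have h4 := hcmp (hM.rho_pos i) (hKi i)
    have h5 : M.aBar ≤ M.aBar * E := le_mul_of_one_le_right ha.le hE1
    rw [M.capII_eq, hcap, Model.rhoCap]
    have h6 := M.le_aBar i j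
    rw [hNk]
    linarith
  have hcount : ∀ j, M.countII T α γ s l₂ j = M.idealCount T α s x l₂ j :=
    Model.countII_eq_idealCount hcl hposl hsuf
  rw [M.VHI_eq, M.VHII_eq, ← hl₁, ← hl₂, hTl, hTll, hcap, add_assoc]
  refine add_le_add_right ?_ _
  simp only [hcount]
  have hsplit : ∀ j, winCount s (1 + l₁) (l₂ + k) j =
      winCount s (1 + l₁) l₂ j + winCount s (1 + l₁ + l₂) k j := fun j => winCount_add ..
  -- a feasible plan that is nearly optimal
  set z₀ : Fin n → ℝ := fun j => min (N * x j) (winCount s (1 + l₁) (l₂ + k) j) with hz₀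
  have hz₀mem : ∀ j, 0 ≤ z₀ j ∧ z₀ j ≤ winCount s (1 + l₁) (l₂ + k) j := fun j =>
    ⟨le_min (mul_nonneg hN0.le (hx.nonneg j)) (winCount_nonneg ..), min_le_right _ _⟩
  have hz₀cap : ∀ i, ∑ j, M.A i j * z₀ j ≤ M.rhoCap N i := fun i => by
    calc ∑ j, M.A i j * z₀ j ≤ ∑ j, N * (M.A i j * x j) := Finset.sum_le_sum fun j _ => by
          have := mul_le_mul_of_nonneg_left (min_le_left (N * x j)
            (winCount s (1 + l₁) (l₂ + k) j)) (hM.A_nonneg i j)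
          simp only [hz₀]
          linarith
      _ = N * ∑ j, M.A i j * x j := by rw [Finset.mul_sum]
      _ ≤ N * M.rho i := mul_le_mul_of_nonneg_left (hx.le_rho i) hN0.le
  have hz₀val : N * M.dual M.rho p - (2 * M.rTot + 2) * E ≤ ∑ j, M.r j * z₀ j := by
    have h1 : ∀ j, N * (M.r j * x j) - M.r j * (2 * e) ≤ M.r j * z₀ j := by
      intro j
      have h2 : N * x j - 2 * e ≤ z₀ j := by
        refine le_min (by linarith) ?_
        have h3 := (abs_le.1 (hw2 j)).1
        have h4 := (abs_le.1 (hw3 j)).1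
        have h5 := mul_le_mul_of_nonneg_left (hx.le_lam j) hN0.le
        rw [hsplit]
        rw [hNk] at h5 ⊢
        linarith
      have := mul_le_mul_of_nonneg_left h2 (hM.r_nonneg j)
      linarith
    have h2 := Finset.sum_le_sum fun j (_ : j ∈ Finset.univ) => h1 j
    rw [Finset.sum_sub_distrib, ← Finset.mul_sum, ← Finset.sum_mul, hx.revenue] at h2
    have h3 : (∑ j, M.r j) * (2 * e) ≤ M.rTot * (2 * E) :=
      mul_le_mul_of_nonneg_left (by linarith) hr
    linarith
  -- A nearly optimal plan is within `K₃ E` of `N x`. Type by type this puts it between the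
  -- acceptances of phase II and these plus the arrivals of phase III, so it can still be completed.
  have hnear : ∀ z : Fin n → ℝ, (∀ i, ∑ j, M.A i j * z j ≤ M.rhoCap N i) →
      (∀ j, 0 ≤ z j ∧ z j ≤ winCount s (1 + l₁) (l₂ + k) j) →
      N * M.dual M.rho p - (2 * M.rTot + 2) * E ≤ ∑ j, M.r j * z j →
      ∑ j, M.r j * z j ≤ ∑ j, M.r j * M.idealCount T α s x l₂ j +
        M.lpVal (fun i => M.rhoCap N i - ∑ j, M.A i j * M.idealCount T α s x l₂ j)
          (winCount s (1 + l₁ + l₂) k) := by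
    intro z hz1 hz2 hz3
    have hr2 : 2 ≤ 2 * M.rTot + 2 := by linarith
    have hzx : ∀ j, |z j - N * x j| ≤ K₃ * E := by
      intro j
      rw [hK₃, mul_assoc]
      have hRE : 0 ≤ (2 * M.rTot + 2) * E := by positivity
      refine hsharp z N ((2 * M.rTot + 2) * E) hRE (fun j => (hz2 j).1) (fun j => ?_)
        (fun i => ?_) hz3 j
      · have h3 := (abs_le.1 (hw2 j)).2
        have h4 := (abs_le.1 (hw3 j)).2
        have h5 := (hz2 j).2
        rw [hsplit] at h5
        rw [hNk]
        nlinarith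
      · have := hz1 i
        rw [Model.rhoCap] at this
        linarith
    refine hM.le_add_lpVal hz1 (fun j => ?_) fun j => ?_
    · rw [hid]
      obtain ⟨hk1, hk2, hk3⟩ := hKj j
      obtain ⟨b1, b2⟩ := abs_le.1 (hzx j)
      split_ifs with h1 h2
      · exact (hz2 j).1
      · have hlam : 0 < M.lam j := lt_of_le_of_ne (hM.lam_nonneg j) (by rw [← h2]; exact Ne.symm h1)
        have := hcmp hlam (hk1 hlam)
        have h3 := (abs_le.1 (hw2 j)).2
        rw [h2, hNk] at b1
        linarith
      · have hxj : 0 < x j := lt_of_le_of_ne (hx.nonneg j) (Ne.symm h1)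
        have := hcmp hxj (hk2 hxj)
        have h3 := (abs_le.1 (hcnt j)).2
        rw [hNk] at b1
        linarith
    · rw [hid]
      obtain ⟨hk1, hk2, hk3⟩ := hKj j
      obtain ⟨b1, b2⟩ := abs_le.1 (hzx j)
      have h5 := (hz2 j).2
      rw [hsplit] at h5
      split_ifs with h1 h2
      -- Types of probability zero may be misclassified, but they do not arrive on the good event.
      · rcases (hM.lam_nonneg j).eq_or_lt with hlam | hlam
        · have h6 : winCount s (1 + l₁) l₂ j = 0 := by
            refine Finset.sum_eq_zero fun t ht => if_neg fun hjt => ?_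
            have := hposl t (Finset.mem_range.1 ht)
            rw [← hl₁, hjt, ← hlam] at this
            exact lt_irrefl _ this
          rw [h6] at h5
          exact h5
        · have := hcmp hlam (hk1 hlam)
          have h3 := (abs_le.1 (hw3 j)).1
          rw [h1] at b2
          linarith
      · exact h5
      · have hxj : x j < M.lam j := lt_of_le_of_ne (hx.le_lam j) h2
        have := hcmp (sub_pos.2 hxj) (hk3 hxj)
        have h3 := (abs_le.1 (hcnt j)).1
        have h4 := (abs_le.1 (hw3 j)).1
        rw [hNk] at b2
        linarith
  -- Plans too poor for `hnear` are worth less than `z₀`, to which it applies.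
  have h0 := hnear z₀ hz₀cap hz₀mem hz₀val
  refine Model.lpVal_le (le_trans (Finset.sum_nonneg fun j _ =>
    mul_nonneg (hM.r_nonneg j) (hz₀mem j).1) h0) fun z hz1 hz2 => ?_
  by_cases hz3 : N * M.dual M.rho p - (2 * M.rTot + 2) * E ≤ ∑ j, M.r j * z j
  · exact hnear z hz1 hz2 hz3
  · linarith

end PhaseIIAnalysis


/-! ### Models without control of the consumption -/

/-- The fluid solution `x` serves one type `j₀` only, partially, and only one resource `i₀`
matters. -/
structure Model.IsSingle (M : Model m n) (i₀ : Fin m) (j₀ : Fin n) (p : Fin m → ℝ)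
    (x : Fin n → ℝ) : Prop where
  margin_nonpos : ∀ j, M.margin p j ≤ 0
  eq_zero : ∀ j, j ≠ j₀ → x j = 0
  lt_lam : x j₀ < M.lam j₀
  A_eq_zero : ∀ i, i ≠ i₀ → M.A i j₀ = 0
  A_pos : 0 < M.A i₀ j₀
  r_pos : 0 < M.r j₀
  eq_rho : M.A i₀ j₀ * x j₀ = M.rho i₀

/-- Always `∑ ᾱ_i ≤ θ̄`, because `B_max / B_min ≥ 1`. So one `ᾱ_i` reaching `θ̄` leaves nothing for
the others. -/
lemma Model.Valid.alphaBar_eq_thetaBar (hM : M.Valid) {i₀ : Fin m}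
    (hi₀ : M.thetaBar M.rho ≤ M.alphaBar i₀) :
    M.alphaBar i₀ = M.thetaBar M.rho ∧ ∀ i, i ≠ i₀ → M.alphaBar i = 0 := by
  have := hM.nonempty_resources
  have hinf := iInf_fin_pos hM.rho_pos
  have hα := hM.alphaBar_nonneg
  have hS : 0 ≤ ∑ i, M.alphaBar i := Finset.sum_nonneg fun i _ => hα i
  have h1 : ∑ i, M.alphaBar i ≤ M.thetaBar M.rho := by
    refine le_mul_of_one_le_left hS ((one_le_div hinf).2 ?_)
    exact (iInf_fin_le M.rho i₀).trans (le_iSup_fin M.rho i₀)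
  have h2 := Finset.add_sum_erase Finset.univ M.alphaBar (Finset.mem_univ i₀)
  have h3 : 0 ≤ ∑ i ∈ Finset.univ.erase i₀, M.alphaBar i := Finset.sum_nonneg fun i _ => hα i
  refine ⟨by linarith, fun i hi => le_antisymm ?_ (hα i)⟩
  have h4 := Finset.single_le_sum (f := M.alphaBar) (fun i _ => hα i)
    (Finset.mem_erase.2 ⟨hi, Finset.mem_univ i⟩)
  linarith

/-- If every minimizer `p` has `∑ p_i ≥ θ̄`, then the dual value at `ᾱ` is at most `θ̄ ρ_min ≤ ρ_min
∑ p_i`, hence at most the minimum. -/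
lemma Model.Valid.isDualMin_alphaBar (hM : M.Valid)
    (h : ∀ p, M.IsDualMin M.rho p → M.thetaBar M.rho ≤ ∑ i, p i) :
    M.IsDualMin M.rho M.alphaBar := by
  have := hM.nonempty_resources
  have hinf := iInf_fin_pos hM.rho_pos
  obtain ⟨p, hp⟩ := hM.exists_isDualMin hM.rho_pos
  refine ⟨hM.alphaBar_nonneg, fun q hq => le_trans ?_ (hp.le q hq)⟩
  calc M.dual M.rho M.alphaBar = ∑ i, M.alphaBar i * M.rho i := hM.dual_alphaBar _
    _ ≤ ∑ i, M.alphaBar i * ⨆ i, M.rho i := Finset.sum_le_sum fun i _ =>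
        mul_le_mul_of_nonneg_left (le_iSup_fin _ i) (hM.alphaBar_nonneg i)
    _ = M.thetaBar M.rho * ⨅ i, M.rho i := by
        rw [← Finset.sum_mul, Model.thetaBar]
        field_simp
    _ ≤ (∑ i, p i) * ⨅ i, M.rho i := mul_le_mul_of_nonneg_right (h p hp) hinf.le
    _ = ∑ i, p i * ⨅ i, M.rho i := Finset.sum_mul ..
    _ ≤ ∑ i, p i * M.rho i := Finset.sum_le_sum fun i _ =>
        mul_le_mul_of_nonneg_left (iInf_fin_le _ i) (hp.nonneg i)
    _ ≤ M.dual M.rho p := le_add_of_nonneg_right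
        (Finset.sum_nonneg fun j _ => mul_nonneg (hM.lam_nonneg j) (le_max_left _ _))

/-- Failure of both criteria for excess control makes `ᾱ` a dual minimizer supported on one resource
`i₀`. Then `m - 1` equations `p_i = 0` are tight already, and general position leaves room for a
single type, the one that attains the maximal ratio at `i₀`. -/
lemma Model.Valid.exists_isSingle (hM : M.Valid) (hgen : M.GeneralPosition)
    (hE : ¬ M.ExcessControl) :
    ∃ i₀ j₀ p x, M.IsDualMin M.rho p ∧ M.IsFluid p x ∧ M.IsSingle i₀ j₀ p x := by
  classical
  obtain ⟨i₀, hi₀⟩ : ∃ i₀, M.thetaBar M.rho ≤ M.alphaBar i₀ := by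
    by_contra! h
    exact hE (hM.excessControl_of_alphaBar_lt h)
  have hsum : ∀ p, M.IsDualMin M.rho p → M.thetaBar M.rho ≤ ∑ i, p i := fun p hp => by
    by_contra! h
    exact hE (hM.excessControl_of_sum_lt hp h)
  obtain ⟨hΘ, hzero⟩ := hM.alphaBar_eq_thetaBar hi₀
  have hp := hM.isDualMin_alphaBar hsum
  obtain ⟨x, hx⟩ := hgen.exists_isFluid hM hp
  have hmargin : ∀ j, M.margin M.alphaBar j ≤ 0 := fun j => by
    rw [Model.margin]; linarith [hM.r_le_sum_alphaBar j]
  have hval : ∀ j, ∑ i, M.alphaBar i * M.A i j = M.alphaBar i₀ * M.A i₀ j := fun j =>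
    Finset.sum_eq_single i₀ (fun i _ hi => by rw [hzero i hi, zero_mul]) (by simp)
  -- If `ᾱ = 0`, all `m + n` equations would be tight.
  have hpos : 0 < M.alphaBar i₀ := by
    refine lt_of_le_of_ne (hM.alphaBar_nonneg i₀) fun h0 => ?_
    have h1 : M.tight M.alphaBar = Finset.univ := by
      refine Finset.eq_univ_iff_forall.2 fun l => ?_
      rcases l with j | i
      · rw [M.mem_tight_inl, hval, ← h0, zero_mul]
        refine le_antisymm (hM.r_nonneg j) ?_
        have := hM.r_le_sum_alphaBar j
        rwa [hval, ← h0, zero_mul] at this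
      · rw [M.mem_tight_inr]
        by_cases hi : i = i₀
        · rw [hi, ← h0]
        · exact hzero i hi
    have h2 := hgen.card_tight_le M.alphaBar
    rw [h1, Finset.card_univ, Fintype.card_sum, Fintype.card_fin, Fintype.card_fin] at h2
    obtain ⟨j⟩ := hM.nonempty_types
    have := j.pos
    lia
  obtain ⟨j₀, hA₀, hj₀⟩ : ∃ j, M.A i₀ j ≠ 0 ∧ M.alphaBar i₀ = M.r j / M.A i₀ j := by
    refine Set.Nonempty.csSup_mem (s := {x : ℝ | ∃ j, M.A i₀ j ≠ 0 ∧ x = M.r j / M.A i₀ j}) ?_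
      (M.finite_ratios i₀)
    by_contra h
    rw [Set.not_nonempty_iff_eq_empty] at h
    rw [Model.alphaBar, h, Real.sSup_empty] at hpos
    exact lt_irrefl _ hpos
  have hApos : 0 < M.A i₀ j₀ := lt_of_le_of_ne (hM.A_nonneg _ _) (Ne.symm hA₀)
  have hr₀ : M.alphaBar i₀ * M.A i₀ j₀ = M.r j₀ := by rw [hj₀]; field_simp
  have hrpos : 0 < M.r j₀ := by rw [← hr₀]; positivity
  have hneg : ∀ j, j ≠ j₀ → M.margin M.alphaBar j < 0 := by
    intro j hj
    refine lt_of_le_of_ne (hmargin j) fun h0 => ?_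
    have hsub : insert (Sum.inl j) (insert (Sum.inl j₀)
        ((Finset.univ.erase i₀).map Function.Embedding.inr)) ⊆ M.tight M.alphaBar := by
      intro l hl
      simp only [Finset.mem_insert, Finset.mem_map, Finset.mem_erase, Finset.mem_univ, and_true,
        Function.Embedding.inr_apply] at hl
      rcases hl with rfl | rfl | ⟨i, hi, rfl⟩
      · rw [M.mem_tight_inl]; rw [Model.margin] at h0; linarith
      · rw [M.mem_tight_inl, hval, hr₀]
      · rw [M.mem_tight_inr]; exact hzero i hi
    have h1 := (Finset.card_le_card hsub).trans (hgen.card_tight_le _)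
    rw [Finset.card_insert_of_notMem (by simp [hj]), Finset.card_insert_of_notMem (by simp),
      Finset.card_map, Finset.card_erase_of_mem (Finset.mem_univ _), Finset.card_univ,
      Fintype.card_fin] at h1
    have := i₀.pos
    lia
  have hx0 : ∀ j, j ≠ j₀ → x j = 0 := fun j hj => hx.eq_zero j (hneg j hj)
  have hxρ : M.A i₀ j₀ * x j₀ = M.rho i₀ := by
    rw [← hx.eq_rho i₀ hpos, Finset.sum_eq_single j₀ (fun j _ hj => by rw [hx0 j hj, mul_zero])
      (by simp)]
  refine ⟨i₀, j₀, M.alphaBar, x, hp, hx, hmargin, hx0,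
    lt_of_le_of_ne (hx.le_lam j₀) fun hlam => ?_, fun i hi => ?_, hApos, hrpos, hxρ⟩
  -- If `j₀` were served completely, the price of `i₀` could be lowered by a small `δ` at constant
  -- dual value, which gives a minimizer with sum below `θ̄`.
  · have hev : ∀ᶠ δ : ℝ in 𝓝[>] 0, (∀ j, j ≠ j₀ → M.margin M.alphaBar j + δ * M.A i₀ j < 0) ∧
        δ < M.alphaBar i₀ := by
      refine Filter.Eventually.filter_mono nhdsWithin_le_nhds ?_
      rw [eventually_and, eventually_all]
      refine ⟨fun j => eventually_imp_distrib_left.2 fun hj => ?_, eventually_lt_nhds hpos⟩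
      have hc : Tendsto (fun δ : ℝ => M.margin M.alphaBar j + δ * M.A i₀ j) (𝓝 0)
          (𝓝 (M.margin M.alphaBar j + 0 * M.A i₀ j)) := Continuous.tendsto (by fun_prop) 0
      refine hc.eventually_lt_const ?_
      rw [zero_mul, add_zero]
      exact hneg j hj
    obtain ⟨δ, ⟨hδ1, hδ2⟩, hδ0⟩ := (hev.and self_mem_nhdsWithin).exists
    have hδ0 : 0 < δ := hδ0
    set q : Fin m → ℝ := fun i => if i = i₀ then M.alphaBar i₀ - δ else 0 with hq
    have hqsum : ∀ c : Fin m → ℝ, ∑ i, q i * c i = (M.alphaBar i₀ - δ) * c i₀ := fun c => by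
      simp [hq]
    have hqval : M.dual M.rho q = M.dual M.rho M.alphaBar := by
      rw [hM.dual_alphaBar, Model.dual, hqsum,
        Finset.sum_eq_single i₀ (fun i _ hi => by rw [hzero i hi, zero_mul]) (by simp),
        Finset.sum_eq_single j₀ (fun j _ hj => ?_) (by simp)]
      · rw [hqsum (fun i => M.A i j₀), ← hlam, ← hxρ, ← hr₀, max_eq_right (by nlinarith)]
        ring
      · rw [hqsum (fun i => M.A i j), max_eq_left, mul_zero]
        have := hδ1 j hj
        rw [Model.margin, hval] at this
        linarith
    have hqmin : M.IsDualMin M.rho q := by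
      refine ⟨fun i => ?_, fun u hu => hqval ▸ hp.le u hu⟩
      simp only [hq]
      split_ifs <;> linarith
    have h1 := hsum q hqmin
    have h2 := hqsum fun _ => 1
    simp only [mul_one] at h2
    linarith
  · by_contra hA
    have := hM.r_le_alphaBar_mul hA
    rw [hzero i hi, zero_mul] at this
    linarith

lemma Model.ffCount_of_not_active {s : ℕ → Fin n} {B : Fin m → ℝ} {L : ℝ} {t₁ l : ℕ}
    (h : ¬ M.Active s B L t₁ l) (k : ℕ) (j : Fin n) :
    M.ffCount s B L t₁ (l + k) j = M.ffCount s B L t₁ l j := by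
  rw [Model.ffCount, Finset.sum_range_add, ← Model.ffCount, add_eq_left]
  refine Finset.sum_eq_zero fun t _ => ?_
  have hna : ¬ M.Active s B L t₁ (l + t) := fun h' => h (h'.mono (Nat.le_add_right _ _))
  split_ifs
  · exact if_neg hna
  · rfl

/-- If the fluid solution serves one type only, then the decisions of phase II are optimal on a
good event. -/
lemma Model.IsSingle.eventually_VHI_le {i₀ : Fin m} {j₀ : Fin n} {p : Fin m → ℝ} {x : Fin n → ℝ}
    (hS : M.IsSingle i₀ j₀ p x) (hM : M.Valid)
    (hgen : M.GeneralPosition) (hp : M.IsDualMin M.rho p) (hx : M.IsFluid p x) :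
    ∀ᶠ K : ℝ in atTop, ∀ (T : ℕ) (α β γ : ℝ) (k : ℕ) (s : ℕ → Fin n) (e : ℝ), 0 < T → 0 ≤ e →
      len1 T α + len2 T α β + k = T → K * (e + 1 + √(T : ℝ)) ≤ k → M.Classified T α γ s x →
      M.GoodII T α β s e → M.VHI T α s ≤ M.VHII T α β γ s := by
  obtain ⟨K₁, hK₁, hfull⟩ := hM.exists_full_run_const hgen hp hx
  have hr := hM.rTot_nonneg
  have ha := hM.aBar_pos
  have hrc := hM.one_le_runConst
  have hr₀ := hS.r_pos
  have hA₀ := hS.A_pos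
  have hx₀ : 0 < x j₀ := by
    have := hM.rho_pos i₀
    rw [← hS.eq_rho] at this
    exact pos_of_mul_pos_right this hA₀.le
  have hlam₀ := hx₀.trans hS.lt_lam
  set K₂ := (M.runConst + M.rTot * K₁) / M.r j₀ + K₁ with hK₂
  have hK₂0 : 0 ≤ K₂ := by positivity
  have hev : ∀ᶠ K : ℝ in atTop, (∀ i, M.aBar ≤ M.rho i * K) ∧
      M.aBar / M.A i₀ j₀ + 1 ≤ M.lam j₀ * K ∧ K₂ + 1 ≤ (M.lam j₀ - x j₀) * K := by
    rw [eventually_and, eventually_and, eventually_all]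
    exact ⟨fun i => eventually_mul_ge (hM.rho_pos i) _, eventually_mul_ge hlam₀ _,
      eventually_mul_ge (sub_pos.2 hS.lt_lam) _⟩
  filter_upwards [hev, eventually_gt_atTop 0] with K hK hK0
  obtain ⟨hKi, hKl, hKx⟩ := hK
  intro T α β γ k s e hT he hk hKk hcl hgood
  set l₁ := len1 T α with hl₁
  set l₂ := len2 T α β with hl₂
  have hTl : T - l₁ = l₂ + k := by lia
  have hTll : T - (l₁ + l₂) = k := by lia
  have hTr : (T : ℝ) - l₁ = (l₂ + k : ℕ) := by
    rw [← hk]; push_cast; ring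
  have hNT : ((l₂ + k : ℕ) : ℝ) ≤ T := by exact_mod_cast (by lia)
  have hNnat : (0 : ℝ) < k → 0 < l₂ + k := fun h => by
    have : 0 < k := by exact_mod_cast h
    lia
  have hcapn : ∀ i, 0 ≤ M.capII T α γ s l₂ i := hM.capII_nonneg (by rw [← hl₁]; lia) l₂
  set N : ℝ := ((l₂ + k : ℕ) : ℝ) with hN
  have hNk : N = l₂ + k := by rw [hN]; push_cast; ring
  set E := e + 1 + √(T : ℝ) with hEdef
  have hs := Real.sqrt_nonneg (T : ℝ)
  have hE1 : 1 ≤ E := by linarith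
  have heE : e ≤ E := by linarith
  have hk0 : (0 : ℝ) < k := lt_of_lt_of_le (by nlinarith) hKk
  have hl₂0 : (0 : ℝ) ≤ l₂ := Nat.cast_nonneg _
  have hN0 : 0 < N := by linarith
  have hcap : M.capStartII T α = M.rhoCap N := by
    rw [M.capStartII_eq_rhoCap hT, ← hl₁, hTr]
  have hsqN : √N ≤ √(T : ℝ) := Real.sqrt_le_sqrt hNT
  have hsq : √(l₂ : ℝ) ≤ √(T : ℝ) := (Real.sqrt_le_sqrt (by linarith)).trans hsqN
  have hgr := hgood.run
  have hgf := hgood.full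
  have hw3 := hgood.win'
  rw [← hl₁, ← hl₂] at hgr hw3
  rw [← hl₁] at hgf
  rw [hTl] at hgr hgf
  rw [hTll] at hw3
  have hcmp : ∀ {a b : ℝ}, 0 < a → b ≤ a * K → b * E ≤ a * k := fun {a b} ha' hb => by
    calc b * E ≤ a * K * E := mul_le_mul_of_nonneg_right hb (by linarith)
      _ = a * (K * E) := by ring
      _ ≤ a * k := mul_le_mul_of_nonneg_left hKk ha'.le
  have hcnt : ∀ j, |M.ffCount s (M.rhoCap N) N (1 + l₁) (l₂ + k) j - N * x j| ≤ K₁ * E :=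
    fun j => (hfull s (1 + l₁) (l₂ + k) e (hNnat hk0) he hgf j).trans
      (mul_le_mul_of_nonneg_left (by linarith) hK₁)
  have hposl : ∀ t < l₂, 0 < M.lam (s (1 + len1 T α + t)) := fun t ht =>
    hgood.support t (by rw [← hl₁]; lia)
  have hwnn : ∀ j, 0 ≤ M.countII T α γ s l₂ j := fun j =>
    (decCount_mem (fun t => M.decII_mem T α γ s _ t) ..).1
  have hw0 : ∀ j, j ≠ j₀ → M.countII T α γ s l₂ j = 0 := fun j hj => by
    refine le_antisymm ((Model.countII_le_idealCount hcl hposl j).trans ?_) (hwnn j)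
    rw [M.idealCount_eq hT, if_pos (hS.eq_zero j hj)]
  have huse : ∀ i, M.capII T α γ s l₂ i =
      N * M.rho i - M.A i j₀ * M.countII T α γ s l₂ j₀ := fun i => by
    rw [M.capII_eq, hcap, Model.rhoCap,
      Finset.sum_eq_single j₀ (fun j _ hj => by rw [hw0 j hj, mul_zero]) (by simp)]
  set w := M.countII T α γ s l₂ with hw
  have hwle : w j₀ ≤ N * x j₀ := by
    have h1 := hcapn i₀
    rw [huse, ← hS.eq_rho] at h1
    exact le_of_mul_le_mul_left (by linarith) hA₀
  -- The optimal plan is `N x`, which serves `j₀` only. It can be completed after phase II if enough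
  -- of `j₀` was accepted; too much is excluded by the capacity of `i₀` (`hwle`).
  have hmain : N * x j₀ ≤ w j₀ + winCount s (1 + l₁ + l₂) k j₀ := by
    have h3 := (abs_le.1 (hw3 j₀)).1
    by_cases hsuf : ∀ t < l₂, M.Sufficient (M.capII T α γ s t)
    · have hwf : w j₀ = M.ffCount s (M.rhoCap N) N (1 + l₁) l₂ j₀ := by
        rw [hw, Model.countII_eq_idealCount hcl hposl hsuf, M.idealCount_eq hT,
          if_neg hx₀.ne', if_neg hS.lt_lam.ne, ← hl₁, hTr]
      have hf : l₂ * x j₀ - K₂ * E ≤ w j₀ := by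
        rw [hwf]
        have hq : 0 ≤ (M.runConst + M.rTot * K₁) / M.r j₀ * E := by positivity
        -- If the run is active, its revenue is about that of `l₂ x`. The other types contribute
        -- little: their counts only grow and are `O(E)` at the end of the full run. So the revenue
        -- comes from `j₀`. If the run has stopped, its count of `j₀` is already the final one,
        -- about `N x_{j₀}`.
        by_cases hact : M.Active s (M.rhoCap N) N (1 + l₁) l₂
        · have h1 := hgr.revenue_ge hM hN0 he hp (u := fun _ => 0)
            (fun _ => ⟨le_rfl, hM.thetaBar_nonneg hM.rho_pos⟩)
          rw [Model.activeTime_of_active fun t ht => hact.mono (le_of_lt ht)] at h1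
          simp only [zero_mul, Finset.sum_const_zero, add_zero] at h1
          rw [← hx.revenue, Finset.sum_eq_single (f := fun j => M.r j * x j) j₀
            (fun j _ hj => by rw [hS.eq_zero j hj, mul_zero]) (by simp)] at h1
          have h2 : ∑ j, M.r j * M.ffCount s (M.rhoCap N) N (1 + l₁) l₂ j ≤
              M.r j₀ * M.ffCount s (M.rhoCap N) N (1 + l₁) l₂ j₀ + M.rTot * (K₁ * E) := by
            rw [← Finset.add_sum_erase _ _ (Finset.mem_univ j₀)]
            refine add_le_add_right ?_ _
            calc _ ≤ ∑ j ∈ Finset.univ.erase j₀, M.r j * (K₁ * E) := by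
                  refine Finset.sum_le_sum fun j hj =>
                    mul_le_mul_of_nonneg_left ?_ (hM.r_nonneg j)
                  have h5 := (abs_le.1 (hcnt j)).2
                  rw [hS.eq_zero j (Finset.ne_of_mem_erase hj)] at h5
                  have h6 := M.ffCount_mono s (M.rhoCap N) N (1 + l₁) j (Nat.le_add_right l₂ k)
                  simp only at h6
                  linarith
              _ ≤ ∑ j, M.r j * (K₁ * E) := Finset.sum_le_sum_of_subset_of_nonneg
                  (Finset.erase_subset _ _) fun j _ _ => mul_nonneg (hM.r_nonneg j) (by positivity)
              _ = M.rTot * (K₁ * E) := by rw [← Finset.sum_mul]; rfl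
          have h4 : M.runConst * (e + 1 + √(l₂ : ℝ)) ≤ M.runConst * E :=
            mul_le_mul_of_nonneg_left (by linarith) (by linarith)
          have h5 : M.r j₀ * (l₂ * x j₀ - (M.runConst + M.rTot * K₁) / M.r j₀ * E) ≤
              M.r j₀ * M.ffCount s (M.rhoCap N) N (1 + l₁) l₂ j₀ := by
            have : M.r j₀ * ((M.runConst + M.rTot * K₁) / M.r j₀ * E) =
              (M.runConst + M.rTot * K₁) * E := by field_simp
            rw [mul_sub, this]
            linarith
          have h6 := le_of_mul_le_mul_left h5 hr₀
          rw [hK₂]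
          have : 0 ≤ K₁ * E := by positivity
          linarith
        · rw [← Model.ffCount_of_not_active hact k]
          have h1 := (abs_le.1 (hcnt j₀)).1
          have h2 : 0 ≤ k * x j₀ := by positivity
          rw [hNk] at h1 ⊢
          rw [hK₂]
          linarith
      have h4 := hcmp (sub_pos.2 hS.lt_lam) hKx
      rw [hNk]
      linarith
    -- If real capacity ran short, it was that of `i₀`, as `j₀` uses no other resource; then `j₀`
    -- has already been served nearly `N x_{j₀}` times.
    · push Not at hsuf
      obtain ⟨t, ht, hns⟩ := hsuf
      unfold Model.Sufficient at hns
      push Not at hns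
      obtain ⟨i, j, hij⟩ := hns
      have h1 := hM.capII_antitone T α γ s i ht.le
      have h2 := M.le_aBar i j
      have h4 : N * M.rho i - M.A i j₀ * w j₀ < M.aBar := by
        rw [← huse]
        simp only at h1
        linarith
      have hi : i = i₀ := by
        by_contra hi
        rw [hS.A_eq_zero i hi, zero_mul, sub_zero] at h4
        have h5 := hcmp (hM.rho_pos i) (hKi i)
        have h6 : M.aBar ≤ M.aBar * E := le_mul_of_one_le_right ha.le hE1
        have h7 := mul_le_mul_of_nonneg_left (show (k : ℝ) ≤ N by linarith) (hM.rho_pos i).le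
        linarith
      rw [hi, ← hS.eq_rho] at h4
      have h5 : N * x j₀ - w j₀ < M.aBar / M.A i₀ j₀ := by
        rw [lt_div_iff₀ hA₀]
        linarith
      have h6 := hcmp hlam₀ hKl
      have h7 : M.aBar / M.A i₀ j₀ ≤ M.aBar / M.A i₀ j₀ * E :=
        le_mul_of_one_le_right (by positivity) hE1
      linarith
  rw [M.VHI_eq, M.VHII_eq, ← hl₁, ← hl₂, hTl, hTll, hcap, add_assoc]
  refine add_le_add_right ?_ _
  have h1 := Model.lpVal_le_dual (M := M) (B := M.rhoCap N) (N := winCount s (1 + l₁) (l₂ + k))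
    (fun i => (hM.rhoCap_pos hN0 i).le) (fun j => winCount_nonneg ..) hp.nonneg
  rw [Finset.sum_eq_zero (s := Finset.univ (α := Fin n)) (fun j _ => by
    rw [max_eq_left (hS.margin_nonpos j), zero_mul]), add_zero] at h1
  have h2 : ∑ i, p i * M.rhoCap N i ≤ ∑ j, M.r j * (N * x j) := by
    have h3 : ∑ j, M.r j * (N * x j) = N * M.dual M.rho p := by
      rw [← hx.revenue, Finset.mul_sum]
      exact Finset.sum_congr rfl fun j _ => by ring
    have h4 : ∑ i, p i * M.rhoCap N i = N * ∑ i, p i * M.rho i := by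
      rw [Finset.mul_sum]
      exact Finset.sum_congr rfl fun i _ => by rw [Model.rhoCap]; ring
    rw [h3, h4]
    exact mul_le_mul_of_nonneg_left (le_add_of_nonneg_right (Finset.sum_nonneg fun j _ =>
      mul_nonneg (hM.lam_nonneg j) (le_max_left _ _))) hN0.le
  refine (h1.trans h2).trans (hM.le_add_lpVal (fun i => ?_) (fun j => ?_) fun j => ?_)
  · calc ∑ j, M.A i j * (N * x j) = N * ∑ j, M.A i j * x j := by
          rw [Finset.mul_sum]
          exact Finset.sum_congr rfl fun j _ => by ring
      _ ≤ N * M.rho i := mul_le_mul_of_nonneg_left (hx.le_rho i) hN0.le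
  · by_cases hj : j = j₀
    · rw [hj]; exact hwle
    · exact ((hw0 j hj).trans (by rw [hS.eq_zero j hj, mul_zero])).le
  · by_cases hj : j = j₀
    · rw [hj]; exact hmain
    · rw [hS.eq_zero j hj, mul_zero]
      exact add_nonneg (hwnn j) (winCount_nonneg ..)

/-- On a good event, phase II loses nothing against the hindsight optimum. -/
lemma Model.Valid.eventually_VHI_le (hM : M.Valid) (hgen : M.GeneralPosition) :
    ∃ p x, M.IsDualMin M.rho p ∧ M.IsFluid p x ∧
      ∀ᶠ K : ℝ in atTop, ∀ (T : ℕ) (α β γ : ℝ) (k : ℕ) (s : ℕ → Fin n) (e : ℝ), 0 < T → 0 ≤ e →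
        len1 T α + len2 T α β + k = T → K * (e + 1 + √(T : ℝ)) ≤ k → M.Classified T α γ s x →
        M.GoodII T α β s e → M.VHI T α s ≤ M.VHII T α β γ s := by
  -- The fluid solution need not be the same in the two cases; the single-type one comes with its
  -- own dual price `ᾱ`.
  by_cases hE : M.ExcessControl
  · obtain ⟨p, hp⟩ := hM.exists_isDualMin hM.rho_pos
    obtain ⟨x, hx⟩ := hgen.exists_isFluid hM hp
    exact ⟨p, x, hp, hx, hE.eventually_VHI_le hM hgen hp hx⟩
  · obtain ⟨i₀, j₀, p, x, hp, hx, hS⟩ := hM.exists_isSingle hgen hE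
    exact ⟨p, x, hp, hx, hS.eventually_VHI_le hM hgen hp hx⟩


/-! ### Probability of large fluctuations -/

section Fluctuations

variable {Ω : Type*} [MeasurableSpace Ω] {μ : Measure Ω} [IsProbabilityMeasure μ]
  {J : ℕ → Ω → Fin n}

/-- Bound for the increments of all martingales in the analysis. -/
noncomputable def Model.incConst (M : Model m n) : ℝ := M.rTot + 1

lemma Model.Valid.one_le_incConst (hM : M.Valid) : 1 ≤ M.incConst := by
  have := hM.rTot_nonneg
  rw [Model.incConst]
  linarith

lemma Model.Valid.lam_le_one (hM : M.Valid) (j : Fin n) : M.lam j ≤ 1 := by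
  rw [← hM.lam_sum]
  exact Finset.single_le_sum (f := M.lam) (fun j _ => hM.lam_nonneg j) (Finset.mem_univ j)

/-- Centered indicator of the arrival of type `j`. -/
noncomputable def Model.centered (M : Model m n) (j i : Fin n) : ℝ :=
  (if i = j then 1 else 0) - M.lam j

lemma Model.Valid.sum_lam_mul_centered (hM : M.Valid) (j : Fin n) :
    ∑ i, M.lam i * M.centered j i = 0 := by
  simp only [Model.centered, mul_sub, Finset.sum_sub_distrib, mul_ite, mul_one, mul_zero,
    Finset.sum_ite_eq', Finset.mem_univ, if_true]
  rw [← Finset.sum_mul, hM.lam_sum, one_mul, sub_self]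

lemma Model.Valid.abs_centered_le (hM : M.Valid) (j i : Fin n) : |M.centered j i| ≤ 1 := by
  have h1 := hM.lam_nonneg j
  have h2 := hM.lam_le_one j
  unfold Model.centered
  rw [abs_le]
  split_ifs <;> constructor <;> linarith

lemma Model.Valid.isIncrement_centered (hM : M.Valid) (t₁ : ℕ) (j : Fin n) :
    M.IsIncrement t₁ fun _ _ i => M.centered j i where
  dependsOn _ _ := fun _ _ _ => rfl
  mean _ _ := hM.sum_lam_mul_centered j

lemma Model.Valid.isIncrement_act_centered (hM : M.Valid) (B : Fin m → ℝ) (L : ℝ) (t₁ : ℕ)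
    (j : Fin n) : M.IsIncrement t₁ fun k s i => M.act s B L t₁ k * M.centered j i where
  dependsOn k i := fun s s' h => by
    simp only
    rw [M.act_congr B L t₁ fun t ht => h t ht]
  mean k s := by
    simp only [mul_left_comm (M.lam _), ← Finset.mul_sum, hM.sum_lam_mul_centered j, mul_zero]

lemma Model.Valid.isIncrement_dualAt (hM : M.Valid) (L : ℝ) (t₁ : ℕ) :
    M.IsIncrement t₁ fun k s j => -(M.act s (M.rhoCap L) L t₁ k *
      (M.dualAt M.rho (M.price s (M.rhoCap L) L t₁ k) j -
        M.dual M.rho (M.price s (M.rhoCap L) L t₁ k))) := by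
  refine Model.IsIncrement.neg ⟨fun k i => fun s s' h => ?_, fun k s => ?_⟩
  · simp only
    rw [M.act_congr _ L t₁ fun t ht => h t ht, M.price_congr _ L t₁ fun t ht => h t ht]
  · simp only [mul_left_comm (M.lam _), ← Finset.mul_sum, hM.sum_lam_mul_sub, mul_zero]

lemma Model.Valid.abs_dualAt_sub_le (hM : M.Valid) {p : Fin m → ℝ} (hp : ∀ i, 0 ≤ p i)
    (j : Fin n) : |M.dualAt M.rho p j - M.dual M.rho p| ≤ M.rTot := by
  have hr := hM.rTot_nonneg
  have h1 : ∀ j, max 0 (M.r j - ∑ i, p i * M.A i j) ≤ M.rTot := fun j => by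
    have h2 := hM.r_le_rTot j
    have h3 : 0 ≤ ∑ i, p i * M.A i j := Finset.sum_nonneg fun i _ =>
      mul_nonneg (hp i) (hM.A_nonneg i j)
    exact max_le hr (by linarith)
  have h0 : ∀ j, 0 ≤ max 0 (M.r j - ∑ i, p i * M.A i j) := fun j => le_max_left _ _
  have h2 : ∑ j, M.lam j * max 0 (M.r j - ∑ i, p i * M.A i j) ≤ M.rTot := by
    calc _ ≤ ∑ j, M.lam j * M.rTot := Finset.sum_le_sum fun j _ =>
          mul_le_mul_of_nonneg_left (h1 j) (hM.lam_nonneg j)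
      _ = M.rTot := by rw [← Finset.sum_mul, hM.lam_sum, one_mul]
  have h3 : 0 ≤ ∑ j, M.lam j * max 0 (M.r j - ∑ i, p i * M.A i j) :=
    Finset.sum_nonneg fun j _ => mul_nonneg (hM.lam_nonneg j) (h0 j)
  rw [Model.dualAt, Model.dual, add_sub_add_left_eq_sub, abs_le]
  constructor <;> linarith [h0 j, h1 j]

lemma Model.act_mul_abs_le (M : Model m n) (s : ℕ → Fin n) (B : Fin m → ℝ) (L : ℝ) (t₁ k : ℕ)
    {y c : ℝ} (hy : |y| ≤ c) : |M.act s B L t₁ k * y| ≤ c := by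
  rcases M.act_mem s B L t₁ k with h | h
  · rw [h, zero_mul, abs_zero]; exact (abs_nonneg y).trans hy
  · rwa [h, one_mul]

variable {N e : ℝ} {k : ℕ}

/-- Bound for the probability that a fluctuation of the arrivals in at most `N` periods
exceeds `e`. -/
noncomputable def Model.tailBound (M : Model m n) (N e : ℝ) : ℝ :=
  Real.exp (-(e ^ 2 / (4 * N * M.incConst ^ 2)))

/-- A union bound over `n + 1` martingales: one for the dual contributions, one for the arrivals of
each type while the run is active. -/
lemma Model.IsArrivalSequence.measureReal_not_goodRun_le (hJ : M.IsArrivalSequence μ J)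
    (hM : M.Valid) {L : ℝ} (hL : 0 < L) (t₁ : ℕ) (he : 0 ≤ e) (hN : 0 < N)
    (heN : e ≤ 2 * N * M.incConst) (hk : k ≤ N) :
    μ.real {ω | ¬ M.GoodRun (fun t => J t ω) L t₁ k e} ≤ (n + 1) * M.tailBound N e := by
  have hc := hM.one_le_incConst
  have h1 := hJ.azuma hM (hM.isIncrement_dualAt L t₁) (zero_lt_one.trans_le hc)
    (fun k s j => by
      rw [abs_neg]
      refine M.act_mul_abs_le _ _ _ _ _ ((hM.abs_dualAt_sub_le
        (fun i => (hM.price_mem (hM.rhoCap_pos hL) k i).1) j).trans ?_)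
      rw [Model.incConst]; linarith) he hN heN hk
  have h2 := fun j => hJ.azuma hM (hM.isIncrement_act_centered (M.rhoCap L) L t₁ j)
    (zero_lt_one.trans_le hc)
    (fun k s i => M.act_mul_abs_le _ _ _ _ _ ((hM.abs_centered_le j i).trans hc)) he hN heN hk
  set S := {ω | e ≤ ∑ t ∈ Finset.range k, -(M.act (fun i => J i ω) (M.rhoCap L) L t₁ t *
      (M.dualAt M.rho (M.price (fun i => J i ω) (M.rhoCap L) L t₁ t) (J (t₁ + t) ω) -
        M.dual M.rho (M.price (fun i => J i ω) (M.rhoCap L) L t₁ t)))} with hS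
  set R : Fin n → Set Ω := fun j => {ω | e ≤ ∑ t ∈ Finset.range k,
    M.act (fun i => J i ω) (M.rhoCap L) L t₁ t * M.centered j (J (t₁ + t) ω)} with hR
  have hsub : {ω | ¬ M.GoodRun (fun t => J t ω) L t₁ k e} ⊆ S ∪ ⋃ j ∈ Finset.univ, R j := by
    intro ω hω
    by_contra hn
    simp only [Set.mem_union, Set.mem_iUnion, not_or, not_exists, hS, hR, Set.mem_ofPred_eq,
      not_le, Finset.mem_univ, true_implies] at hn
    refine hω ⟨?_, fun j => ?_⟩
    · have := hn.1
      rw [Finset.sum_neg_distrib] at this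
      linarith
    · have h3 := hn.2 j
      have h4 : M.ffArrivals (fun t => J t ω) (M.rhoCap L) L t₁ k j -
          M.activeTime (fun t => J t ω) (M.rhoCap L) L t₁ k * M.lam j =
          ∑ t ∈ Finset.range k, M.act (fun i => J i ω) (M.rhoCap L) L t₁ t *
            M.centered j (J (t₁ + t) ω) := by
        rw [Model.ffArrivals, Model.activeTime, Finset.sum_mul, ← Finset.sum_sub_distrib]
        refine Finset.sum_congr rfl fun t _ => ?_
        rw [Model.centered]
        split_ifs <;> ring
      linarith
  calc _ ≤ μ.real (S ∪ ⋃ j ∈ Finset.univ, R j) := measureReal_mono hsub (measure_ne_top _ _)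
    _ ≤ μ.real S + ∑ j, μ.real (R j) :=
        (measureReal_union_le _ _).trans (add_le_add_right (measureReal_biUnion_finset_le _ _) _)
    _ ≤ M.tailBound N e + ∑ _j : Fin n, M.tailBound N e :=
        add_le_add h1 (Finset.sum_le_sum fun j _ => h2 j)
    _ = (n + 1) * M.tailBound N e := by
        rw [Finset.sum_const, Finset.card_univ, Fintype.card_fin, nsmul_eq_mul]; ring

lemma Model.IsArrivalSequence.measureReal_winCount_le (hJ : M.IsArrivalSequence μ J)
    (hM : M.Valid) (t₁ : ℕ) (he : 0 ≤ e) (hN : 0 < N)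
    (heN : e ≤ 2 * N * M.incConst) (hk : k ≤ N) :
    μ.real {ω | ¬ ∀ j, |winCount (fun t => J t ω) t₁ k j - k * M.lam j| ≤ e} ≤
      2 * n * M.tailBound N e := by
  have hc := hM.one_le_incConst
  have h1 := fun j => hJ.azuma hM (hM.isIncrement_centered t₁ j) (zero_lt_one.trans_le hc)
    (fun k s i => (hM.abs_centered_le j i).trans hc) he hN heN hk
  have h2 := fun j => hJ.azuma hM (hM.isIncrement_centered t₁ j).neg (zero_lt_one.trans_le hc)
    (fun k s i => by rw [abs_neg]; exact (hM.abs_centered_le j i).trans hc) he hN heN hk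
  set S : Fin n → Set Ω := fun j => {ω | e ≤ ∑ t ∈ Finset.range k,
    M.centered j (J (t₁ + t) ω)} with hS
  set R : Fin n → Set Ω := fun j => {ω | e ≤ ∑ t ∈ Finset.range k,
    -M.centered j (J (t₁ + t) ω)} with hR
  have hsub : {ω | ¬ ∀ j, |winCount (fun t => J t ω) t₁ k j - k * M.lam j| ≤ e} ⊆
      ⋃ j ∈ Finset.univ, (S j ∪ R j) := by
    intro ω hω
    by_contra hn
    simp only [Set.mem_iUnion, Set.mem_union, not_or, not_exists, hS, hR, Set.mem_ofPred_eq,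
      not_le, Finset.mem_univ, true_implies, Finset.sum_neg_distrib] at hn
    refine hω fun j => ?_
    have h4 : winCount (fun t => J t ω) t₁ k j - k * M.lam j =
        ∑ t ∈ Finset.range k, M.centered j (J (t₁ + t) ω) := by
      simp only [winCount, Model.centered, Finset.sum_sub_distrib, Finset.sum_const,
        Finset.card_range, nsmul_eq_mul]
    rw [h4, abs_le]
    constructor <;> linarith [(hn j).1, (hn j).2]
  calc _ ≤ μ.real (⋃ j ∈ Finset.univ, (S j ∪ R j)) := measureReal_mono hsub (measure_ne_top _ _)
    _ ≤ ∑ j, (μ.real (S j) + μ.real (R j)) := (measureReal_biUnion_finset_le _ _).trans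
        (Finset.sum_le_sum fun j _ => measureReal_union_le _ _)
    _ ≤ ∑ _j : Fin n, (M.tailBound N e + M.tailBound N e) :=
        Finset.sum_le_sum fun j _ => add_le_add (h1 j) (h2 j)
    _ = 2 * n * M.tailBound N e := by
        rw [Finset.sum_const, Finset.card_univ, Fintype.card_fin, nsmul_eq_mul]; ring

/-- Correct classification is only claimed for types of positive probability, so the others have to
be discarded. -/
lemma Model.IsArrivalSequence.ae_lam_pos (hJ : M.IsArrivalSequence μ J) (hM : M.Valid) :
    ∀ᵐ ω ∂μ, ∀ t, 0 < M.lam (J t ω) := by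
  rw [ae_all_iff]
  intro t
  have h : ∀ j, ∀ᵐ ω ∂μ, J t ω = j → 0 < M.lam j := by
    intro j
    rcases (hM.lam_nonneg j).eq_or_lt with h0 | h0
    · have h1 := hJ.law t j
      rw [← h0, measureReal_eq_zero_iff] at h1
      filter_upwards [compl_mem_ae_iff.2 h1] with ω hω hj
      exact absurd hj hω
    · exact Eventually.of_forall fun _ _ => h0
  rw [← ae_all_iff] at h
  filter_upwards [h] with ω hω
  exact hω _ rfl

/-- Two two-sided counts of arrivals (`2n` each) and two runs (`n + 1` each) give `6n + 2`. -/
lemma Model.IsArrivalSequence.measureReal_not_goodII_le (hJ : M.IsArrivalSequence μ J)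
    (hM : M.Valid) {T : ℕ} {α β : ℝ} (hl : len1 T α + len2 T α β ≤ T)
    (hl₁ : len1 T α < T) (he : 0 ≤ e) (heT : e ≤ 2 * T * M.incConst) :
    μ.real {ω | ¬ M.GoodII T α β (fun t => J t ω) e} ≤ (6 * n + 2) * M.tailBound T e := by
  have hT : (0 : ℝ) < T := by exact_mod_cast (by lia)
  have hL : (0 : ℝ) < (T - len1 T α : ℕ) := by exact_mod_cast (by lia)
  have h1 := hJ.measureReal_winCount_le hM (k := len2 T α β) (1 + len1 T α) he hT heT
    (by exact_mod_cast (by lia))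
  have h2 := hJ.measureReal_winCount_le hM (k := T - (len1 T α + len2 T α β))
    (1 + len1 T α + len2 T α β) he hT heT (by exact_mod_cast (by lia))
  have h3 := hJ.measureReal_not_goodRun_le hM hL (k := len2 T α β) (1 + len1 T α) he hT heT
    (by exact_mod_cast (by lia))
  have h4 := hJ.measureReal_not_goodRun_le hM hL (k := T - len1 T α) (1 + len1 T α) he hT heT
    (by exact_mod_cast (by lia))
  set S₁ := {ω | ¬ ∀ j, |winCount (fun t => J t ω) (1 + len1 T α) (len2 T α β) j -
    len2 T α β * M.lam j| ≤ e}
  set S₂ := {ω | ¬ ∀ j, |winCount (fun t => J t ω) (1 + len1 T α + len2 T α β)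
    (T - (len1 T α + len2 T α β)) j - (T - (len1 T α + len2 T α β) : ℕ) * M.lam j| ≤ e}
  set S₃ := {ω | ¬ M.GoodRun (fun t => J t ω) (T - len1 T α : ℕ) (1 + len1 T α)
    (len2 T α β) e}
  set S₄ := {ω | ¬ M.GoodRun (fun t => J t ω) (T - len1 T α : ℕ) (1 + len1 T α)
    (T - len1 T α) e}
  set S₀ := {ω | ¬ ∀ t, 0 < M.lam (J t ω)}
  have h0 : μ.real S₀ = 0 := by
    rw [measureReal_eq_zero_iff]
    exact hJ.ae_lam_pos hM
  have hsub : {ω | ¬ M.GoodII T α β (fun t => J t ω) e} ⊆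
      S₀ ∪ (S₁ ∪ (S₂ ∪ (S₃ ∪ S₄))) := by
    intro ω hω
    by_contra hn
    simp only [Set.mem_union, not_or, S₀, S₁, S₂, S₃, S₄, Set.mem_ofPred_eq, not_not] at hn
    obtain ⟨g0, g1, g2, g3, g4⟩ := hn
    exact hω ⟨g1, g2, fun _ _ => g0 _, g3, g4⟩
  have h5 := measureReal_mono (μ := μ) hsub
  have h6 := measureReal_union_le (μ := μ) S₀ (S₁ ∪ (S₂ ∪ (S₃ ∪ S₄)))
  have h7 := measureReal_union_le (μ := μ) S₁ (S₂ ∪ (S₃ ∪ S₄))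
  have h8 := measureReal_union_le (μ := μ) S₂ (S₃ ∪ S₄)
  have h9 := measureReal_union_le (μ := μ) S₃ S₄
  linarith

/-- Loss of phase II. -/
lemma Model.IsArrivalSequence.exists_phaseII_bound (hJ : M.IsArrivalSequence μ J) (hM : M.Valid)
    (hgen : M.GeneralPosition) :
    ∃ C K : ℝ, 0 ≤ C ∧ 1 ≤ K ∧ ∀ (T : ℕ) (α β γ : ℝ) (k : ℕ) (e₁ e₂ : ℝ), 0 < T → 0 ≤ e₁ →
      0 ≤ e₂ → e₁ ≤ 2 * len1 T α * M.incConst → e₂ ≤ 2 * T * M.incConst →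
      len1 T α + len2 T α β + k = T →
      K * (e₁ + 1 + √(len1 T α : ℝ)) ≤ (T : ℝ) ^ (α / 2 + γ) →
      K * (T : ℝ) ^ (α / 2 + γ) ≤ (T : ℝ) ^ α → K * (e₂ + 1 + √(T : ℝ)) ≤ k →
      |∫ ω, (M.VHI T α (fun t => J t ω) - M.VHII T α β γ (fun t => J t ω)) ∂μ| ≤
        C * T * (M.tailBound (len1 T α) e₁ + M.tailBound T e₂) := by
  obtain ⟨p, x, hp, hx, hev⟩ := hM.eventually_VHI_le hgen
  obtain ⟨K, ⟨hK1, hK2⟩, hK3⟩ := ((hev.and (hM.eventually_classified hgen hp hx)).and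
    (eventually_ge_atTop 1)).exists
  have hr := hM.rTot_nonneg
  refine ⟨M.rTot * (6 * n + 2), K, by positivity, hK3,
    fun T α β γ k e₁ e₂ hT he₁ he₂ hb₁ hb₂ hk hc₁ hc₂ hc₃ => ?_⟩
  have hl := len1_pos hT α
  have hl' : (0 : ℝ) < len1 T α := by exact_mod_cast hl
  have hs := Real.sqrt_nonneg (T : ℝ)
  have hk0 : 0 < k := by
    have : (0 : ℝ) < k := lt_of_lt_of_le (by nlinarith) hc₃
    exact_mod_cast this
  have hlT : len1 T α + len2 T α β ≤ T := by lia
  set f : (ℕ → Fin n) → ℝ := fun s => M.VHI T α s - M.VHII T α β γ s with hf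
  have hdep : DependsOn f (Set.Iio (1 + len1 T α + len2 T α β + T)) := by
    intro s s' h
    simp only [hf]
    rw [M.dependsOn_VHI T α fun t ht => h t (by simp only [Set.mem_Iio] at ht ⊢; lia),
      M.dependsOn_VHII T α β γ h]
  have hmeas : Measurable fun ω => f fun t => J t ω := hJ.measurable_of_dependsOn hdep
  have hint : Integrable (fun ω => f fun t => J t ω) μ := hJ.integrable_of_dependsOn hdep
  set S := {ω | 0 < f fun t => J t ω} with hS
  have hSm : MeasurableSet S := measurableSet_lt measurable_const hmeas
  have hf0 : ∀ s, 0 ≤ f s := fun s => sub_nonneg.2 (hM.VHII_le_VHI hlT s)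
  have hfb : ∀ s, f s ≤ M.rTot * T := fun s => hM.VHI_sub_VHII_le s
  have hPS : μ.real S ≤ (n + 1) * M.tailBound (len1 T α) e₁ + (6 * n + 2) * M.tailBound T e₂ := by
    have hsub : S ⊆ {ω | ¬ M.GoodRun (fun t => J t ω) (len1 T α) 1 (len1 T α) e₁} ∪
        {ω | ¬ M.GoodII T α β (fun t => J t ω) e₂} := by
      intro ω hω
      by_contra hn
      simp only [Set.mem_union, not_or, Set.mem_ofPred_eq, not_not] at hn
      have h1 := hK2 T α γ _ e₁ hT he₁ hn.1 hc₁ hc₂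
      have h2 := hK1 T α β γ k _ e₂ hT he₂ hk hc₃ h1 hn.2
      have h3 : 0 < f fun t => J t ω := hω
      simp only [hf] at h3
      linarith
    refine (measureReal_mono hsub).trans ((measureReal_union_le _ _).trans (add_le_add ?_ ?_))
    · exact hJ.measureReal_not_goodRun_le hM hl' 1 he₁ hl' hb₁ le_rfl
    · exact hJ.measureReal_not_goodII_le hM hlT (by lia) he₂ hb₂
  -- The loss is at most `rTot * T` and vanishes off `S`.
  have hmain : ∫ ω, f (fun t => J t ω) ∂μ ≤ M.rTot * T * μ.real S := by
    calc ∫ ω, f (fun t => J t ω) ∂μ ≤ ∫ ω, S.indicator (fun _ => M.rTot * T) ω ∂μ := by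
          refine integral_mono hint ((integrable_const _).indicator hSm) fun ω => ?_
          by_cases hω : ω ∈ S
          · simp only [Set.indicator_of_mem hω]
            exact hfb _
          · simp only [Set.indicator_of_notMem hω]
            exact not_lt.1 hω
      _ = M.rTot * T * μ.real S := by
          rw [integral_indicator_const _ hSm, smul_eq_mul, mul_comm]
  rw [abs_of_nonneg (integral_nonneg fun ω => hf0 _)]
  refine hmain.trans ?_
  have hRT : 0 ≤ M.rTot * T := by positivity
  have ht1 : 0 ≤ M.tailBound (len1 T α) e₁ := (Real.exp_pos _).le
  calc M.rTot * T * μ.real S ≤ M.rTot * T * ((6 * n + 2) * M.tailBound (len1 T α) e₁ +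
        (6 * n + 2) * M.tailBound T e₂) := by
        refine mul_le_mul_of_nonneg_left (hPS.trans (add_le_add_left ?_ _)) hRT
        refine mul_le_mul_of_nonneg_right ?_ ht1
        have : (0 : ℝ) ≤ n := Nat.cast_nonneg n
        linarith
    _ = _ := by ring

end Fluctuations


/-! ### Asymptotics -/

section Asymptotics

variable {T : ℕ} {α β γ ε K : ℝ}

lemma len1_le_two_mul (hT : 1 ≤ T) (hα : 0 ≤ α) : (len1 T α : ℝ) ≤ 2 * (T : ℝ) ^ α := by
  have h1 := len1_le T α
  have h2 := Real.one_le_rpow (show (1 : ℝ) ≤ T by exact_mod_cast hT) hα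
  linarith

lemma four_le_sqrt (hT : 16 ≤ T) : 4 ≤ √(T : ℝ) :=
  Real.le_sqrt_of_sq_le (by norm_num; exact_mod_cast hT)

/-- Lengths of the phases. -/
lemma exists_len3 (hT : 16 ≤ T) (hα : 0 < α ∧ α < 1 / 2) (hβ : 0 < β ∧ β < 1 / 2) :
    ∃ k : ℕ, len1 T α + len2 T α β + k = T ∧ (k : ℝ) ≤ (T : ℝ) ^ (1 / 2 + β) ∧
      (T : ℝ) ^ (1 / 2 + β) / 2 ≤ k := by
  have hT' : (16 : ℝ) ≤ T := by exact_mod_cast hT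
  have hT1 : (1 : ℝ) ≤ T := by linarith
  have h4 := four_le_sqrt hT
  have hsq : √(T : ℝ) * √(T : ℝ) = T := Real.mul_self_sqrt (by linarith)
  have h1 : (T : ℝ) ^ α ≤ √(T : ℝ) := by
    rw [Real.sqrt_eq_rpow]
    exact Real.rpow_le_rpow_of_exponent_le hT1 hα.2.le
  have h2 : √(T : ℝ) ≤ (T : ℝ) ^ (1 / 2 + β) := by
    rw [Real.sqrt_eq_rpow]
    exact Real.rpow_le_rpow_of_exponent_le hT1 (by linarith)
  have h3 : (T : ℝ) ^ (1 / 2 + β) ≤ T := by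
    conv_rhs => rw [← Real.rpow_one (T : ℝ)]
    exact Real.rpow_le_rpow_of_exponent_le hT1 (by linarith)
  have hl1 := le_len1 T α
  have hl2 := len1_le T α
  have hl3 : (T : ℝ) - (T : ℝ) ^ α - (T : ℝ) ^ (1 / 2 + β) ≤ len2 T α β := Nat.le_ceil _
  -- If phase II is nonempty, the two ceilings cost at most `2`, and `T^b / 2 ≥ √T / 2 ≥ 2`. If it
  -- is empty, `T^a + 1 + T^b / 2 ≤ √T + 1 + T / 2 ≤ T`.
  have hle : (len1 T α : ℝ) + len2 T α β + (T : ℝ) ^ (1 / 2 + β) / 2 ≤ T := by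
    rcases le_or_gt ((T : ℝ) - (T : ℝ) ^ α - (T : ℝ) ^ (1 / 2 + β)) 0 with h | h
    · have : len2 T α β = 0 := Nat.ceil_eq_zero.2 h
      rw [this, Nat.cast_zero]
      nlinarith
    · have : (len2 T α β : ℝ) < (T : ℝ) - (T : ℝ) ^ α - (T : ℝ) ^ (1 / 2 + β) + 1 :=
        Nat.ceil_lt_add_one h.le
      linarith
  have hnat : len1 T α + len2 T α β ≤ T := by
    have : (len1 T α : ℝ) + len2 T α β ≤ T := by linarith
    exact_mod_cast this
  have hk : ((T - (len1 T α + len2 T α β) : ℕ) : ℝ) = T - (len1 T α + len2 T α β) := by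
    rw [Nat.cast_sub hnat]; push_cast; rfl
  refine ⟨T - (len1 T α + len2 T α β), by lia, ?_, ?_⟩ <;> rw [hk] <;> linarith

/-- The allowed fluctuation `T^c / (4K)` takes a quarter of `T^c`; the term `K √l₁`, of order `K
T^(a/2)`, is absorbed by `T^γ ≥ 8K`. -/
lemma classification_threshold (hT : 16 ≤ T) (hα : 0 < α) (hK : 1 ≤ K)
    (hγ : 8 * K ≤ (T : ℝ) ^ γ) :
    K * ((T : ℝ) ^ (α / 2 + γ) / (4 * K) + 1 + √(len1 T α : ℝ)) ≤ (T : ℝ) ^ (α / 2 + γ) := by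
  have hT1 : (1 : ℝ) ≤ T := by exact_mod_cast (by lia)
  have hT0 : (0 : ℝ) < T := by linarith
  have h1 : √(len1 T α : ℝ) ≤ 2 * (T : ℝ) ^ (α / 2) := by
    refine Real.sqrt_le_iff.2 ⟨by positivity, (len1_le_two_mul (by lia) hα.le).trans ?_⟩
    rw [mul_pow, ← Real.rpow_natCast ((T : ℝ) ^ (α / 2)), ← Real.rpow_mul hT0.le]
    have : (T : ℝ) ^ (α / 2 * (2 : ℕ)) = (T : ℝ) ^ α := by norm_num
    rw [this]
    linarith [Real.rpow_pos_of_pos hT0 α]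
  have h2 : 1 ≤ (T : ℝ) ^ (α / 2) := Real.one_le_rpow hT1 (by linarith)
  rw [Real.rpow_add hT0]
  have h3 : K * ((T : ℝ) ^ (α / 2) * (T : ℝ) ^ γ / (4 * K)) =
      (T : ℝ) ^ (α / 2) * (T : ℝ) ^ γ / 4 := by field_simp
  have h4 := mul_le_mul_of_nonneg_left hγ (zero_le_one.trans h2)
  have h5 : K * (1 + √(len1 T α : ℝ)) ≤ K * (3 * (T : ℝ) ^ (α / 2)) :=
    mul_le_mul_of_nonneg_left (by linarith) (by linarith)
  rw [add_assoc, mul_add, h3]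
  nlinarith

lemma fluctuation_le_len3 {k : ℝ} (hT : 16 ≤ T) (hK : 1 ≤ K) (hβ : 8 * K ≤ (T : ℝ) ^ β)
    (hk : (T : ℝ) ^ (1 / 2 + β) / 2 ≤ k) :
    K * ((T : ℝ) ^ (1 / 2 + β) / (4 * K) + 1 + √(T : ℝ)) ≤ k := by
  have hT0 : (0 : ℝ) < T := by exact_mod_cast (by lia)
  have h4 := four_le_sqrt hT
  rw [Real.rpow_add hT0, ← Real.sqrt_eq_rpow] at hk ⊢
  have h3 : K * (√(T : ℝ) * (T : ℝ) ^ β / (4 * K)) = √(T : ℝ) * (T : ℝ) ^ β / 4 := by field_simp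
  have h5 := mul_le_mul_of_nonneg_left hβ (show 0 ≤ √(T : ℝ) by linarith)
  rw [add_assoc, mul_add, h3]
  nlinarith

lemma Model.tailBound_le_exp {N e : ℝ} (h : (T : ℝ) ^ ε * (4 * N * M.incConst ^ 2) ≤ e ^ 2)
    (hM : M.Valid) (hN : 0 < N) : M.tailBound N e ≤ Real.exp (-(T : ℝ) ^ ε) := by
  have hc := hM.one_le_incConst
  refine Real.exp_le_exp.2 (neg_le_neg ?_)
  rwa [le_div_iff₀ (by positivity)]

/-- The square of the fluctuation is of order `T^(a + 2γ)` and the phase has at most `2 T^a`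
periods. The exponent is thus of order `T^(2γ)`, and the factor `T^(2γ - ε)` absorbs the constants.
-/
lemma Model.Valid.tailBound_len1_le (hM : M.Valid) (hT : 1 ≤ T) (hα : 0 ≤ α) (hK : 1 ≤ K)
    (h : 8 * M.incConst ^ 2 * (4 * K) ^ 2 ≤ (T : ℝ) ^ (2 * γ - ε)) :
    M.tailBound (len1 T α) ((T : ℝ) ^ (α / 2 + γ) / (4 * K)) ≤ Real.exp (-(T : ℝ) ^ ε) := by
  have hT0 : (0 : ℝ) < T := by exact_mod_cast hT
  refine Model.tailBound_le_exp ?_ hM (by exact_mod_cast len1_pos hT α)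
  rw [div_pow, le_div_iff₀ (by positivity)]
  have h1 : ((T : ℝ) ^ (α / 2 + γ)) ^ 2 =
      (T : ℝ) ^ ε * ((T : ℝ) ^ (2 * γ - ε) * (T : ℝ) ^ α) := by
    rw [← Real.rpow_natCast, ← Real.rpow_mul hT0.le, ← Real.rpow_add hT0, ← Real.rpow_add hT0]
    congr 1
    push_cast
    ring
  rw [h1, mul_assoc]
  refine mul_le_mul_of_nonneg_left ?_ (Real.rpow_nonneg hT0.le _)
  calc 4 * (len1 T α : ℝ) * M.incConst ^ 2 * (4 * K) ^ 2 =
        4 * M.incConst ^ 2 * (4 * K) ^ 2 * len1 T α := by ring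
    _ ≤ 4 * M.incConst ^ 2 * (4 * K) ^ 2 * (2 * (T : ℝ) ^ α) :=
        mul_le_mul_of_nonneg_left (len1_le_two_mul hT hα) (by positivity)
    _ = 8 * M.incConst ^ 2 * (4 * K) ^ 2 * (T : ℝ) ^ α := by ring
    _ ≤ _ := mul_le_mul_of_nonneg_right h (Real.rpow_nonneg hT0.le _)

/-- Here the exponent is of order `T^(1 + 2β) / T = T^(2β)`, at least `T^(2γ)`. -/
lemma Model.Valid.tailBound_horizon_le (hM : M.Valid) (hT : 1 ≤ T) (hK : 1 ≤ K)
    (hβ : γ ≤ β) (h : 8 * M.incConst ^ 2 * (4 * K) ^ 2 ≤ (T : ℝ) ^ (2 * γ - ε)) :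
    M.tailBound T ((T : ℝ) ^ (1 / 2 + β) / (4 * K)) ≤ Real.exp (-(T : ℝ) ^ ε) := by
  have hT1 : (1 : ℝ) ≤ T := by exact_mod_cast hT
  have hT0 : (0 : ℝ) < T := by linarith
  refine Model.tailBound_le_exp ?_ hM hT0
  rw [div_pow, le_div_iff₀ (by positivity)]
  have h1 : ((T : ℝ) ^ (1 / 2 + β)) ^ 2 = (T : ℝ) ^ ε * ((T : ℝ) ^ (2 * β - ε) * T) := by
    conv_rhs => rw [← Real.rpow_one (T : ℝ)]
    rw [Real.rpow_one, ← Real.rpow_natCast, ← Real.rpow_mul hT0.le, ← Real.rpow_add_one hT0.ne',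
      ← Real.rpow_add hT0]
    congr 1
    push_cast
    ring
  have h2 : (T : ℝ) ^ (2 * γ - ε) ≤ (T : ℝ) ^ (2 * β - ε) :=
    Real.rpow_le_rpow_of_exponent_le hT1 (by linarith)
  have hc : 0 ≤ M.incConst ^ 2 * (4 * K) ^ 2 := by positivity
  rw [h1, mul_assoc]
  refine mul_le_mul_of_nonneg_left ?_ (Real.rpow_nonneg hT0.le _)
  calc 4 * (T : ℝ) * M.incConst ^ 2 * (4 * K) ^ 2 =
        4 * (M.incConst ^ 2 * (4 * K) ^ 2) * T := by ring
    _ ≤ (T : ℝ) ^ (2 * β - ε) * T := mul_le_mul_of_nonneg_right (by linarith) hT0.le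

/-- The lower bound on `ε` says precisely that `T^ε ≥ log T`; with `ε < 2γ` this forces `T^γ → ∞`.
-/
lemma log_le_rpow (hT : 16 ≤ T) (h : Real.log (Real.log T) / Real.log T ≤ ε) :
    Real.log T ≤ (T : ℝ) ^ ε := by
  have hT' : (1 : ℝ) < T := by exact_mod_cast (by lia)
  have hlog : 0 < Real.log T := Real.log_pos hT'
  rw [div_le_iff₀ hlog] at h
  rw [Real.rpow_def_of_pos (by linarith)]
  calc Real.log T = Real.exp (Real.log (Real.log T)) := (Real.exp_log hlog).symm
    _ ≤ _ := Real.exp_le_exp.2 (by linarith)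

end Asymptotics

/-- The powers `T ^ γ` tend to infinity. -/
lemma eventually_le_rpow {γ ε : ℕ → ℝ}
    (hε : ∀ᶠ T : ℕ in atTop, ε T < 2 * γ T ∧ Real.log (Real.log T) / Real.log T ≤ ε T) (K : ℝ) :
    ∀ᶠ T : ℕ in atTop, K ≤ (T : ℝ) ^ γ T := by
  have hlog : Tendsto (fun T : ℕ => Real.log T) atTop atTop :=
    Real.tendsto_log_atTop.comp tendsto_natCast_atTop_atTop
  filter_upwards [hε, hlog.eventually_ge_atTop (K ^ 2), eventually_ge_atTop 16] with T h1 h2 h3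
  have hT1 : (1 : ℝ) ≤ T := by exact_mod_cast (by lia)
  refine le_of_sq_le_sq ?_ (by positivity)
  calc K ^ 2 ≤ (T : ℝ) ^ ε T := h2.trans (log_le_rpow h3 h1.2)
    _ ≤ (T : ℝ) ^ (γ T * (2 : ℕ)) :=
        Real.rpow_le_rpow_of_exponent_le hT1 (by push_cast; linarith [h1.1])
    _ = ((T : ℝ) ^ γ T) ^ 2 := by rw [Real.rpow_mul (by linarith), Real.rpow_natCast]

/-! ### The decomposition of the regret and the three bounds -/

section Regret

variable {Ω : Type*} [MeasurableSpace Ω] {μ : Measure Ω} [IsProbabilityMeasure μ]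
  {J : ℕ → Ω → Fin n} {α β γ ε : ℕ → ℝ}

lemma Model.IsArrivalSequence.regret_split (hJ : M.IsArrivalSequence μ J) (T : ℕ) (α β γ : ℝ) :
    Integrable (fun ω => M.VHO T (fun t => J t ω)) μ ∧
      Integrable (fun ω => M.VHI T α (fun t => J t ω)) μ ∧
      Integrable (fun ω => M.VHII T α β γ (fun t => J t ω)) μ ∧
      Integrable (fun ω => M.VFD T α β γ (fun t => J t ω)) μ ∧
      ∫ ω, (M.VHO T (fun t => J t ω) - M.VFD T α β γ (fun t => J t ω)) ∂μ =
        ∫ ω, (M.VHO T (fun t => J t ω) - M.VHI T α (fun t => J t ω)) ∂μ +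
        ∫ ω, (M.VHI T α (fun t => J t ω) - M.VHII T α β γ (fun t => J t ω)) ∂μ +
        ∫ ω, (M.VHII T α β γ (fun t => J t ω) - M.VFD T α β γ (fun t => J t ω)) ∂μ := by
  have h1 := hJ.integrable_of_dependsOn (M.dependsOn_VHO T)
  have h2 := hJ.integrable_of_dependsOn (M.dependsOn_VHI T α)
  have h3 := hJ.integrable_of_dependsOn (M.dependsOn_VHII T α β γ)
  have h4 := hJ.integrable_of_dependsOn (M.dependsOn_VFD T α β γ)
  refine ⟨h1, h2, h3, h4, ?_⟩
  rw [integral_sub h1 h4, integral_sub h1 h2, integral_sub h2 h3, integral_sub h3 h4]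
  ring

lemma Model.Valid.isBigO_phaseI (hM : M.Valid) (hα : ∀ᶠ T : ℕ in atTop, 0 < α T ∧ α T < 1 / 2)
    (J : ℕ → Ω → Fin n) :
    (fun T : ℕ => ∫ ω, (M.VHO T (fun t => J t ω) - M.VHI T (α T) (fun t => J t ω)) ∂μ)
      =O[atTop] (fun T : ℕ => (T : ℝ) ^ (α T)) := by
  have hr := hM.rTot_nonneg
  refine IsBigO.of_bound (4 * M.rTot) ?_
  filter_upwards [hα, eventually_ge_atTop 16] with T hα hT
  -- Only `l₁ ≤ T` is needed; the value `1 / 4` is arbitrary.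
  obtain ⟨k, hk, -, -⟩ := exists_len3 (β := 1 / 4) hT hα ⟨by norm_num, by norm_num⟩
  have h1 := norm_integral_le_of_norm_le_const (μ := μ)
    (f := fun ω => M.VHO T (fun t => J t ω) - M.VHI T (α T) (fun t => J t ω))
    (Eventually.of_forall fun ω =>
      hM.abs_VHO_sub_VHI_le (T := T) (α := α T) (by lia) (by lia) fun t => J t ω)
  rw [probReal_univ, mul_one] at h1
  refine h1.trans ?_
  rw [Real.norm_of_nonneg (by positivity)]
  have h2 := mul_le_mul_of_nonneg_left (len1_le_two_mul (by lia) hα.1.le : (len1 T (α T) : ℝ) ≤ _)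
    (show 0 ≤ 2 * M.rTot by positivity)
  linarith

lemma Model.IsArrivalSequence.isBigO_phaseII (hJ : M.IsArrivalSequence μ J) (hM : M.Valid)
    (hgen : M.GeneralPosition)
    (hα : ∀ᶠ T : ℕ in atTop, 0 < α T ∧ α T < 1 / 2)
    (hβ : ∀ᶠ T : ℕ in atTop, α T / 2 ≤ β T ∧ β T < 1 / 2)
    (hγ : ∀ᶠ T : ℕ in atTop, 0 < γ T ∧ γ T < α T / 2)
    (hε : ∀ᶠ T : ℕ in atTop, ε T < 2 * γ T ∧ Real.log (Real.log T) / Real.log T ≤ ε T)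
    (hγε : Tendsto (fun T : ℕ => (T : ℝ) ^ (2 * γ T - ε T)) atTop atTop)
    (hαγ : Tendsto (fun T : ℕ => (T : ℝ) ^ (α T / 2 - γ T)) atTop atTop) :
    (fun T : ℕ => ∫ ω, (M.VHI T (α T) (fun t => J t ω) -
        M.VHII T (α T) (β T) (γ T) (fun t => J t ω)) ∂μ)
      =O[atTop] (fun T : ℕ => (T : ℝ) * Real.exp (-(T : ℝ) ^ (ε T))) := by
  obtain ⟨C, K, hC, hK, hbound⟩ := hJ.exists_phaseII_bound hM hgen
  have hc := hM.one_le_incConst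
  refine IsBigO.of_bound (2 * C) ?_
  filter_upwards [hα, hβ, hγ, eventually_le_rpow hε (8 * K), hαγ.eventually_ge_atTop K,
    hγε.eventually_ge_atTop (8 * M.incConst ^ 2 * (4 * K) ^ 2), eventually_ge_atTop 16]
    with T hα hβ hγ hγK hαγ hγε hT
  have hT1 : (1 : ℝ) ≤ T := by exact_mod_cast (by lia)
  -- Fluctuations of size `T^c / (4K)` in phase I and `T^b / (4K)` afterwards are the largest scales
  -- compatible with the thresholds and with the length of phase III.
  have hT0 : (0 : ℝ) < T := by linarith
  have hβ0 : γ T ≤ β T := by linarith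
  obtain ⟨k, hk, -, hk2⟩ := exists_len3 hT hα ⟨by linarith, hβ.2⟩
  have hβK : 8 * K ≤ (T : ℝ) ^ β T :=
    hγK.trans (Real.rpow_le_rpow_of_exponent_le hT1 hβ0)
  have hc2 : K * (T : ℝ) ^ (α T / 2 + γ T) ≤ (T : ℝ) ^ α T := by
    calc K * (T : ℝ) ^ (α T / 2 + γ T) ≤ (T : ℝ) ^ (α T / 2 - γ T) * (T : ℝ) ^ (α T / 2 + γ T) :=
          mul_le_mul_of_nonneg_right hαγ (by positivity)
      _ = (T : ℝ) ^ α T := by rw [← Real.rpow_add hT0]; congr 1; ring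
  have hdiv : ∀ {y : ℝ}, 0 ≤ y → y / (4 * K) ≤ y := fun hy => div_le_self hy (by linarith)
  have he1 : (T : ℝ) ^ (α T / 2 + γ T) / (4 * K) ≤ 2 * len1 T (α T) * M.incConst := by
    have h1 := hdiv (show 0 ≤ (T : ℝ) ^ (α T / 2 + γ T) by positivity)
    have h2 : (T : ℝ) ^ (α T / 2 + γ T) ≤ (T : ℝ) ^ α T :=
      Real.rpow_le_rpow_of_exponent_le hT1 (by linarith)
    have h3 := le_len1 T (α T)
    have h4 : (0 : ℝ) ≤ len1 T (α T) := Nat.cast_nonneg _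
    nlinarith
  have he2 : (T : ℝ) ^ (1 / 2 + β T) / (4 * K) ≤ 2 * T * M.incConst := by
    have h1 := hdiv (show 0 ≤ (T : ℝ) ^ (1 / 2 + β T) by positivity)
    have h2 : (T : ℝ) ^ (1 / 2 + β T) ≤ (T : ℝ) ^ (1 : ℝ) :=
      Real.rpow_le_rpow_of_exponent_le hT1 (by linarith [hβ.2])
    rw [Real.rpow_one] at h2
    nlinarith
  have h := hbound T (α T) (β T) (γ T) k _ _ (by lia) (by positivity) (by positivity) he1 he2 hk
    (classification_threshold hT hα.1 hK hγK) hc2 (fluctuation_le_len3 hT hK hβK hk2)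
  refine h.trans ?_
  rw [Real.norm_of_nonneg (by positivity)]
  have h1 := hM.tailBound_len1_le (α := α T) (by lia) hα.1.le hK hγε
  have h2 := hM.tailBound_horizon_le (by lia) hK hβ0 hγε
  have h3 := mul_le_mul_of_nonneg_left (add_le_add h1 h2) (show 0 ≤ C * T by positivity)
  linarith

/-- The bound `O(T^(3b/4))` already holds; the factor `T^(ε/2) ≥ 1` is slack. -/
lemma Model.IsArrivalSequence.isBigO_phaseIII (hJ : M.IsArrivalSequence μ J) (hM : M.Valid)
    (hα : ∀ᶠ T : ℕ in atTop, 0 < α T ∧ α T < 1 / 2)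
    (hβ : ∀ᶠ T : ℕ in atTop, α T / 2 ≤ β T ∧ β T < 1 / 2)
    (hε : ∀ᶠ T : ℕ in atTop, 0 < ε T) :
    (fun T : ℕ => ∫ ω, (M.VHII T (α T) (β T) (γ T) (fun t => J t ω) -
        M.VFD T (α T) (β T) (γ T) (fun t => J t ω)) ∂μ)
      =O[atTop] (fun T : ℕ => (T : ℝ) ^ (3 / 4 * (1 / 2 + β T) + ε T / 2)) := by
  obtain ⟨K, hK, hbound⟩ := hM.exists_phaseIII_bound
  refine IsBigO.of_bound K ?_
  filter_upwards [hα, hβ, hε, eventually_ge_atTop 16] with T hα hβ hε hT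
  have hT1 : (1 : ℝ) ≤ T := by exact_mod_cast (by lia)
  obtain ⟨k, hk, hk1, hk2⟩ := exists_len3 hT hα ⟨by linarith, hβ.2⟩
  refine (hbound hJ T (α T) (β T) (γ T) k (by lia) (by linarith) hk hk1 hk2).trans ?_
  rw [Real.norm_of_nonneg (by positivity)]
  exact mul_le_mul_of_nonneg_left (Real.rpow_le_rpow_of_exponent_le hT1 (by linarith)) hK

end Regret

end NRM

theorem proposition4 {m n : ℕ} (M : NRM.Model m n) (hM : M.Valid) (hgen : M.GeneralPosition)
    {Ω : Type*} [MeasurableSpace Ω] (μ : Measure Ω) [IsProbabilityMeasure μ]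
    (J : ℕ → Ω → Fin n) (hJ_meas : ∀ t, Measurable (J t)) (hJ_indep : iIndepFun J μ)
    (hJ_law : ∀ t j, μ.real (J t ⁻¹' {j}) = M.lam j)
    -- parameters, which may depend on the horizon
    (α β γ ε : ℕ → ℝ)
    (hα : ∀ᶠ T : ℕ in atTop, 0 < α T ∧ α T < 1 / 2)
    (hβ : ∀ᶠ T : ℕ in atTop, α T / 2 ≤ β T ∧ β T < 1 / 2)
    (hγ : ∀ᶠ T : ℕ in atTop, 0 < γ T ∧ γ T < α T / 2)
    (hε : ∀ᶠ T : ℕ in atTop, 0 < ε T ∧ ε T < 2 * γ T ∧ ε T ≤ β T ∧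
      Real.log (Real.log T) / Real.log T ≤ ε T)
    -- asymptotic form of the strict inequalities `ε < 2γ` and `γ < α/2`;
    -- both hold automatically when the parameters do not depend on `T`
    (hγε : Tendsto (fun T : ℕ => (T : ℝ) ^ (2 * γ T - ε T)) atTop atTop)
    (hαγ : Tendsto (fun T : ℕ => (T : ℝ) ^ (α T / 2 - γ T)) atTop atTop) :
    -- the revenues are integrable, and the regret splits over the three phases
    (∀ T : ℕ,
      Integrable (fun ω => M.VHO T (fun t => J t ω)) μ ∧
      Integrable (fun ω => M.VHI T (α T) (fun t => J t ω)) μ ∧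
      Integrable (fun ω => M.VHII T (α T) (β T) (γ T) (fun t => J t ω)) μ ∧
      Integrable (fun ω => M.VFD T (α T) (β T) (γ T) (fun t => J t ω)) μ ∧
      ∫ ω, (M.VHO T (fun t => J t ω) - M.VFD T (α T) (β T) (γ T) (fun t => J t ω)) ∂μ =
        ∫ ω, (M.VHO T (fun t => J t ω) - M.VHI T (α T) (fun t => J t ω)) ∂μ +
        ∫ ω, (M.VHI T (α T) (fun t => J t ω) -
          M.VHII T (α T) (β T) (γ T) (fun t => J t ω)) ∂μ +
        ∫ ω, (M.VHII T (α T) (β T) (γ T) (fun t => J t ω) -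
          M.VFD T (α T) (β T) (γ T) (fun t => J t ω)) ∂μ) ∧
    -- (1)
    (fun T : ℕ => ∫ ω, (M.VHO T (fun t => J t ω) - M.VHI T (α T) (fun t => J t ω)) ∂μ)
      =O[atTop] (fun T : ℕ => (T : ℝ) ^ (α T)) ∧
    -- (2)
    (fun T : ℕ => ∫ ω, (M.VHI T (α T) (fun t => J t ω) -
        M.VHII T (α T) (β T) (γ T) (fun t => J t ω)) ∂μ)
      =O[atTop] (fun T : ℕ => (T : ℝ) * Real.exp (-(T : ℝ) ^ (ε T))) ∧
    -- (3)
    (fun T : ℕ => ∫ ω, (M.VHII T (α T) (β T) (γ T) (fun t => J t ω) -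
        M.VFD T (α T) (β T) (γ T) (fun t => J t ω)) ∂μ)
      =O[atTop] (fun T : ℕ => (T : ℝ) ^ (3 / 4 * (1 / 2 + β T) + ε T / 2)) := by
  have hJ : M.IsArrivalSequence μ J := ⟨hJ_meas, hJ_indep, hJ_law⟩
  exact ⟨fun T => hJ.regret_split T (α T) (β T) (γ T), hM.isBigO_phaseI hα J,
    hJ.isBigO_phaseII hM hgen hα hβ hγ (hε.mono fun _ h => ⟨h.2.1, h.2.2.2⟩) hγε hαγ,
    hJ.isBigO_phaseIII hM hα hβ (hε.mono fun _ h => h.1)⟩
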